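/- Let $N\ge 3$ be an integer and $p>1$ a real number, and put $K=\frac{(N-2)p-N}{p-1}$, $L=\frac{(N-2)p-(N+2)}{p-1}$. For $M\in\mathbb R$ consider the planar system $$x'=\tfrac{2}{p-1}x-y,\qquad y'=-Ky+|x|^{p-1}x+M|y|^{\frac{2p}{p+1}}.\qquad (S_M)$$ Let $$\overline M=\frac{(p+1)\left((N-2)p-N-2\right)}{(4p)^{\frac{p}{p+1}}\left((N-2)(p-1)^2+4\right)^{\frac1{p+1}}}.$$ When $(S_M)$ has an equilibrium in the open first quadrant, let $P_M=(X_M,\frac{2}{p-1}X_M)$ denote the one with the largest abscissa $X_M>0$ (for $p\ge\frac{N}{N-2}$ there is at most one; for $p<\frac{N}{N-2}$ there may be two). (i) If $p>\frac{N+2}{N-2}$, then $\overline M>0$, $P_{\overline M}$ exists, $P_{\overline M}$ is a weak sink of $(S_{\overline M})$, and it is an Andronov–Hopf bifurcation point of the family $(S_M)$ at $M=\overline M$, with limit cycles for $M>\overline M$. (ii) If $p<\frac{N+2}{N-2}$, then $\overline M<0$, $P_{\overline M}$ exists, and $P_{\overline M}$ is a weak source of $(S_{\overline M})$. In both cases the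 first Lyapunov coefficient of $(S_{\overline M})$ at $P_{\overline M}$ is defined and has the sign of $-L$. Here a *weak sink* is an asymptotically stable equilibrium $P$ such that every solution $z$ that starts close enough to $P$, with $z(0)\neq P$, satisfies $e^{ct}\,|z(t)-P|\to\infty$ as $t\to\infty$ for every $c>0$; a *weak source* is a weak sink of the system obtained by changing $t$ into $-t$. *Andronov–Hopf bifurcation point at $\overline M$, with limit cycles for $M>\overline M$* means: the map $M\mapsto P_M$ is continuous at $\overline M$; for $M$ near $\overline M$ the point $P_M$ is an equilibrium at which the linearization has eigenvalues $a(M)\pm i\,b(M)$ with $b(M)>0$, $a(\overline M)=0$ and $a'(\overline M)>0$; and for every neighbourhood $U$ of $P_{\overline M}$ there is $\varepsilon>0$ such that for all $M\in(\overline M,\overline M+\varepsilon)$ the system $(S_M)$ has a nonconstant periodic orbit contained in $U$ which is the $\omega$-limit set of a trajectory outside it and whose complement has a bounded connected component containing $P_M$. The *first Lyapunov coefficient* is the number $$\tfrac1{16}(f_{uuu}+f_{uvv}+g_{uuv}+g_{vvv})+\tfrac1{16\omega}\left(f_{uv}(f_{uu}+f_{vv})-g_{uv}(g_{uu}+g_{vv})-f_{uu}g_{uu}+f_{vv}g_{vv}\right)$$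 (derivatives at the origin), computed in any linear coordinates $(u,v)$ centred at the equilibrium in which the system reads $u'=-\omega v+f(u,v)$, $v'=\omega u+g(u,v)$ with $\omega>0$ and $f,g$ of higher order (such coordinates exist, and the sign is asserted for all of them). -/

import Mathlib

open Filter Topology

noncomputable section

/-! The planar system -/

/-- `K = ((N - 2) p - N) / (p - 1)`. -/
def coefK (N : ℕ) (p : ℝ) : ℝ := (((N : ℝ) - 2) * p - N) / (p - 1)

/-- `L = ((N - 2) p - (N + 2)) / (p - 1)`. -/
def coefL (N : ℕ) (p : ℝ) : ℝ := (((N : ℝ) - 2) * p - (N + 2)) / (p - 1)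

/-- The vector field of the autonomous system
`x' = 2 x / (p - 1) - y`, `y' = - K y + |x| ^ (p - 1) x + M |y| ^ (2 p / (p + 1))`. -/
def phaseField (N : ℕ) (p M : ℝ) (z : ℝ × ℝ) : ℝ × ℝ :=
  (2 / (p - 1) * z.1 - z.2,
    -coefK N p * z.2 + |z.1| ^ (p - 1) * z.1 + M * |z.2| ^ (2 * p / (p + 1)))

/-- The critical value of the parameter `M`. -/
def Mbar (N : ℕ) (p : ℝ) : ℝ :=
  (p + 1) * (((N : ℝ) - 2) * p - N - 2) /
    ((4 * p) ^ (p / (p + 1)) * (((N : ℝ) - 2) * (p - 1) ^ 2 + 4) ^ (1 / (p + 1)))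

/-- Abscissae of the equilibria in the open first quadrant
(the first equation of the system forces `y = 2 x / (p - 1)`). -/
def equilibriumAbscissae (N : ℕ) (p M : ℝ) : Set ℝ :=
  {X | 0 < X ∧ phaseField N p M (X, 2 / (p - 1) * X) = 0}

/-- The equilibrium `P_M`: the one in the open first quadrant which is farthest from the origin.
It is the only one there if `p ≥ N / (N - 2)`; when there are two of them it is the second one.
The supremum is meaningful when the set has a greatest element. -/
def pointP (N : ℕ) (p M : ℝ) : ℝ × ℝ :=
  (sSup (equilibriumAbscissae N p M), 2 / (p - 1) * sSup (equilibriumAbscissae N p M))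

/-! Stability notions for an autonomous planar system `z' = F z` -/

/-- `z` solves `z' = F z` on the set of times `s`. -/
def IsSolutionOn (F : ℝ × ℝ → ℝ × ℝ) (z : ℝ → ℝ × ℝ) (s : Set ℝ) : Prop :=
  ∀ t ∈ s, HasDerivWithinAt z (F (z t)) s t

/-- Asymptotically stable equilibrium: solutions starting near `P` exist for all positive times,
stay near `P`, and tend to `P`. -/
def IsAsymptoticallyStable (F : ℝ × ℝ → ℝ × ℝ) (P : ℝ × ℝ) : Prop :=
  F P = 0 ∧
  (∃ δ > 0, ∀ z₀ : ℝ × ℝ, dist z₀ P < δ → ∃ z, IsSolutionOn F z (Set.Ici 0) ∧ z 0 = z₀) ∧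
  (∀ ε > 0, ∃ δ > 0, ∀ z, IsSolutionOn F z (Set.Ici 0) → dist (z 0) P < δ →
    ∀ t ≥ 0, dist (z t) P < ε) ∧
  (∃ δ > 0, ∀ z, IsSolutionOn F z (Set.Ici 0) → dist (z 0) P < δ → Tendsto z atTop (𝓝 P))

/-- Weak sink: an asymptotically stable equilibrium which attracts the nearby points at a rate
slower than any exponential rate. -/
def IsWeakSink (F : ℝ × ℝ → ℝ × ℝ) (P : ℝ × ℝ) : Prop :=
  IsAsymptoticallyStable F P ∧
  ∃ δ > 0, ∀ z, IsSolutionOn F z (Set.Ici 0) → 0 < dist (z 0) P → dist (z 0) P < δ →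
    ∀ c > 0, Tendsto (fun t : ℝ => Real.exp (c * t) * dist (z t) P) atTop atTop

/-- Weak source: a weak sink of the system obtained by changing `t` into `-t`. -/
def IsWeakSource (F : ℝ × ℝ → ℝ × ℝ) (P : ℝ × ℝ) : Prop :=
  IsWeakSink (fun z => -F z) P

/-! The Andronov-Hopf bifurcation -/

/-- `γ` runs along an (`ω`-)limit cycle of `z' = F z` surrounding `P`: a nonconstant periodic
solution whose orbit is the `ω`-limit set of a trajectory outside this orbit, and such that `P`
belongs to a bounded connected component of the complement of the orbit. -/
def IsLimitCycleAround (F : ℝ × ℝ → ℝ × ℝ) (P : ℝ × ℝ) (γ : ℝ → ℝ × ℝ) : Prop :=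
  IsSolutionOn F γ Set.univ ∧
  (∃ T > 0, Function.Periodic γ T) ∧
  (∃ t, γ t ≠ γ 0) ∧
  (∃ w, IsSolutionOn F w (Set.Ici 0) ∧ w 0 ∉ Set.range γ ∧
    {Q | MapClusterPt Q atTop w} = Set.range γ) ∧
  P ∉ Set.range γ ∧ Bornology.IsBounded (connectedComponentIn (Set.range γ)ᶜ P)

/-- The branch of equilibria `l ↦ z l` of `w' = F l w` undergoes an Andronov-Hopf bifurcation at
`l = l₀`, with cycles for `l > l₀`: near `l₀` the linearization at `z l` has a pair of conjugate
nonreal eigenvalues `a l ± i b l` which crosses the imaginary axis from left to right, with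
nonzero speed, at `l = l₀`; and, however small a neighbourhood of `z l₀` is, it contains a limit
cycle surrounding `z l` as soon as `l > l₀` is close enough to `l₀`. -/
def IsAndronovHopfPoint (F : ℝ → ℝ × ℝ → ℝ × ℝ) (z : ℝ → ℝ × ℝ) (l₀ : ℝ) : Prop :=
  ContinuousAt z l₀ ∧
  (∃ a b : ℝ → ℝ,
    (∀ᶠ l in 𝓝 l₀, F l (z l) = 0 ∧ DifferentiableAt ℝ (F l) (z l) ∧ 0 < b l ∧
      ((fderiv ℝ (F l) (z l)).toLinearMap.charpoly.map (algebraMap ℝ ℂ)).roots =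
        {(a l : ℂ) + b l * Complex.I, (a l : ℂ) - b l * Complex.I}) ∧
    a l₀ = 0 ∧ ∃ a' > 0, HasDerivAt a a' l₀) ∧
  ∀ U ∈ 𝓝 (z l₀), ∃ ε > 0, ∀ l ∈ Set.Ioo l₀ (l₀ + ε),
    ∃ γ, IsLimitCycleAround (F l) (z l) γ ∧ Set.range γ ⊆ U

/-! The first Lyapunov coefficient -/

/-- The field `F` read in the linear coordinates `ζ = A (z - P)`. -/
def chartField (F : ℝ × ℝ → ℝ × ℝ) (P : ℝ × ℝ) (A : (ℝ × ℝ) ≃L[ℝ] (ℝ × ℝ)) (ζ : ℝ × ℝ) :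
    ℝ × ℝ :=
  A (F (P + A.symm ζ))

/-- The coordinates `A (z - P) = (u, v)` put the system at the equilibrium `P` into the form
`u' = - ω v + f (u, v)`, `v' = ω u + g (u, v)`, with `ω > 0` and `f`, `g` of higher order. -/
def IsHopfChart (F : ℝ × ℝ → ℝ × ℝ) (P : ℝ × ℝ) (A : (ℝ × ℝ) ≃L[ℝ] (ℝ × ℝ)) (ω : ℝ) : Prop :=
  0 < ω ∧ F P = 0 ∧ DifferentiableAt ℝ F P ∧
    ∀ h : ℝ × ℝ, A (fderiv ℝ F P h) = (-ω * (A h).2, ω * (A h).1)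

/-- The partial derivative `∂_u ^ i ∂_v ^ j φ` at the origin. -/
def partialAtZero (i j : ℕ) (φ : ℝ × ℝ → ℝ) : ℝ :=
  iteratedDeriv i (fun u => iteratedDeriv j (fun v => φ (u, v)) 0) 0

/-- The classical formula for the first Lyapunov coefficient (the coefficient of the cubic term
`r ^ 3` in the normal form of `r'`) of a system `u' = - ω v + f`, `v' = ω u + g` given by the
field `G`; only derivatives of order two and three occur, so that those of `f` and `g` are those
of the components of `G`. -/
def lyapunovCoeff (G : ℝ × ℝ → ℝ × ℝ) (ω : ℝ) : ℝ :=
  let f (i j : ℕ) : ℝ := partialAtZero i j (fun ζ => (G ζ).1)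
  let g (i j : ℕ) : ℝ := partialAtZero i j (fun ζ => (G ζ).2)
  (f 3 0 + f 1 2 + g 2 1 + g 0 3) / 16 +
    (f 1 1 * (f 2 0 + f 0 2) - g 1 1 * (g 2 0 + g 0 2) - f 2 0 * g 2 0 + f 0 2 * g 0 2) / (16 * ω)

/-- The first Lyapunov coefficient of `z' = F z` at `P` is defined (there are coordinates which
bring the linear part to a rotation) and, in all such coordinates, has the sign `σ`. -/
def LyapunovSignEq (F : ℝ × ℝ → ℝ × ℝ) (P : ℝ × ℝ) (σ : SignType) : Prop :=
  (∃ A ω, IsHopfChart F P A ω) ∧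
  ∀ A ω, IsHopfChart F P A ω → SignType.sign (lyapunovCoeff (chartField F P A) ω) = σ

end

/-! Write a = 2/(p-1), q = 2p/(p+1) and Y = aX. At an equilibrium the trace of the linearization is
-L + M q Y^(q-1). It vanishes at M = `Mbar` and X = `critX`, where X^(p-1) = a² + L/p; there the
linear part has determinant N-2, so its eigenvalues are ±i√(N-2). `Mbar_mul` and `isGreatest_critX`
identify this point with the equilibrium farthest from the origin.

The stability of such a focus is decided at third order. In suitable linear coordinates one corrects
u²+v² by cubic and quartic terms into a function V whose derivative along the flow is c(u²+v²)² up
to higher order (`exists_quartic_lyapunov`). Here c is a positive multiple of `focalValue`, and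
inserting the derivatives of x^p and M y^q turns that into -L times a positive factor
(`focalValue_eq`). The same number is, up to a positive factor, the first Lyapunov coefficient in
every admissible chart (`lyapunovCoeff_eq`). If L > 0 then V' lies between two negative multiples of
V², so 1/V grows linearly, and the distance to the equilibrium decays like t^(-1/2): convergence,
but slower than any exponential (`QuarticDecay.isWeakSink`). If L < 0 the same argument applies to
the reversed field.

For the bifurcation (L > 0, hence `Mbar` > 0) the equilibrium equation is solved for M as a strictly
decreasing function of X near `critX`; its local inverse is the branch of equilibria. Half the trace
along this branch has positive derivative in M, so for M slightly above `Mbar` the equilibrium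
repels, while on a fixed annulus V still decreases, by compactness. The field also rotates around
the equilibrium, so the orbits in the annulus are graphs r(θ) of solutions of a scalar equation that
is 2π-periodic in θ. This makes the Poincaré–Bendixson theorem unnecessary: the solution starting at
the outermost point of a level of V on one ray is strictly smaller after one turn, its values after
successive turns decrease to a limit, and this limit starts a periodic solution, which is the limit
cycle (`exists_periodic_solution`, `TrappingAnnulus.exists_limitCycle`). -/

/-! ### Global solutions of ordinary differential equations -/

/-- Global existence for a bounded, globally Lipschitz time-dependent vector field. -/
theorem exists_global_solution {E : Type*} [NormedAddCommGroup E] [NormedSpace ℝ E]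
    [CompleteSpace E] {f : ℝ → E → E} {K B : NNReal} (hL : ∀ t, LipschitzWith K (f t))
    (hc : ∀ x, Continuous fun t => f t x) (hB : ∀ t x, ‖f t x‖ ≤ B) (x₀ : E) :
    ∃ α : ℝ → E, α 0 = x₀ ∧ ∀ t, HasDerivAt α (f t (α t)) t := by
  have key : ∀ n : ℕ, ∃ α : ℝ → E, α 0 = x₀ ∧
      ∀ t ∈ Set.Ioo (-(n + 1 : ℝ)) (n + 1), HasDerivAt α (f t (α t)) t := by
    intro n
    have h0 : (0 : ℝ) ∈ Set.Icc (-(n + 1 : ℝ)) (n + 1) := ⟨by linarith [n.cast_nonneg (α := ℝ)],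
      by positivity⟩
    -- A curve of speed at most B covers at most B(n+1) in time n+1, so with this radius the
    -- Picard–Lindelöf interval is not shortened.
    have hpl : IsPicardLindelof f (⟨0, h0⟩ : Set.Icc (-(n + 1 : ℝ)) (n + 1)) x₀
        (B * (n + 1)) 0 B K :=
      { lipschitzOnWith := fun t _ => (hL t).lipschitzOnWith
        continuousOn := fun x _ => (hc x).continuousOn
        norm_le := fun t _ x _ => hB t x
        mul_max_le := by simp }
    obtain ⟨α, h1, h2⟩ := hpl.exists_eq_forall_mem_Icc_hasDerivWithinAt₀
    exact ⟨α, h1, fun t ht => (h2 t (Set.Ioo_subset_Icc_self ht)).hasDerivAt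
      (Icc_mem_nhds ht.1 ht.2)⟩
  choose α h0 hα using key
  have heq : ∀ m n : ℕ, m ≤ n → Set.EqOn (α m) (α n) (Set.Ioo (-(m + 1 : ℝ)) (m + 1)) := by
    intro m n hmn
    have hmn' : (m : ℝ) ≤ n := by exact_mod_cast hmn
    refine ODE_solution_unique_of_mem_Ioo (K := K) (v := f) (s := fun _ => Set.univ) (t₀ := 0)
      (fun t _ => (hL t).lipschitzOnWith) ⟨by linarith [m.cast_nonneg (α := ℝ)], by positivity⟩
      (fun t ht => ⟨hα m t ht, trivial⟩) (fun t ht => ⟨hα n t ⟨?_, ?_⟩, trivial⟩)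
      ((h0 m).trans (h0 n).symm)
    · linarith [ht.1]
    · linarith [ht.2]
  have hfl : ∀ t : ℝ, t ∈ Set.Ioo (-((⌈|t|⌉₊ : ℝ) + 1)) ((⌈|t|⌉₊ : ℝ) + 1) := by
    intro t
    have := Nat.le_ceil |t|
    have := abs_le.1 this
    exact ⟨by linarith, by linarith⟩
  refine ⟨fun t => α ⌈|t|⌉₊ t, by simp [h0], fun t => ?_⟩
  set n := ⌈|t|⌉₊ with hn
  refine (hα n t (hfl t)).congr_of_eventuallyEq ?_
  filter_upwards [Ioo_mem_nhds (hfl t).1 (hfl t).2] with s hs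
  rcases le_total n ⌈|s|⌉₊ with h | h
  · exact (heq _ _ h hs).symm
  · exact heq _ _ h (hfl s)

/-- The solution of `θ' = f θ`, `θ 0 = 0`, for a positive continuous `f` bounded away from zero
and from infinity. -/
theorem exists_time_change {f : ℝ → ℝ} (hf : Continuous f) {m B : ℝ} (hm : 0 < m)
    (hmf : ∀ x, m ≤ f x) (hB : ∀ x, f x ≤ B) :
    ∃ θ : ℝ → ℝ, θ 0 = 0 ∧ StrictMono θ ∧ Function.Surjective θ ∧
      (∀ t, HasDerivAt θ (f (θ t)) t) ∧
      ∀ c > 0, Function.Periodic f c → ∃ T > 0, ∀ t, θ (t + T) = θ t + c := by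
  have hpos : ∀ x, 0 < f x := fun x => hm.trans_le (hmf x)
  have hBpos : 0 < B := (hpos 0).trans_le (hB 0)
  have hk : Continuous fun x => (f x)⁻¹ := hf.inv₀ fun x => (hpos x).ne'
  -- Since f is only continuous, the equation is solved by separation of variables: τ is the time as
  -- a function of the position, and θ is its inverse.
  set τ : ℝ → ℝ := fun x => ∫ y in (0 : ℝ)..x, (f y)⁻¹ with hτ
  have hτd : ∀ x, HasDerivAt τ (f x)⁻¹ x := fun x =>
    intervalIntegral.integral_hasDerivAt_right (hk.intervalIntegrable _ _)
      (hk.stronglyMeasurableAtFilter _ _) hk.continuousAt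
  have hτ0 : τ 0 = 0 := by simp [hτ]
  have hτm : StrictMono τ := strictMono_of_deriv_pos fun x => by
    rw [(hτd x).deriv]; exact inv_pos.2 (hpos x)
  have hτc : Continuous τ := continuous_iff_continuousAt.2 fun x => (hτd x).continuousAt
  -- The bound f ≤ B gives τ slope at least 1/B, so τ is onto and its inverse is defined for all
  -- times.
  have hlow : Monotone fun x => τ x - x * B⁻¹ := by
    have hd : ∀ x, HasDerivAt (fun x => τ x - x * B⁻¹) ((f x)⁻¹ - 1 * B⁻¹) x := fun x =>
      (hτd x).sub ((hasDerivAt_id x).mul_const B⁻¹)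
    refine monotone_of_deriv_nonneg (fun x => (hd x).differentiableAt) fun x => ?_
    rw [(hd x).deriv, one_mul, sub_nonneg]
    exact inv_anti₀ (hpos x) (hB x)
  have hsurj : Function.Surjective τ := by
    refine hτc.surjective ?_ ?_
    · refine tendsto_atTop_mono' _ ?_ (tendsto_id.atTop_mul_const (inv_pos.2 hBpos))
      filter_upwards [eventually_ge_atTop 0] with x hx
      have := hlow hx
      simp only [hτ0, zero_mul, sub_zero, id] at this ⊢
      linarith
    · refine tendsto_atBot_mono' _ ?_ (tendsto_id.atBot_mul_const (inv_pos.2 hBpos))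
      filter_upwards [eventually_le_atBot 0] with x hx
      have := hlow hx
      simp only [hτ0, zero_mul, sub_zero, id] at this ⊢
      linarith
  set e : ℝ ≃o ℝ := hτm.orderIsoOfSurjective τ hsurj with he
  have hleft : ∀ x, e.symm (τ x) = x := fun x => e.symm_apply_apply x
  have hright : ∀ t, τ (e.symm t) = t := fun t => e.apply_symm_apply t
  refine ⟨e.symm, by simpa [hτ0] using hleft 0, e.symm.strictMono, e.symm.surjective, fun t => ?_,
    fun c hc hper => ⟨τ c, by simpa [hτ0] using hτm hc, fun t => ?_⟩⟩
  · have := HasDerivAt.of_local_left_inverse (f := τ) (g := e.symm) (a := t)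
      e.symm.continuous.continuousAt (hτd _) (inv_ne_zero (hpos _).ne')
      (Eventually.of_forall hright)
    rwa [inv_inv] at this
  · have hadd : τ (e.symm t + c) = t + τ c := by
      have h1 : τ (e.symm t + c) = τ c + ∫ y in c..(e.symm t + c), (f y)⁻¹ :=
        (intervalIntegral.integral_add_adjacent_intervals (hk.intervalIntegrable _ _)
          (hk.intervalIntegrable _ _)).symm
      have h2 : ∫ y in c..(e.symm t + c), (f y)⁻¹ = τ (e.symm t) := by
        have := intervalIntegral.integral_comp_add_right (a := 0) (b := e.symm t)
          (fun y => (f y)⁻¹) c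
        rw [zero_add] at this
        rw [← this]
        simp only [hτ, hper _]
      rw [h1, h2, hright]; ring
    rw [← hadd, hleft]

/-! ### Lyapunov functions and weak sinks -/

/-- A continuous function which passes from below `e` to above `e` has a first time at `e`. -/
theorem exists_first_exit {g : ℝ → ℝ} (hg : ContinuousOn g (Set.Ici 0)) {e t : ℝ} (h0 : g 0 < e)
    (ht : 0 ≤ t) (h : e ≤ g t) : ∃ s, 0 < s ∧ s ≤ t ∧ g s = e ∧ ∀ u, 0 ≤ u → u < s → g u < e := by
  set S : Set ℝ := Set.Icc 0 t ∩ g ⁻¹' Set.Ici e with hS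
  have hcl : IsClosed S :=
    (hg.mono Set.Icc_subset_Ici_self).preimage_isClosed_of_isClosed isClosed_Icc isClosed_Ici
  have hne : S.Nonempty := ⟨t, ⟨ht, le_rfl⟩, h⟩
  have hbd : BddBelow S := ⟨0, fun x hx => hx.1.1⟩
  have hmem : sInf S ∈ S := hcl.csInf_mem hne hbd
  have hlt : ∀ u, 0 ≤ u → u < sInf S → g u < e := by
    intro u hu hus
    by_contra hcon
    exact absurd (csInf_le hbd ⟨⟨hu, hus.le.trans hmem.1.2⟩, not_lt.1 hcon⟩) (not_le.2 hus)
  have hpos : 0 < sInf S := by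
    rcases hmem.1.1.lt_or_eq with h' | h'
    · exact h'
    · have := hmem.2
      rw [← h'] at this
      exact absurd this (not_le.2 h0)
  refine ⟨sInf S, hpos, hmem.1.2, le_antisymm ?_ hmem.2, hlt⟩
  by_contra hcon
  push Not at hcon
  obtain ⟨u, hu, hgu⟩ := intermediate_value_Ico hpos.le
    (hg.mono (Set.Icc_subset_Ici_self)) ⟨h0.le, hcon⟩
  exact absurd hgu (hlt u hu.1 hu.2).ne

/-- A nonnegative function with `- C w ^ 2 ≤ w' ≤ - c w ^ 2` decays like `1 / t`. -/
theorem inv_bounds_of_deriv_bounds {w w' : ℝ → ℝ} {c C : ℝ} (hC : 0 ≤ C) (hc : 0 ≤ c)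
    (hw : ContinuousOn w (Set.Ici 0)) (hd : ∀ t, 0 < t → HasDerivAt w (w' t) t)
    (hnn : ∀ t, 0 ≤ t → 0 ≤ w t) (hl : ∀ t, 0 < t → -C * w t ^ 2 ≤ w' t)
    (hu : ∀ t, 0 < t → w' t ≤ -c * w t ^ 2) (h0 : 0 < w 0) {t : ℝ} (ht : 0 ≤ t) :
    0 < w t ∧ (w 0)⁻¹ + c * t ≤ (w t)⁻¹ ∧ (w t)⁻¹ ≤ (w 0)⁻¹ + C * t := by
  have hanti : AntitoneOn w (Set.Ici 0) := by
    refine antitoneOn_of_deriv_nonpos (convex_Ici 0) hw ?_ ?_ <;> rw [interior_Ici]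
    · exact fun s hs => (hd s hs).differentiableAt.differentiableWithinAt
    · intro s hs
      rw [(hd s hs).deriv]
      nlinarith [hu s hs, sq_nonneg (w s)]
  -- As w decreases, w' ≥ -C w² ≥ -C w(0) w, so w e^(C w(0) s) is nondecreasing; w never reaches
  -- zero and 1/w may be formed.
  have hpos : ∀ s, 0 ≤ s → 0 < w s := by
    have hm : MonotoneOn (fun s => w s * Real.exp (C * w 0 * s)) (Set.Ici 0) := by
      have hd' : ∀ s, 0 < s → HasDerivAt (fun s => w s * Real.exp (C * w 0 * s))
          (w' s * Real.exp (C * w 0 * s) + w s * (Real.exp (C * w 0 * s) * (C * w 0 * 1))) s :=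
        fun s hs => (hd s hs).mul (((hasDerivAt_id s).const_mul (C * w 0)).exp)
      refine monotoneOn_of_deriv_nonneg (convex_Ici 0) (by fun_prop) ?_ ?_ <;> rw [interior_Ici]
      · exact fun s hs => (hd' s hs).differentiableAt.differentiableWithinAt
      · intro s hs
        rw [(hd' s hs).deriv]
        have h1 := hl s hs
        have h2 : w s ≤ w 0 := hanti (Set.mem_Ici.2 le_rfl) (Set.mem_Ici.2 (le_of_lt hs)) (le_of_lt hs)
        have h3 := hnn s (le_of_lt hs)
        have h4 : 0 ≤ w' s + w s * (C * w 0) := by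
          have : 0 ≤ C * w s * (w 0 - w s) := mul_nonneg (mul_nonneg hC h3) (by linarith)
          nlinarith
        have := mul_nonneg h4 (Real.exp_pos (C * w 0 * s)).le
        nlinarith
    intro s hs
    have := hm (Set.mem_Ici.2 le_rfl) hs hs
    simp only [mul_zero, Real.exp_zero, mul_one] at this
    exact pos_of_mul_pos_left (h0.trans_le this) (Real.exp_pos _).le
  have hinv : ∀ k s, 0 < s → HasDerivAt (fun s => (w s)⁻¹ - k * s) (-w' s / w s ^ 2 - k * 1) s :=
    fun k s hs => ((hd s hs).inv (hpos s (le_of_lt hs)).ne').sub ((hasDerivAt_id s).const_mul k)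
  have hcont : ∀ k, ContinuousOn (fun s => (w s)⁻¹ - k * s) (Set.Ici 0) := fun k =>
    (hw.inv₀ fun s hs => (hpos s hs).ne').sub (by fun_prop)
  refine ⟨hpos t ht, ?_, ?_⟩
  · have hm : MonotoneOn (fun s => (w s)⁻¹ - c * s) (Set.Ici 0) := by
      refine monotoneOn_of_deriv_nonneg (convex_Ici 0) (hcont c) ?_ ?_ <;> rw [interior_Ici]
      · exact fun s hs => (hinv c s hs).differentiableAt.differentiableWithinAt
      · intro s hs
        rw [(hinv c s hs).deriv, mul_one, sub_nonneg, le_div_iff₀ (pow_pos (hpos s (le_of_lt hs)) 2)]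
        linarith [hu s hs]
    have := hm (Set.mem_Ici.2 le_rfl) ht ht
    simp only [mul_zero, sub_zero] at this
    linarith
  · have hm : AntitoneOn (fun s => (w s)⁻¹ - C * s) (Set.Ici 0) := by
      refine antitoneOn_of_deriv_nonpos (convex_Ici 0) (hcont C) ?_ ?_ <;> rw [interior_Ici]
      · exact fun s hs => (hinv C s hs).differentiableAt.differentiableWithinAt
      · intro s hs
        rw [(hinv C s hs).deriv, mul_one, sub_nonpos, div_le_iff₀ (pow_pos (hpos s (le_of_lt hs)) 2)]
        linarith [hl s hs]
    have := hm (Set.mem_Ici.2 le_rfl) ht ht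
    simp only [mul_zero, sub_zero] at this
    linarith

/-- `W` is a Lyapunov function for `z' = F z` on the ball of radius `R` about `P`, comparable to
the square of the distance to `P`, whose derivative along the flow is comparable to `- W ^ 2`. -/
structure QuarticDecay (F : ℝ × ℝ → ℝ × ℝ) (P : ℝ × ℝ) (W : ℝ × ℝ → ℝ) (R c₁ c₂ c C : ℝ) :
    Prop where
  R_pos : 0 < R
  c₁_pos : 0 < c₁
  c_pos : 0 < c
  C_pos : 0 < C
  diff : ∀ z, dist z P ≤ R → DifferentiableAt ℝ W z
  lower : ∀ z, dist z P ≤ R → c₁ * dist z P ^ 2 ≤ W z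
  upper : ∀ z, dist z P ≤ R → W z ≤ c₂ * dist z P ^ 2
  deriv_lower : ∀ z, dist z P ≤ R → -C * W z ^ 2 ≤ fderiv ℝ W z (F z)
  deriv_upper : ∀ z, dist z P ≤ R → fderiv ℝ W z (F z) ≤ -c * W z ^ 2

theorem IsSolutionOn.continuousOn {F : ℝ × ℝ → ℝ × ℝ} {z : ℝ → ℝ × ℝ} {s : Set ℝ}
    (hz : IsSolutionOn F z s) : ContinuousOn z s :=
  fun t ht => (hz t ht).continuousWithinAt

theorem IsSolutionOn.hasDerivAt {F : ℝ × ℝ → ℝ × ℝ} {z : ℝ → ℝ × ℝ} {s : Set ℝ}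
    (hz : IsSolutionOn F z s) {t : ℝ} (hs : s ∈ 𝓝 t) : HasDerivAt z (F (z t)) t :=
  (hz t (mem_of_mem_nhds hs)).hasDerivAt hs

namespace QuarticDecay

variable {F : ℝ × ℝ → ℝ × ℝ} {P : ℝ × ℝ} {W : ℝ × ℝ → ℝ} {R c₁ c₂ c C : ℝ}

theorem nonneg (h : QuarticDecay F P W R c₁ c₂ c C) {z : ℝ × ℝ} (hz : dist z P ≤ R) : 0 ≤ W z :=
  (mul_nonneg h.c₁_pos.le (sq_nonneg _)).trans (h.lower z hz)

theorem c₂_pos (h : QuarticDecay F P W R c₁ c₂ c C) : 0 < c₂ := by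
  have hd : dist (P + (R, 0)) P = R := by
    simp [Prod.norm_def, abs_of_pos h.R_pos, h.R_pos.le]
  have h1 := (h.lower _ hd.le).trans (h.upper _ hd.le)
  rw [hd] at h1
  have h2 := mul_pos h.c₁_pos (pow_pos h.R_pos 2)
  exact pos_of_mul_pos_left (h2.trans_le h1) (sq_nonneg R)

theorem congr (h : QuarticDecay F P W R c₁ c₂ c C) {G : ℝ × ℝ → ℝ × ℝ}
    (hG : ∀ z, dist z P ≤ R → G z = F z) : QuarticDecay G P W R c₁ c₂ c C :=
  { h with
    deriv_lower := fun z hz => by rw [hG z hz]; exact h.deriv_lower z hz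
    deriv_upper := fun z hz => by rw [hG z hz]; exact h.deriv_upper z hz }

/-- W decreases as long as the trajectory stays in the ball of radius R. At a first exit from the
ball of radius ε this would give c₁ε² ≤ W ≤ c₂ dist(z 0, P)², which the second smallness condition
excludes. -/
theorem trapped (h : QuarticDecay F P W R c₁ c₂ c C) {z : ℝ → ℝ × ℝ}
    (hz : IsSolutionOn F z (Set.Ici 0)) {ε : ℝ} (hε : ε ≤ R)
    (h0 : dist (z 0) P < ε) (h1 : c₂ * dist (z 0) P ^ 2 < c₁ * ε ^ 2) :
    ∀ t, 0 ≤ t → dist (z t) P < ε := by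
  by_contra hcon
  push Not at hcon
  obtain ⟨t, ht, hte⟩ := hcon
  obtain ⟨s, hs0, -, hse, hs⟩ := exists_first_exit (g := fun t => dist (z t) P)
    ((continuous_id.dist continuous_const).comp_continuousOn hz.continuousOn) h0 ht hte
  have hR : ∀ u ∈ Set.Icc 0 s, dist (z u) P ≤ R := fun u hu => by
    rcases hu.2.lt_or_eq with h' | h'
    · exact (hs u hu.1 h').le.trans hε
    · rw [h']; exact hse.le.trans hε
  have hcont : ContinuousOn (fun u => W (z u)) (Set.Icc 0 s) := fun u hu =>
    (h.diff _ (hR u hu)).continuousAt.comp_continuousWithinAt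
      ((hz.continuousOn u hu.1).mono Set.Icc_subset_Ici_self)
  have hder : ∀ u ∈ Set.Ioo 0 s, HasDerivAt (fun u => W (z u)) (fderiv ℝ W (z u) (F (z u))) u :=
    fun u hu => (h.diff _ (hR u (Set.Ioo_subset_Icc_self hu))).hasFDerivAt.comp_hasDerivAt u
      (hz.hasDerivAt (Ici_mem_nhds hu.1))
  have hanti : AntitoneOn (fun u => W (z u)) (Set.Icc 0 s) := by
    refine antitoneOn_of_deriv_nonpos (convex_Icc 0 s) hcont ?_ ?_ <;> rw [interior_Icc]
    · exact fun u hu => (hder u hu).differentiableAt.differentiableWithinAt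
    · intro u hu
      rw [(hder u hu).deriv]
      have := h.deriv_upper _ (hR u (Set.Ioo_subset_Icc_self hu))
      nlinarith [h.c_pos, sq_nonneg (W (z u))]
  have h2 := hanti (Set.left_mem_Icc.2 hs0.le) (Set.right_mem_Icc.2 hs0.le) hs0.le
  have h3 := h.lower _ (hR s (Set.right_mem_Icc.2 hs0.le))
  have h4 := h.upper _ (hR 0 (Set.left_mem_Icc.2 hs0.le))
  simp only at h2 hse
  rw [hse] at h3
  linarith

/-- The size of the initial data which ensures that the solution stays in the ball `ε`. -/
theorem exists_radius (h : QuarticDecay F P W R c₁ c₂ c C) {ε : ℝ} (hε : 0 < ε) :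
    ∃ δ > 0, ∀ d, 0 ≤ d → d < δ → d < ε ∧ c₂ * d ^ 2 < c₁ * ε ^ 2 := by
  have hc₂ := h.c₂_pos
  have hc₁ := h.c₁_pos
  refine ⟨min ε (ε * √(c₁ / c₂)), lt_min hε (mul_pos hε (Real.sqrt_pos.2 (div_pos hc₁ hc₂))),
    fun d hd hlt => ⟨hlt.trans_le (min_le_left _ _), ?_⟩⟩
  have h1 : d < ε * √(c₁ / c₂) := hlt.trans_le (min_le_right _ _)
  have h2 : d ^ 2 < (ε * √(c₁ / c₂)) ^ 2 := by gcongr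
  rw [mul_pow, Real.sq_sqrt (div_pos hc₁ hc₂).le] at h2
  calc c₂ * d ^ 2 < c₂ * (ε ^ 2 * (c₁ / c₂)) := by gcongr
    _ = c₁ * ε ^ 2 := by field_simp

/-- Closed balls of ℝ × ℝ are squares for the maximum norm, so clamping each coordinate is a
1-Lipschitz retraction. The field composed with it is bounded and globally Lipschitz, and its
solutions that start close to P never leave the square, where it agrees with F. -/
theorem exists_solution (h : QuarticDecay F P W R c₁ c₂ c C) {K : NNReal}
    (hF : LipschitzOnWith K F (Metric.closedBall P R)) :
    ∃ δ > 0, ∀ z₀ : ℝ × ℝ, dist z₀ P < δ → ∃ z, IsSolutionOn F z (Set.Ici 0) ∧ z 0 = z₀ := by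
  have hR := h.R_pos
  set pr : ℝ × ℝ → ℝ × ℝ := fun z =>
    ((Set.projIcc (P.1 - R) (P.1 + R) (by linarith) z.1 : ℝ),
      (Set.projIcc (P.2 - R) (P.2 + R) (by linarith) z.2 : ℝ)) with hpr
  have hball : ∀ z : ℝ × ℝ, dist z P ≤ R ↔
      z.1 ∈ Set.Icc (P.1 - R) (P.1 + R) ∧ z.2 ∈ Set.Icc (P.2 - R) (P.2 + R) := by
    intro z
    rw [Prod.dist_eq, max_le_iff, Real.dist_eq, Real.dist_eq, abs_le, abs_le, Set.mem_Icc,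
      Set.mem_Icc]
    constructor <;> rintro ⟨⟨_, _⟩, _, _⟩ <;> refine ⟨⟨?_, ?_⟩, ?_, ?_⟩ <;> linarith
  have hprm : ∀ z, pr z ∈ Metric.closedBall P R := fun z =>
    (hball _).2 ⟨Subtype.prop _, Subtype.prop _⟩
  have hpre : ∀ z, dist z P ≤ R → pr z = z := fun z hz => by
    obtain ⟨h1, h2⟩ := (hball z).1 hz
    simp [hpr, Set.projIcc_of_mem _ h1, Set.projIcc_of_mem _ h2]
  have hprl : LipschitzWith 1 pr := by
    have h1 : LipschitzWith 1 fun z : ℝ × ℝ =>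
        (Set.projIcc (P.1 - R) (P.1 + R) (by linarith) z.1 : ℝ) := by
      simpa using! (LipschitzWith.subtype_val _).comp
        ((LipschitzWith.projIcc (by linarith)).comp LipschitzWith.prod_fst)
    have h2 : LipschitzWith 1 fun z : ℝ × ℝ =>
        (Set.projIcc (P.2 - R) (P.2 + R) (by linarith) z.2 : ℝ) := by
      simpa using! (LipschitzWith.subtype_val _).comp
        ((LipschitzWith.projIcc (by linarith)).comp LipschitzWith.prod_snd)
    simpa using h1.prodMk h2
  have hGl : LipschitzWith K (F ∘ pr) := by
    rw [← lipschitzOnWith_univ]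
    simpa using hF.comp (hprl.lipschitzOnWith (s := Set.univ)) fun z _ => hprm z
  obtain ⟨B, hB⟩ := (isCompact_closedBall P R).exists_bound_of_continuousOn hF.continuousOn
  obtain ⟨δ, hδ, hδ'⟩ := h.exists_radius hR
  refine ⟨δ, hδ, fun z₀ hz₀ => ?_⟩
  obtain ⟨z, hz0, hz⟩ := exists_global_solution (f := fun _ => F ∘ pr) (K := K) (B := B.toNNReal)
    (fun _ => hGl) (fun _ => continuous_const)
    (fun _ z => (hB _ (hprm z)).trans (Real.le_coe_toNNReal B)) z₀
  have hsol : IsSolutionOn (F ∘ pr) z (Set.Ici 0) := fun t _ => (hz t).hasDerivWithinAt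
  have hcongr : ∀ z, dist z P ≤ R → (F ∘ pr) z = F z := fun z hz => by
    simp [hpre z hz]
  obtain ⟨h1, h2⟩ := hδ' _ dist_nonneg hz₀
  have htr := (h.congr hcongr).trapped hsol le_rfl (by rwa [hz0]) (by rwa [hz0])
  refine ⟨z, fun t ht => ?_, hz0⟩
  rw [← hcongr _ (htr t ht).le]
  exact hsol t ht

theorem decay (h : QuarticDecay F P W R c₁ c₂ c C) {z : ℝ → ℝ × ℝ}
    (hz : IsSolutionOn F z (Set.Ici 0)) (hR : ∀ t, 0 ≤ t → dist (z t) P < R) (h0 : z 0 ≠ P)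
    {t : ℝ} (ht : 0 ≤ t) :
    0 < W (z t) ∧ (W (z 0))⁻¹ + c * t ≤ (W (z t))⁻¹ ∧ (W (z t))⁻¹ ≤ (W (z 0))⁻¹ + C * t := by
  refine inv_bounds_of_deriv_bounds (w := fun t => W (z t))
    (w' := fun t => fderiv ℝ W (z t) (F (z t))) h.C_pos.le h.c_pos.le
    (fun t ht => (h.diff _ (hR t ht).le).continuousAt.comp_continuousWithinAt
      (hz.continuousOn t ht))
    (fun t ht => (h.diff _ (hR t (le_of_lt ht)).le).hasFDerivAt.comp_hasDerivAt t
      (hz.hasDerivAt (Ici_mem_nhds ht)))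
    (fun t ht => h.nonneg (hR t ht).le)
    (fun t ht => h.deriv_lower _ (hR t (le_of_lt ht)).le)
    (fun t ht => h.deriv_upper _ (hR t (le_of_lt ht)).le) ?_ ht
  exact (mul_pos h.c₁_pos (pow_pos (dist_pos.2 h0) 2)).trans_le (h.lower _ (hR 0 le_rfl).le)

/-- `decay` puts W between two multiples of 1/t for large t: the upper one gives convergence, the
lower one is beaten by no exponential. -/
theorem isWeakSink (h : QuarticDecay F P W R c₁ c₂ c C) (hF0 : F P = 0) {K : NNReal}
    (hF : LipschitzOnWith K F (Metric.closedBall P R)) : IsWeakSink F P := by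
  have hR := h.R_pos
  have hc₁ := h.c₁_pos
  have hc₂ := h.c₂_pos
  -- The radius is kept at most 1 so that d² ≤ d: the lower bound of order 1/t on d² then passes to
  -- d, without square roots.
  obtain ⟨δ₀, hδ₀, hδ₀'⟩ := h.exists_radius (lt_min hR one_pos)
  have htr : ∀ z, IsSolutionOn F z (Set.Ici 0) → dist (z 0) P < δ₀ →
      ∀ t, 0 ≤ t → dist (z t) P < min R 1 := fun z hz hz0 =>
    h.trapped hz (min_le_left _ _) (hδ₀' _ dist_nonneg hz0).1 (hδ₀' _ dist_nonneg hz0).2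
  refine ⟨⟨hF0, h.exists_solution hF, ?_, δ₀, hδ₀, ?_⟩, δ₀, hδ₀, ?_⟩
  · intro ε hε
    obtain ⟨δ, hδ, hδ'⟩ := h.exists_radius (lt_min hε hR)
    refine ⟨δ, hδ, fun z hz hz0 t ht => (h.trapped hz (min_le_right _ _) ?_ ?_ t ht).trans_le
      (min_le_left _ _)⟩
    · exact (hδ' _ dist_nonneg hz0).1
    · exact (hδ' _ dist_nonneg hz0).2
  · intro z hz hz0
    have hRz : ∀ t, 0 ≤ t → dist (z t) P < R := fun t ht =>
      (htr z hz hz0 t ht).trans_le (min_le_left _ _)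
    rw [tendsto_iff_dist_tendsto_zero]
    by_cases hP : z 0 = P
    · have hzero : ∀ t, 0 ≤ t → dist (z t) P = 0 := by
        intro t ht
        by_contra hne
        have hpos : 0 < dist (z t) P := lt_of_le_of_ne dist_nonneg (Ne.symm hne)
        have := h.trapped hz (ε := dist (z t) P) (hRz t ht).le (by simpa [hP] using hpos)
          (by rw [hP, dist_self]; simpa using mul_pos hc₁ (pow_pos hpos 2)) t ht
        exact lt_irrefl _ this
      exact tendsto_const_nhds.congr' ((eventually_ge_atTop 0).mono fun t ht => (hzero t ht).symm)
    · have hlim : Tendsto (fun t => (√c₁)⁻¹ * √((W (z 0))⁻¹ + c * t)⁻¹) atTop (𝓝 0) := by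
        have h1 : Tendsto (fun t => (W (z 0))⁻¹ + c * t) atTop atTop :=
          tendsto_atTop_add_const_left _ _ (tendsto_id.const_mul_atTop h.c_pos)
        have h2 := (Real.continuous_sqrt.tendsto 0).comp h1.inv_tendsto_atTop
        rw [Real.sqrt_zero] at h2
        simpa using! h2.const_mul (√c₁)⁻¹
      refine squeeze_zero' (Eventually.of_forall fun t => dist_nonneg) ?_ hlim
      filter_upwards [eventually_ge_atTop 0] with t ht
      obtain ⟨h1, h2, -⟩ := h.decay hz hRz hP ht
      have h3 := h.lower _ (hRz t ht).le
      have h0 : 0 < (W (z 0))⁻¹ := inv_pos.2 (h.decay hz hRz hP le_rfl).1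
      have h4 : W (z t) ≤ ((W (z 0))⁻¹ + c * t)⁻¹ := by
        rw [← inv_inv (W (z t))]
        exact inv_anti₀ (add_pos_of_pos_of_nonneg h0 (mul_nonneg h.c_pos.le ht)) h2
      rw [← Real.sqrt_inv, ← Real.sqrt_mul (inv_nonneg.2 hc₁.le)]
      refine Real.le_sqrt_of_sq_le ?_
      rw [inv_mul_eq_div, le_div_iff₀ hc₁]
      linarith
  · intro z hz hpos hz0 k hk
    have hlt := htr z hz hz0
    have hRz : ∀ t, 0 ≤ t → dist (z t) P < R := fun t ht => (hlt t ht).trans_le (min_le_left _ _)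
    have hP : z 0 ≠ P := dist_pos.1 hpos
    have h0 : 0 < (W (z 0))⁻¹ := inv_pos.2 (h.decay hz hRz hP le_rfl).1
    have hlow : ∀ t, 1 ≤ t → (c₂ * ((W (z 0))⁻¹ + C))⁻¹ * (Real.exp (k * t) / t) ≤
        Real.exp (k * t) * dist (z t) P := by
      intro t ht
      have ht0 : 0 < t := one_pos.trans_le ht
      obtain ⟨h1, -, h2⟩ := h.decay hz hRz hP ht0.le
      have h3 : ((W (z 0))⁻¹ + C * t)⁻¹ ≤ W (z t) := by
        rw [← inv_inv (W (z t))]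
        exact inv_anti₀ (inv_pos.2 h1) h2
      have h4 : (((W (z 0))⁻¹ + C) * t)⁻¹ ≤ ((W (z 0))⁻¹ + C * t)⁻¹ := by
        refine inv_anti₀ (add_pos h0 (mul_pos h.C_pos ht0)) ?_
        nlinarith
      have h5 := h.upper _ (hRz t ht0.le).le
      have h6 : dist (z t) P ^ 2 ≤ dist (z t) P := by
        have := (hlt t ht0.le).trans_le (min_le_right _ _)
        nlinarith [dist_nonneg (x := z t) (y := P)]
      have h7 : (((W (z 0))⁻¹ + C) * t)⁻¹ ≤ c₂ * dist (z t) P :=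
        (h4.trans h3).trans (h5.trans (by gcongr))
      calc _ = Real.exp (k * t) * (c₂⁻¹ * (((W (z 0))⁻¹ + C) * t)⁻¹) := by
            rw [mul_inv, mul_inv, div_eq_mul_inv]; ring
        _ ≤ Real.exp (k * t) * (c₂⁻¹ * (c₂ * dist (z t) P)) := by gcongr
        _ = _ := by rw [inv_mul_cancel_left₀ hc₂.ne']
    refine tendsto_atTop_mono' _ ((eventually_ge_atTop 1).mono hlow) ?_
    refine Tendsto.const_mul_atTop (inv_pos.2 (mul_pos hc₂ (add_pos h0 h.C_pos))) ?_
    have := tendsto_exp_mul_div_rpow_atTop 1 k hk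
    simpa using! this

end QuarticDecay

/-! ### Periodic solutions of periodic scalar equations -/

/-- If a solution of a periodic scalar equation is bounded below and has decreased after one
period, then it is asymptotic to a periodic solution. -/
theorem exists_periodic_solution {f : ℝ → ℝ → ℝ} {K B : NNReal} (hL : ∀ t, LipschitzWith K (f t))
    (hc : ∀ x, Continuous fun t => f t x) (hB : ∀ t x, ‖f t x‖ ≤ B) {c : ℝ} (hcpos : 0 < c)
    (hper : ∀ t x, f (t + c) x = f t x) {r : ℝ → ℝ} (hr : ∀ t, HasDerivAt r (f t (r t)) t)
    {ε : ℝ} (hε : ∀ t, 0 ≤ t → ε ≤ r t) (hdec : r c < r 0) :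
    ∃ s : ℝ → ℝ, (∀ t, HasDerivAt s (f t (s t)) t) ∧ Function.Periodic s c ∧ s 0 < r 0 ∧
      Tendsto (fun t => r t - s t) atTop (𝓝 0) := by
  have huniq : ∀ {a b : ℝ → ℝ} {t₀ : ℝ}, (∀ t, HasDerivAt a (f t (a t)) t) →
      (∀ t, HasDerivAt b (f t (b t)) t) → a t₀ = b t₀ → a = b := fun ha hb h =>
    ODE_solution_unique_univ (v := f) (s := fun _ => Set.univ) (K := K)
      (fun t => (hL t).lipschitzOnWith) (fun t => ⟨ha t, trivial⟩) (fun t => ⟨hb t, trivial⟩) h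
  have hshift : ∀ {a : ℝ → ℝ}, (∀ t, HasDerivAt a (f t (a t)) t) →
      ∀ t, HasDerivAt (fun t => a (t + c)) (f t (a (t + c))) t := fun {a} ha t => by
    have := (ha (t + c)).comp_add_const t c
    rwa [hper] at this
  have hcont : ∀ {a : ℝ → ℝ}, (∀ t, HasDerivAt a (f t (a t)) t) → Continuous a := fun ha =>
    continuous_iff_continuousAt.2 fun t => (ha t).continuousAt
  -- The shifted solution solves the same equation; if the order were reversed somewhere, the two
  -- would meet and, by uniqueness, coincide.
  have hord : ∀ t, r (t + c) < r t := by
    by_contra hcon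
    push Not at hcon
    obtain ⟨t, ht⟩ := hcon
    obtain ⟨t', ht'⟩ := mem_range_of_exists_le_of_exists_ge (c := (0 : ℝ))
      (f := fun t => r (t + c) - r t)
      (((hcont hr).comp (continuous_id.add continuous_const)).sub (hcont hr))
      ⟨0, by simpa using hdec.le⟩ ⟨t, sub_nonneg.2 ht⟩
    have := congrFun (huniq (hshift hr) hr (sub_eq_zero.1 ht')) 0
    simp only [zero_add] at this
    exact hdec.ne this
  have hanti : Antitone fun n : ℕ => r (n * c) := antitone_nat_of_succ_le fun n => by
    have := hord (n * c)
    rw [Nat.cast_add_one, add_one_mul]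
    exact this.le
  have hbdd : BddBelow (Set.range fun n : ℕ => r (n * c)) :=
    ⟨ε, by rintro _ ⟨n, rfl⟩; exact hε _ (by positivity)⟩
  have hlim := tendsto_atTop_ciInf hanti hbdd
  set r' := ⨅ n : ℕ, r (n * c) with hr'
  obtain ⟨s, hs0, hs⟩ := exists_global_solution hL hc hB r'
  have hshiftn : ∀ n : ℕ, ∀ t, HasDerivAt (fun t => r (t + n * c)) (f t (r (t + n * c))) t := by
    intro n t
    have := (hr (t + n * c)).comp_add_const t (n * c)
    have hp : Function.Periodic f c := fun t => funext (hper t)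
    rwa [hp.nat_mul n t] at this
  -- Grönwall over one period: convergence of the iterates of the period map becomes uniform
  -- convergence on the whole period.
  have hest : ∀ n : ℕ, ∀ t, 0 ≤ t → t ≤ c →
      |r (t + n * c) - s t| ≤ |r (n * c) - r'| * Real.exp (K * c) := by
    intro n t ht htc
    have h1 := dist_le_of_trajectories_ODE (v := f) (K := K) (f := fun t => r (t + n * c)) (g := s)
      (a := 0) (b := c) (δ := |r (n * c) - r'|) hL
      (continuous_iff_continuousAt.2 fun t => (hshiftn n t).continuousAt).continuousOn
      (fun t _ => (hshiftn n t).hasDerivWithinAt)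
      (hcont hs).continuousOn (fun t _ => (hs t).hasDerivWithinAt)
      (by rw [zero_add, hs0, Real.dist_eq]) t ⟨ht, htc⟩
    rw [Real.dist_eq, sub_zero] at h1
    refine h1.trans ?_
    gcongr
  have hlim0 : Tendsto (fun n : ℕ => |r (n * c) - r'| * Real.exp (K * c)) atTop (𝓝 0) := by
    have := ((hlim.sub_const r').abs).mul_const (Real.exp (K * c))
    simpa using this
  have hsc : s c = r' := by
    have h1 : Tendsto (fun n : ℕ => r (c + n * c)) atTop (𝓝 (s c)) := by
      rw [tendsto_iff_dist_tendsto_zero]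
      exact squeeze_zero (fun _ => dist_nonneg) (fun n => hest n c hcpos.le le_rfl) hlim0
    have h2 := hlim.comp (tendsto_add_atTop_nat 1)
    refine tendsto_nhds_unique h1 (h2.congr fun n => ?_)
    simp only [Function.comp_apply, Nat.cast_add_one]
    congr 1; ring
  have hsper : Function.Periodic s c := fun t =>
    congrFun (huniq (t₀ := 0) (hshift hs) hs (by simp only [zero_add]; rw [hsc, hs0])) t
  refine ⟨s, hs, hsper, ?_, ?_⟩
  · rw [hs0]
    refine lt_of_le_of_lt (ciInf_le hbdd 1) ?_
    simpa using hdec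
  · have hfl : Tendsto (fun t : ℝ => ⌊t / c⌋₊) atTop atTop :=
      tendsto_nat_floor_atTop.comp (tendsto_id.atTop_div_const hcpos)
    refine squeeze_zero_norm' ?_ (hlim0.comp hfl)
    filter_upwards [eventually_ge_atTop 0] with t ht
    have h1 := Nat.floor_le (div_nonneg ht hcpos.le)
    have h2 := Nat.lt_floor_add_one (t / c)
    rw [le_div_iff₀ hcpos] at h1
    rw [div_lt_iff₀ hcpos] at h2
    have h3 := hest ⌊t / c⌋₊ (t - ⌊t / c⌋₊ * c) (by linarith) (by linarith)
    rw [sub_add_cancel, hsper.sub_nat_mul_eq] at h3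
    exact h3

/-! ### Polar coordinates -/

/-- The point with polar coordinates `r`, `θ`. -/
noncomputable def polarPoint (r θ : ℝ) : ℝ × ℝ := (r * Real.cos θ, r * Real.sin θ)

theorem polarPoint_normSq (r θ : ℝ) : (polarPoint r θ).1 ^ 2 + (polarPoint r θ).2 ^ 2 = r ^ 2 := by
  simp only [polarPoint, mul_pow, ← mul_add, Real.cos_sq_add_sin_sq, mul_one]

theorem polarPoint_add_two_pi (r θ : ℝ) : polarPoint r (θ + 2 * Real.pi) = polarPoint r θ := by
  simp [polarPoint]

theorem contDiff_polarPoint {n : WithTop ℕ∞} :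
    ContDiff ℝ n fun x : ℝ × ℝ => polarPoint x.2 x.1 := by
  unfold polarPoint; fun_prop

theorem continuous_polarPoint : Continuous fun x : ℝ × ℝ => polarPoint x.2 x.1 :=
  (contDiff_polarPoint (n := 0)).continuous

theorem dist_polarPoint_le (r s θ : ℝ) : dist (polarPoint r θ) (polarPoint s θ) ≤ |r - s| := by
  rw [Prod.dist_eq, Real.dist_eq, Real.dist_eq]
  simp only [polarPoint, ← sub_mul, abs_mul]
  exact max_le (mul_le_of_le_one_right (abs_nonneg _) (Real.abs_cos_le_one θ))
    (mul_le_of_le_one_right (abs_nonneg _) (Real.abs_sin_le_one θ))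

theorem hasDerivAt_polarPoint {r θ : ℝ → ℝ} {r' θ' t : ℝ} (hr : HasDerivAt r r' t)
    (hθ : HasDerivAt θ θ' t) :
    HasDerivAt (fun t => polarPoint (r t) (θ t))
      (r' * Real.cos (θ t) - r t * Real.sin (θ t) * θ',
        r' * Real.sin (θ t) + r t * Real.cos (θ t) * θ') t := by
  have h1 := hr.mul ((Real.hasDerivAt_cos (θ t)).comp t hθ)
  have h2 := hr.mul ((Real.hasDerivAt_sin (θ t)).comp t hθ)
  convert! h1.prodMk h2 using 2
  · simp only [Function.comp_apply]; ring
  · simp only [Function.comp_apply]; ring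

/-- The radial component of the field `G` at the point with polar coordinates `x = (θ, r)`. -/
noncomputable def radialPart (G : ℝ × ℝ → ℝ × ℝ) (x : ℝ × ℝ) : ℝ :=
  (G (polarPoint x.2 x.1)).1 * Real.cos x.1 + (G (polarPoint x.2 x.1)).2 * Real.sin x.1

/-- The angular component of the field `G` at the point with polar coordinates `x = (θ, r)`. -/
noncomputable def angularPart (G : ℝ × ℝ → ℝ × ℝ) (x : ℝ × ℝ) : ℝ :=
  (G (polarPoint x.2 x.1)).2 * Real.cos x.1 - (G (polarPoint x.2 x.1)).1 * Real.sin x.1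

theorem field_eq_parts (G : ℝ × ℝ → ℝ × ℝ) (r θ : ℝ) :
    G (polarPoint r θ) =
      (radialPart G (θ, r) * Real.cos θ - angularPart G (θ, r) * Real.sin θ,
        radialPart G (θ, r) * Real.sin θ + angularPart G (θ, r) * Real.cos θ) := by
  have h := Real.cos_sq_add_sin_sq θ
  refine Prod.ext ?_ ?_ <;> simp only [radialPart, angularPart]
  · linear_combination -(G (polarPoint r θ)).1 * h
  · linear_combination -(G (polarPoint r θ)).2 * h

theorem radialPart_add_two_pi (G : ℝ × ℝ → ℝ × ℝ) (θ r : ℝ) :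
    radialPart G (θ + 2 * Real.pi, r) = radialPart G (θ, r) := by
  simp [radialPart, polarPoint_add_two_pi]

theorem angularPart_add_two_pi (G : ℝ × ℝ → ℝ × ℝ) (θ r : ℝ) :
    angularPart G (θ + 2 * Real.pi, r) = angularPart G (θ, r) := by
  simp [angularPart, polarPoint_add_two_pi]

/-! ### Closed curves in polar form -/

section Curve

variable {s : ℝ → ℝ} {ε δ : ℝ}

/-- The function `s` of the polar angle, as a function in the plane. -/
noncomputable def angularLift (hs : Function.Periodic s (2 * Real.pi)) (z : ℝ × ℝ) : ℝ :=
  hs.lift ((Complex.arg (Complex.equivRealProdCLM.symm z) : ℝ) : AddCircle (2 * Real.pi))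

/-- The argument jumps across the negative real axis, but its class modulo 2π is continuous away
from the origin, and a periodic s factors through that class. -/
theorem angularLift_continuousAt (hs : Function.Periodic s (2 * Real.pi)) (hc : Continuous s)
    {z : ℝ × ℝ} (hz : z ≠ 0) : ContinuousAt (angularLift hs) z := by
  have h1 : Continuous (hs.lift : AddCircle (2 * Real.pi) → ℝ) := hc.quotient_liftOn' _
  have h2 : ContinuousAt (fun z : ℂ => ((Complex.arg z : ℝ) : AddCircle (2 * Real.pi)))
      (Complex.equivRealProdCLM.symm z) :=
    Complex.continuousAt_arg_coe_angle (by simpa using hz)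
  exact h1.continuousAt.comp (h2.comp (f := fun z : ℝ × ℝ => Complex.equivRealProdCLM.symm z)
    Complex.equivRealProdCLM.symm.continuous.continuousAt)

theorem angularLift_eq (hs : Function.Periodic s (2 * Real.pi)) (z : ℝ × ℝ) :
    angularLift hs z = s (Complex.arg (Complex.equivRealProdCLM.symm z)) :=
  hs.lift_coe _

theorem polarPoint_norm_arg (z : ℝ × ℝ) :
    polarPoint ‖Complex.equivRealProdCLM.symm z‖ (Complex.arg (Complex.equivRealProdCLM.symm z)) =
      z := by
  refine Prod.ext ?_ ?_
  · simp [polarPoint, Complex.norm_mul_cos_arg]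
  · simp [polarPoint, Complex.norm_mul_sin_arg]

/-- The component of the origin in the complement of a closed curve `r = s θ` is bounded. -/
theorem isBounded_component_polar (hs : Function.Periodic s (2 * Real.pi)) (hc : Continuous s)
    (hε : 0 < ε) (hsε : ∀ θ, ε ≤ s θ) (hsδ : ∀ θ, s θ ≤ δ) :
    Bornology.IsBounded
      (connectedComponentIn (Set.range fun θ => polarPoint (s θ) θ)ᶜ (0 : ℝ × ℝ)) := by
  set ρ : ℝ × ℝ → ℝ := fun z => ‖Complex.equivRealProdCLM.symm z‖ with hρ
  have hρc : Continuous ρ := Complex.equivRealProdCLM.symm.continuous.norm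
  have hρ0 : ∀ z, z = 0 → ρ z = 0 := fun z hz => by simp [hρ, hz]
  set C := connectedComponentIn (Set.range fun θ => polarPoint (s θ) θ)ᶜ (0 : ℝ × ℝ) with hC
  -- Inside and outside of the curve. The disc of radius ε is added to the inside to cover the
  -- origin, where the angle has no meaning. The two open sets are disjoint and cover the complement
  -- of the curve, so the connected component of the origin stays inside.
  have hU : IsOpen ({z | ρ z < ε} ∪ {z | z ≠ 0 ∧ ρ z < angularLift hs z}) := by
    refine (isOpen_lt hρc continuous_const).union (isOpen_iff_mem_nhds.2 fun z hz => ?_)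
    exact Filter.Eventually.and (isOpen_ne.mem_nhds hz.1)
      (hρc.continuousAt.eventually_lt (angularLift_continuousAt hs hc hz.1) hz.2)
  have hW : IsOpen {z | z ≠ 0 ∧ angularLift hs z < ρ z} := isOpen_iff_mem_nhds.2 fun z hz =>
    Filter.Eventually.and (isOpen_ne.mem_nhds hz.1)
      ((angularLift_continuousAt hs hc hz.1).eventually_lt hρc.continuousAt hz.2)
  have hdisj : Disjoint ({z | ρ z < ε} ∪ {z | z ≠ 0 ∧ ρ z < angularLift hs z})
      {z | z ≠ 0 ∧ angularLift hs z < ρ z} := by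
    rw [Set.disjoint_left]
    rintro z (h | h) ⟨-, h2⟩
    · rw [angularLift_eq] at h2
      exact absurd (h.trans_le (hsε _)) (not_lt.2 h2.le)
    · exact absurd h.2 (not_lt.2 h2.le)
  have h0 : (0 : ℝ × ℝ) ∉ Set.range fun θ => polarPoint (s θ) θ := by
    rintro ⟨θ, hθ⟩
    have h1 := polarPoint_normSq (s θ) θ
    simp only at hθ
    rw [hθ] at h1
    simp only [Prod.fst_zero, Prod.snd_zero] at h1
    nlinarith [hsε θ]
  have hcov : C ⊆ ({z | ρ z < ε} ∪ {z | z ≠ 0 ∧ ρ z < angularLift hs z}) ∪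
      {z | z ≠ 0 ∧ angularLift hs z < ρ z} := by
    intro z hz
    have hz' : z ∉ Set.range fun θ => polarPoint (s θ) θ := connectedComponentIn_subset _ _ hz
    by_cases hz0 : z = 0
    · exact Or.inl (Or.inl (by simpa [hρ0 z hz0] using hε))
    rcases lt_trichotomy (ρ z) (angularLift hs z) with h | h | h
    · exact Or.inl (Or.inr ⟨hz0, h⟩)
    · refine absurd ⟨Complex.arg (Complex.equivRealProdCLM.symm z), ?_⟩ hz'
      simp only
      rw [← angularLift_eq hs, ← h]
      exact polarPoint_norm_arg z
    · exact Or.inr ⟨hz0, h⟩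
  have hsub := isPreconnected_connectedComponentIn.subset_left_of_subset_union hU hW hdisj hcov
    ⟨0, mem_connectedComponentIn h0, Or.inl (by simpa [hρ0] using hε)⟩
  refine (Metric.isBounded_closedBall (x := (0 : ℝ × ℝ)) (r := δ)).subset fun z hz => ?_
  have hle : ρ z ≤ δ := by
    rcases hsub hz with h | h
    · exact (le_of_lt h).trans ((hsε 0).trans (hsδ 0))
    · exact h.2.le.trans ((angularLift_eq hs z).trans_le (hsδ _))
  rw [mem_closedBall_zero_iff, Prod.norm_def]
  refine max_le (le_trans ?_ hle) (le_trans ?_ hle)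
  · simpa [hρ] using! Complex.abs_re_le_norm (Complex.equivRealProdCLM.symm z)
  · simpa [hρ] using! Complex.abs_im_le_norm (Complex.equivRealProdCLM.symm z)

end Curve

/-! ### A limit cycle in a trapping annulus -/

/-- The closed annulus `ε ≤ |z| ≤ δ`. -/
def annulus (ε δ : ℝ) : Set (ℝ × ℝ) := {z | ε ^ 2 ≤ z.1 ^ 2 + z.2 ^ 2 ∧ z.1 ^ 2 + z.2 ^ 2 ≤ δ ^ 2}

theorem polarPoint_mem_annulus {ε δ r : ℝ} (hε : 0 ≤ ε) (h1 : ε ≤ r) (h2 : r ≤ δ) (θ : ℝ) :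
    polarPoint r θ ∈ annulus ε δ := by
  simp only [annulus, Set.mem_ofPred_eq, polarPoint_normSq]
  constructor <;> gcongr
  exact hε.trans h1

/-- The field `G` rotates counterclockwise in the annulus `ε ≤ |z| ≤ δ`, leaves the inner circle
outwards, and crosses the level `κ` of `V`, which separates the inner circle from the outer one,
inwards. -/
structure TrappingAnnulus (G : ℝ × ℝ → ℝ × ℝ) (V : ℝ × ℝ → ℝ) (ε δ κ : ℝ) : Prop where
  pos : 0 < ε
  lt : ε < δ
  smooth : ∀ z ∈ annulus ε δ, ContDiffAt ℝ 1 G z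
  rot : ∀ z ∈ annulus ε δ, 0 < z.1 * (G z).2 - z.2 * (G z).1
  inner : ∀ z, z.1 ^ 2 + z.2 ^ 2 = ε ^ 2 → 0 < z.1 * (G z).1 + z.2 * (G z).2
  diff : ∀ z ∈ annulus ε δ, DifferentiableAt ℝ V z
  inner_lt : V (ε, 0) < κ
  lt_outer : ∀ z, z.1 ^ 2 + z.2 ^ 2 = δ ^ 2 → κ < V z
  outer : ∀ z ∈ annulus ε δ, V z = κ → fderiv ℝ V z (G z) < 0

namespace TrappingAnnulus

variable {G : ℝ × ℝ → ℝ × ℝ} {V : ℝ × ℝ → ℝ} {ε δ κ : ℝ}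

theorem angularPart_pos (h : TrappingAnnulus G V ε δ κ) {r : ℝ} (hr : r ∈ Set.Icc ε δ) (θ : ℝ) :
    0 < angularPart G (θ, r) := by
  have h1 := h.rot _ (polarPoint_mem_annulus h.pos.le hr.1 hr.2 θ)
  have h2 : 0 < r := h.pos.trans_le hr.1
  refine pos_of_mul_pos_right (a := r) (h1.trans_eq ?_) h2.le
  simp only [angularPart, polarPoint]; ring

theorem radialPart_pos (h : TrappingAnnulus G V ε δ κ) (θ : ℝ) : 0 < radialPart G (θ, ε) := by
  have h1 := h.inner _ (polarPoint_normSq ε θ)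
  refine pos_of_mul_pos_right (a := ε) (h1.trans_eq ?_) h.pos.le
  simp only [radialPart, polarPoint]; ring

theorem contDiffAt_parts (h : TrappingAnnulus G V ε δ κ) {r : ℝ} (hr : r ∈ Set.Icc ε δ) (θ : ℝ) :
    ContDiffAt ℝ 1 (radialPart G) (θ, r) ∧ ContDiffAt ℝ 1 (angularPart G) (θ, r) := by
  have h1 : ContDiffAt ℝ 1 (fun x : ℝ × ℝ => G (polarPoint x.2 x.1)) (θ, r) :=
    ContDiffAt.comp (θ, r) (g := G) (h.smooth _ (polarPoint_mem_annulus h.pos.le hr.1 hr.2 θ))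
      contDiff_polarPoint.contDiffAt
  have h2 : ContDiffAt ℝ 1 (fun x : ℝ × ℝ => Real.cos x.1) (θ, r) := by fun_prop
  have h3 : ContDiffAt ℝ 1 (fun x : ℝ × ℝ => Real.sin x.1) (θ, r) := by fun_prop
  exact ⟨(h1.fst.mul h2).add (h1.snd.mul h3), (h1.snd.mul h2).sub (h1.fst.mul h3)⟩

/-- The right hand side of the equation `dr / dθ = slope (θ, r)` of the orbits. -/
noncomputable def slope (G : ℝ × ℝ → ℝ × ℝ) (x : ℝ × ℝ) : ℝ :=
  x.2 * radialPart G x / angularPart G x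

theorem contDiffAt_slope (h : TrappingAnnulus G V ε δ κ) {r : ℝ} (hr : r ∈ Set.Icc ε δ) (θ : ℝ) :
    ContDiffAt ℝ 1 (slope G) (θ, r) :=
  (contDiffAt_snd.mul (h.contDiffAt_parts hr θ).1).div (h.contDiffAt_parts hr θ).2
    (h.angularPart_pos hr θ).ne'

/-- A function of `(θ, r)` which is periodic in `θ` takes its values over a period. -/
theorem exists_mem_period {g : ℝ × ℝ → ℝ} (hg : ∀ θ r, g (θ + 2 * Real.pi, r) = g (θ, r)) (θ : ℝ) :
    ∃ θ' ∈ Set.Icc 0 (2 * Real.pi), ∀ r, g (θ, r) = g (θ', r) := by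
  have hp : Function.Periodic (fun θ r => g (θ, r)) (2 * Real.pi) := fun θ => funext (hg θ)
  obtain ⟨θ', h1, h2⟩ := hp.exists_mem_Ico₀ Real.two_pi_pos θ
  exact ⟨θ', Set.Ico_subset_Icc_self h1, congrFun h2⟩

theorem slope_add_two_pi (θ r : ℝ) : slope G (θ + 2 * Real.pi, r) = slope G (θ, r) := by
  simp [slope, radialPart_add_two_pi, angularPart_add_two_pi]

/-- By periodicity it suffices to bound the C¹ function `slope G` on one compact convex rectangle.
-/
theorem exists_slope_bounds (h : TrappingAnnulus G V ε δ κ) :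
    ∃ K B : NNReal, ∀ θ, LipschitzOnWith K (fun r => slope G (θ, r)) (Set.Icc ε δ) ∧
      ∀ r ∈ Set.Icc ε δ, ‖slope G (θ, r)‖ ≤ B := by
  have hk : IsCompact (Set.Icc (0 : ℝ) (2 * Real.pi) ×ˢ Set.Icc ε δ) :=
    isCompact_Icc.prod isCompact_Icc
  have hd : ContDiffOn ℝ 1 (slope G) (Set.Icc (0 : ℝ) (2 * Real.pi) ×ˢ Set.Icc ε δ) :=
    fun x hx => (h.contDiffAt_slope hx.2 x.1).contDiffWithinAt
  obtain ⟨K, hK⟩ := hd.exists_lipschitzOnWith one_ne_zero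
    ((convex_Icc _ _).prod (convex_Icc _ _)) hk
  obtain ⟨B, hB⟩ := hk.exists_bound_of_continuousOn hd.continuousOn
  refine ⟨K, B.toNNReal, fun θ => ?_⟩
  obtain ⟨θ', hθ', heq⟩ := exists_mem_period (g := slope G) slope_add_two_pi θ
  simp only [heq]
  refine ⟨fun r hr r' hr' => ?_, fun r hr => (hB _ ⟨hθ', hr⟩).trans (Real.le_coe_toNNReal B)⟩
  refine (hK ⟨hθ', hr⟩ ⟨hθ', hr'⟩).trans_eq ?_
  simp [Prod.edist_eq]

/-- The equation of the orbits, with `r` confined to `[ε, δ]`. -/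
noncomputable def clampedSlope (G : ℝ × ℝ → ℝ × ℝ) {ε δ : ℝ} (hεδ : ε ≤ δ) (θ r : ℝ) : ℝ :=
  slope G (θ, Set.projIcc ε δ hεδ r)

theorem clampedSlope_eq (hεδ : ε ≤ δ) {r : ℝ} (hr : r ∈ Set.Icc ε δ) (θ : ℝ) :
    clampedSlope G hεδ θ r = slope G (θ, r) := by
  simp [clampedSlope, Set.projIcc_of_mem hεδ hr]

/-- A solution of the equation of the orbits gives, after a change of time, a solution of the
planar system. -/
theorem exists_planar_solution (h : TrappingAnnulus G V ε δ κ) {r : ℝ → ℝ} (hrc : Continuous r) :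
    ∃ θ : ℝ → ℝ, θ 0 = 0 ∧ StrictMono θ ∧ Function.Surjective θ ∧
      (∀ t, r (θ t) ∈ Set.Icc ε δ → HasDerivAt r (slope G (θ t, r (θ t))) (θ t) →
        HasDerivAt (fun t => polarPoint (r (θ t)) (θ t)) (G (polarPoint (r (θ t)) (θ t))) t) ∧
      (Function.Periodic r (2 * Real.pi) → ∃ T > 0, ∀ t, θ (t + T) = θ t + 2 * Real.pi) := by
  have hεδ := h.lt.le
  set ω : ℝ × ℝ → ℝ := fun x => angularPart G x / x.2 with hω
  have hωc : ∀ θ, ∀ ρ ∈ Set.Icc ε δ, ContinuousAt ω (θ, ρ) := fun θ ρ hρ =>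
    (h.contDiffAt_parts hρ θ).2.continuousAt.div continuousAt_snd (h.pos.trans_le hρ.1).ne'
  have hωper : ∀ θ ρ, ω (θ + 2 * Real.pi, ρ) = ω (θ, ρ) := fun θ ρ => by
    simp [hω, angularPart_add_two_pi]
  have hk : IsCompact (Set.Icc (0 : ℝ) (2 * Real.pi) ×ˢ Set.Icc ε δ) :=
    isCompact_Icc.prod isCompact_Icc
  have hne : (Set.Icc (0 : ℝ) (2 * Real.pi) ×ˢ Set.Icc ε δ).Nonempty :=
    ⟨(0, ε), ⟨le_rfl, Real.two_pi_pos.le⟩, le_rfl, hεδ⟩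
  have hωon : ContinuousOn ω (Set.Icc (0 : ℝ) (2 * Real.pi) ×ˢ Set.Icc ε δ) :=
    fun x hx => (hωc x.1 x.2 hx.2).continuousWithinAt
  obtain ⟨a, ha, hamin⟩ := hk.exists_isMinOn hne hωon
  obtain ⟨b, hb, hbmax⟩ := hk.exists_isMaxOn hne hωon
  have hmem : ∀ ρ, (Set.projIcc ε δ hεδ ρ : ℝ) ∈ Set.Icc ε δ := fun ρ => Subtype.prop _
  have hbounds : ∀ θ ρ, ρ ∈ Set.Icc ε δ → ω a ≤ ω (θ, ρ) ∧ ω (θ, ρ) ≤ ω b := fun θ ρ hρ => by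
    obtain ⟨θ', hθ', heq⟩ := exists_mem_period hωper θ
    rw [heq]
    exact ⟨hamin ⟨hθ', hρ⟩, hbmax ⟨hθ', hρ⟩⟩
  -- The angular speed along r. Clamping r keeps it between positive bounds even at angles where r
  -- leaves [ε, δ].
  set f : ℝ → ℝ := fun θ => ω (θ, Set.projIcc ε δ hεδ (r θ)) with hf
  have hfc : Continuous f := continuous_iff_continuousAt.2 fun θ =>
    ContinuousAt.comp (g := ω) (f := fun θ : ℝ => (θ, (Set.projIcc ε δ hεδ (r θ) : ℝ)))
      (hωc θ _ (hmem _)) (continuous_id.prodMk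
      (continuous_subtype_val.comp (continuous_projIcc.comp hrc))).continuousAt
  obtain ⟨θ, h0, hmono, hsurj, hd, hp⟩ := exists_time_change hfc (m := ω a) (B := ω b)
    (div_pos (h.angularPart_pos ha.2 a.1) (h.pos.trans_le ha.2.1))
    (fun θ => (hbounds θ _ (hmem _)).1) (fun θ => (hbounds θ _ (hmem _)).2)
  refine ⟨θ, h0, hmono, hsurj, fun t ht hrt => ?_, fun hper => ?_⟩
  · have h1 := hasDerivAt_polarPoint (hrt.comp t (hd t)) (hd t)
    have h2 : f (θ t) = angularPart G (θ t, r (θ t)) / r (θ t) := by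
      simp [hf, hω, Set.projIcc_of_mem hεδ ht]
    have h3 := h.angularPart_pos ht (θ t)
    have h4 : 0 < r (θ t) := h.pos.trans_le ht.1
    rw [h2] at h1
    rw [field_eq_parts G]
    convert! h1 using 2 <;> simp only [slope, Function.comp_apply] <;> field_simp
  · exact hp _ Real.two_pi_pos fun θ => by simp only [hf, hωper, hper θ]

/-- The outermost point of the level `κ` on the ray `θ = 0`. -/
theorem exists_outermost (h : TrappingAnnulus G V ε δ κ) :
    ∃ r₀, ε ≤ r₀ ∧ r₀ < δ ∧ V (r₀, 0) = κ ∧ ∀ r, r₀ < r → r ≤ δ → κ < V (r, 0) := by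
  have hmem : ∀ r ∈ Set.Icc ε δ, (r, (0 : ℝ)) ∈ annulus ε δ := fun r hr => by
    simpa [polarPoint] using polarPoint_mem_annulus h.pos.le hr.1 hr.2 0
  have hVc : ContinuousOn (fun r : ℝ => V (r, 0)) (Set.Icc ε δ) := fun r hr =>
    (ContinuousAt.comp (g := V) (f := fun r : ℝ => (r, (0 : ℝ)))
      (h.diff _ (hmem r hr)).continuousAt (by fun_prop)).continuousWithinAt
  set S := Set.Icc ε δ ∩ (fun r : ℝ => V (r, 0)) ⁻¹' Set.Iic κ with hS
  have hcl : IsClosed S := hVc.preimage_isClosed_of_isClosed isClosed_Icc isClosed_Iic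
  have hbd : BddAbove S := ⟨δ, fun x hx => hx.1.2⟩
  have hm : sSup S ∈ S := hcl.csSup_mem ⟨ε, ⟨le_rfl, h.lt.le⟩, h.inner_lt.le⟩ hbd
  have hout : ∀ r, sSup S < r → r ≤ δ → κ < V (r, 0) := fun r h1 h2 => by
    by_contra hcon
    exact absurd (le_csSup hbd ⟨⟨hm.1.1.trans h1.le, h2⟩, not_lt.1 hcon⟩) (not_le.2 h1)
  have hδ : κ < V (δ, 0) := h.lt_outer _ (by simp)
  have hlt : sSup S < δ := by
    refine lt_of_le_of_ne hm.1.2 fun heq => ?_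
    have := hm.2
    rw [heq] at this
    exact absurd hδ (not_lt.2 this)
  refine ⟨sSup S, hm.1.1, hlt, le_antisymm hm.2 ?_, hout⟩
  by_contra hcon
  push Not at hcon
  obtain ⟨u, hu, hVu⟩ := intermediate_value_Ioc hlt.le
    (hVc.mono (Set.Icc_subset_Icc_left hm.1.1)) ⟨hcon, hδ.le⟩
  exact absurd hVu (hout u hu.1 hu.2).ne'

/-- The angle advances at speed `angularPart G` / r, so the factor in front is dt/dθ, and the rest
is the derivative of V along the flow. -/
theorem hasDerivAt_level (h : TrappingAnnulus G V ε δ κ) {r : ℝ → ℝ} {θ : ℝ}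
    (hr : r θ ∈ Set.Icc ε δ) (hd : HasDerivAt r (slope G (θ, r θ)) θ) :
    HasDerivAt (fun θ => V (polarPoint (r θ) θ))
      (r θ / angularPart G (θ, r θ) *
        fderiv ℝ V (polarPoint (r θ) θ) (G (polarPoint (r θ) θ))) θ := by
  have h0 := hasDerivAt_polarPoint (r := r) hd (hasDerivAt_id θ)
  have h1 := (h.diff _ (polarPoint_mem_annulus h.pos.le hr.1 hr.2 θ)).hasFDerivAt.comp_hasDerivAt
    (f := fun t => polarPoint (r t) (id t)) θ h0
  have h3 := h.angularPart_pos hr θ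
  convert! h1 using 1
  rw [← smul_eq_mul, ← map_smul]
  congr 1
  rw [field_eq_parts G]
  ext <;> simp only [slope, Prod.smul_mk, smul_eq_mul, mul_one, id] <;> field_simp

theorem level_deriv_neg (h : TrappingAnnulus G V ε δ κ) {r θ : ℝ} (hr : r ∈ Set.Icc ε δ)
    (hV : V (polarPoint r θ) = κ) :
    r / angularPart G (θ, r) * fderiv ℝ V (polarPoint r θ) (G (polarPoint r θ)) < 0 :=
  mul_neg_of_pos_of_neg (div_pos (h.pos.trans_le hr.1) (h.angularPart_pos hr θ))
    (h.outer _ (polarPoint_mem_annulus h.pos.le hr.1 hr.2 θ) hV)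

/-- The inner circle is a strict barrier. The level κ is one too, but only as long as r ≤ δ; a first
passage at r = δ would still have V ≤ κ, whereas V > κ on the outer circle. -/
theorem trapped (h : TrappingAnnulus G V ε δ κ) {r : ℝ → ℝ}
    (hr : ∀ θ, HasDerivAt r (clampedSlope G h.lt.le θ (r θ)) θ) (h0 : ε ≤ r 0) (h0' : r 0 < δ)
    (hV : V (r 0, 0) ≤ κ) {θ : ℝ} (hθ : 0 ≤ θ) :
    r θ ∈ Set.Icc ε δ ∧ V (polarPoint (r θ) θ) ≤ κ := by
  have hrc : Continuous r := continuous_iff_continuousAt.2 fun t => (hr t).continuousAt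
  have hlow : ∀ t, 0 ≤ t → ε ≤ r t := by
    intro t ht
    have := image_le_of_deriv_right_lt_deriv_boundary (f := fun t => -r t)
      (f' := fun t => -clampedSlope G h.lt.le t (r t)) (a := 0) (b := t) (B := fun _ => -ε)
      (B' := fun _ => 0) hrc.neg.continuousOn (fun t _ => (hr t).neg.hasDerivWithinAt)
      (neg_le_neg h0) (fun _ => hasDerivAt_const _ _) (fun u _ hu => ?_) ⟨ht, le_rfl⟩
    · exact neg_le_neg_iff.1 this
    · have hu' : r u = ε := neg_inj.1 hu
      have hm : ε ∈ Set.Icc ε δ := ⟨le_rfl, h.lt.le⟩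
      rw [hu', clampedSlope_eq h.lt.le hm, neg_lt_zero]
      exact div_pos (mul_pos h.pos (h.radialPart_pos u)) (h.angularPart_pos hm u)
  have hlev : ∀ t, 0 ≤ t → (∀ u ∈ Set.Icc 0 t, r u ≤ δ) → V (polarPoint (r t) t) ≤ κ := by
    intro t ht hu
    have hm : ∀ u ∈ Set.Icc 0 t, r u ∈ Set.Icc ε δ := fun u h' => ⟨hlow u h'.1, hu u h'⟩
    have hd : ∀ u ∈ Set.Icc 0 t, _ := fun u h' => h.hasDerivAt_level (hm u h')
      (by rw [← clampedSlope_eq h.lt.le (hm u h')]; exact hr u)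
    exact image_le_of_deriv_right_lt_deriv_boundary (B := fun _ => κ) (B' := fun _ => 0)
      (fun u h' => (hd u h').continuousAt.continuousWithinAt)
      (fun u h' => (hd u (Set.Ico_subset_Icc_self h')).hasDerivWithinAt)
      (by simpa [polarPoint] using hV) (fun _ => hasDerivAt_const _ _)
      (fun u h' hVu => h.level_deriv_neg (hm u (Set.Ico_subset_Icc_self h')) hVu) ⟨ht, le_rfl⟩
  have hup : ∀ t, 0 ≤ t → r t < δ := by
    by_contra hcon
    push Not at hcon
    obtain ⟨t, ht, hrt⟩ := hcon
    obtain ⟨s, hs0, -, hs, hlt⟩ := exists_first_exit hrc.continuousOn h0' ht hrt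
    have h1 := hlev s hs0.le fun u hu => by
      rcases hu.2.lt_or_eq with h' | h'
      · exact (hlt u hu.1 h').le
      · rw [h']; exact hs.le
    exact absurd (h.lt_outer _ (by rw [polarPoint_normSq, hs])) (not_lt.2 h1)
  exact ⟨⟨hlow θ hθ, (hup θ hθ).le⟩, hlev θ hθ fun u hu => (hup u hu.1).le⟩

theorem exists_limitCycle (h : TrappingAnnulus G V ε δ κ) :
    ∃ γ, IsLimitCycleAround G 0 γ ∧ Set.range γ ⊆ annulus ε δ := by
  have hεδ := h.lt.le
  obtain ⟨K, B, hKB⟩ := h.exists_slope_bounds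
  have hmem : ∀ ρ, (Set.projIcc ε δ hεδ ρ : ℝ) ∈ Set.Icc ε δ := fun ρ => Subtype.prop _
  have hL : ∀ θ, LipschitzWith K (clampedSlope G hεδ θ) := fun θ => by
    have := (hKB θ).1.comp
      (((LipschitzWith.subtype_val _).comp (LipschitzWith.projIcc hεδ)).lipschitzOnWith
        (s := Set.univ)) fun ρ _ => hmem ρ
    rw [lipschitzOnWith_univ] at this
    simpa using! this
  have hc : ∀ ρ, Continuous fun θ => clampedSlope G hεδ θ ρ := fun ρ =>
    continuous_iff_continuousAt.2 fun θ => ContinuousAt.comp (g := slope G)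
      (f := fun θ : ℝ => (θ, (Set.projIcc ε δ hεδ ρ : ℝ)))
      (h.contDiffAt_slope (hmem ρ) θ).continuousAt (by fun_prop)
  have hB : ∀ θ ρ, ‖clampedSlope G hεδ θ ρ‖ ≤ B := fun θ ρ => (hKB θ).2 _ (hmem ρ)
  have hper : ∀ θ ρ, clampedSlope G hεδ (θ + 2 * Real.pi) ρ = clampedSlope G hεδ θ ρ :=
    fun θ ρ => slope_add_two_pi _ _
  obtain ⟨r₀, hr₀, hr₀δ, hV₀, hray⟩ := h.exists_outermost
  obtain ⟨r, hr0, hr⟩ := exists_global_solution hL hc hB r₀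
  have hrc : Continuous r := continuous_iff_continuousAt.2 fun t => (hr t).continuousAt
  have htr : ∀ θ, 0 ≤ θ → r θ ∈ Set.Icc ε δ ∧ V (polarPoint (r θ) θ) ≤ κ := fun θ hθ =>
    h.trapped hr (by rwa [hr0]) (by rwa [hr0]) (by rw [hr0, hV₀]) hθ
  -- After one turn the solution is on the initial ray with V ≤ κ, and beyond r₀ on this ray V
  -- exceeds κ. Equality would close the orbit, and V along it would have a maximum at θ = 0,
  -- against the strictly negative derivative on the level κ.
  have hdec : r (2 * Real.pi) < r 0 := by
    have h2 := htr (2 * Real.pi) Real.two_pi_pos.le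
    have hle : r (2 * Real.pi) ≤ r 0 := by
      by_contra hcon
      push Not at hcon
      rw [hr0] at hcon
      have := hray _ hcon h2.1.2
      have h3 := h2.2
      simp only [polarPoint, Real.cos_two_pi, Real.sin_two_pi, mul_one, mul_zero] at h3
      linarith
    refine lt_of_le_of_ne hle fun heq => ?_
    have hrper : Function.Periodic r (2 * Real.pi) := fun t => congrFun
      (ODE_solution_unique_univ (v := clampedSlope G hεδ) (s := fun _ => Set.univ) (K := K)
        (t₀ := 0) (f := fun t => r (t + 2 * Real.pi)) (g := r)
        (fun t => (hL t).lipschitzOnWith)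
        (fun t => ⟨by
          have := (hr (t + 2 * Real.pi)).comp_add_const t (2 * Real.pi)
          rwa [hper] at this, trivial⟩)
        (fun t => ⟨hr t, trivial⟩) (by simpa using heq)) t
    have hm0 := (htr 0 le_rfl).1
    have hmax : IsLocalMax (fun θ => V (polarPoint (r θ) θ)) 0 := Eventually.of_forall fun θ => by
      have hvp : Function.Periodic (fun θ => V (polarPoint (r θ) θ)) (2 * Real.pi) := fun θ => by
        simp only [hrper θ, polarPoint_add_two_pi]
      obtain ⟨θ', h1, h2⟩ := hvp.exists_mem_Ico₀ Real.two_pi_pos θ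
      simp only at h2 ⊢
      rw [h2]
      refine (htr θ' h1.1).2.trans_eq ?_
      simp [polarPoint, hr0, hV₀]
    have h3 := hmax.hasDerivAt_eq_zero (h.hasDerivAt_level hm0
      (by rw [← clampedSlope_eq hεδ hm0]; exact hr 0))
    exact (h.level_deriv_neg hm0 (by simp [polarPoint, hr0, hV₀])).ne h3
  obtain ⟨s, hs, hsper, hs0, hlim⟩ := exists_periodic_solution hL hc hB Real.two_pi_pos hper hr
    (fun t ht => (htr t ht).1.1) hdec
  have hsc : Continuous s := continuous_iff_continuousAt.2 fun t => (hs t).continuousAt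
  have hlim' : ∀ φ, Tendsto (fun n : ℕ => r (φ + n * (2 * Real.pi))) atTop (𝓝 (s φ)) := fun φ => by
    have h1 : Tendsto (fun n : ℕ => φ + n * (2 * Real.pi)) atTop atTop :=
      tendsto_atTop_add_const_left _ _
        (tendsto_natCast_atTop_atTop.atTop_mul_const Real.two_pi_pos)
    have h2 := (hlim.comp h1).add_const (s φ)
    rw [zero_add] at h2
    refine h2.congr fun n => ?_
    simp only [Function.comp_apply]
    rw [hsper.nat_mul n φ, sub_add_cancel]
  have hsm : ∀ θ, s θ ∈ Set.Icc ε δ := fun θ => by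
    refine isClosed_Icc.mem_of_tendsto (hlim' θ) ?_
    have h1 : Tendsto (fun n : ℕ => θ + n * (2 * Real.pi)) atTop atTop :=
      tendsto_atTop_add_const_left _ _
        (tendsto_natCast_atTop_atTop.atTop_mul_const Real.two_pi_pos)
    exact (h1.eventually_ge_atTop 0).mono fun n hn => (htr _ hn).1
  obtain ⟨θ₁, hθ₁0, -, hθ₁s, hθ₁, hθ₁T⟩ := h.exists_planar_solution hsc
  obtain ⟨θ₂, hθ₂0, hθ₂m, hθ₂s, hθ₂, -⟩ := h.exists_planar_solution hrc
  obtain ⟨T, hT, hθT⟩ := hθ₁T hsper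
  set γ : ℝ → ℝ × ℝ := fun t => polarPoint (s (θ₁ t)) (θ₁ t) with hγ
  have hrange : Set.range γ = Set.range fun θ => polarPoint (s θ) θ := by
    have : γ = (fun θ => polarPoint (s θ) θ) ∘ θ₁ := rfl
    rw [this, hθ₁s.range_comp]
  have hpc : Continuous fun θ => polarPoint (s θ) θ :=
    continuous_polarPoint.comp (continuous_id.prodMk hsc)
  have hclosed : IsClosed (Set.range γ) := by
    have hp : Function.Periodic (fun θ => polarPoint (s θ) θ) (2 * Real.pi) := fun θ => by
      simp only [hsper θ, polarPoint_add_two_pi]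
    rw [hrange, ← hp.image_Icc Real.two_pi_pos 0]
    exact (isCompact_Icc.image hpc).isClosed
  refine ⟨γ, ⟨?_, ⟨T, hT, ?_⟩, ?_, ?_, ?_, ?_⟩, ?_⟩
  · intro t _
    refine (hθ₁ t (hsm _) ?_).hasDerivWithinAt
    rw [← clampedSlope_eq hεδ (hsm _)]
    exact hs _
  · intro t
    simp only [hγ, hθT, hsper _, polarPoint_add_two_pi]
  · obtain ⟨t, ht⟩ := hθ₁s Real.pi
    refine ⟨t, fun heq => ?_⟩
    have h1 := congrArg Prod.fst heq
    simp only [hγ, ht, hθ₁0, polarPoint, Real.cos_pi, Real.cos_zero] at h1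
    linarith [(hsm Real.pi).1, (hsm 0).1, h.pos]
  · have hθ₂n : ∀ t, 0 ≤ t → 0 ≤ θ₂ t := fun t ht => hθ₂0.symm.le.trans (hθ₂m.monotone ht)
    refine ⟨fun t => polarPoint (r (θ₂ t)) (θ₂ t), fun t ht => ?_, ?_, ?_⟩
    · have hm := (htr (θ₂ t) (hθ₂n t ht)).1
      refine (hθ₂ t hm ?_).hasDerivWithinAt
      rw [← clampedSlope_eq hεδ hm]
      exact hr _
    · rw [hrange]
      rintro ⟨φ, hφ⟩
      simp only [hθ₂0] at hφ
      have h1 := polarPoint_normSq (s φ) φ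
      have h2 := polarPoint_normSq (r 0) 0
      rw [hφ, h2] at h1
      have hrpos : 0 < r 0 := h.pos.trans_le (htr 0 le_rfl).1.1
      -- If the starting point of w were on the cycle, moduli and angles would agree up to a
      -- multiple of 2π, so s 0 = r 0, whereas s 0 < r 0.
      have h3 : s φ = r 0 := ((sq_eq_sq₀ hrpos.le (h.pos.le.trans (hsm φ).1)).1 h1).symm
      have h4 := congrArg Prod.fst hφ
      simp only [polarPoint, h3, Real.cos_zero] at h4
      obtain ⟨n, hn⟩ := (Real.cos_eq_one_iff φ).1 (mul_left_cancel₀ hrpos.ne' h4)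
      have h5 : s φ = s 0 := by
        have := hsper.int_mul n 0
        rwa [zero_add, hn] at this
      exact hs0.ne (h5.symm.trans h3)
    · have hθ₂t : Tendsto θ₂ atTop atTop :=
        (hθ₂m.orderIsoOfSurjective θ₂ hθ₂s).tendsto_atTop
      ext Q
      constructor
      · intro hQ
        by_contra hcon
        obtain ⟨η, hη, hball⟩ := Metric.isOpen_iff.1 hclosed.isOpen_compl Q hcon
        have h1 : ∀ᶠ t in atTop, |r (θ₂ t) - s (θ₂ t)| < η / 2 := by
          have := (hlim.comp hθ₂t).abs
          rw [abs_zero] at this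
          exact this.eventually_lt_const (half_pos hη)
        have h2 := mapClusterPt_iff_frequently.1 hQ _ (Metric.ball_mem_nhds Q (half_pos hη))
        obtain ⟨t, ht1, ht2⟩ := (h2.and_eventually h1).exists
        have h3 : polarPoint (s (θ₂ t)) (θ₂ t) ∈ Metric.ball Q η := by
          rw [Metric.mem_ball] at ht1 ⊢
          have := dist_triangle_left (polarPoint (s (θ₂ t)) (θ₂ t)) Q
            (polarPoint (r (θ₂ t)) (θ₂ t))
          have := dist_polarPoint_le (r (θ₂ t)) (s (θ₂ t)) (θ₂ t)
          linarith
        exact hball h3 (by rw [hrange]; exact ⟨_, rfl⟩)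
      · rw [hrange]
        rintro ⟨φ, rfl⟩
        have h1 : Tendsto (fun n : ℕ => φ + n * (2 * Real.pi)) atTop atTop :=
          tendsto_atTop_add_const_left _ _
            (tendsto_natCast_atTop_atTop.atTop_mul_const Real.two_pi_pos)
        set e := hθ₂m.orderIsoOfSurjective θ₂ hθ₂s with he
        have he' : ∀ x, θ₂ (e.symm x) = x := fun x => e.apply_symm_apply x
        -- Sample w at the times when its angle is φ + 2πn: it then lies on a fixed ray and
        -- converges to the point of the cycle on that ray.
        refine MapClusterPt.of_comp (e.symm.tendsto_atTop.comp h1) (Tendsto.mapClusterPt ?_)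
        have h2 : Tendsto (fun n : ℕ => polarPoint (r (φ + n * (2 * Real.pi))) φ) atTop
            (𝓝 (polarPoint (s φ) φ)) :=
          ((continuous_polarPoint.comp (continuous_const.prodMk continuous_id)).tendsto _).comp
            (hlim' φ)
        refine h2.congr fun n => ?_
        have hp : Function.Periodic (polarPoint (r (φ + n * (2 * Real.pi)))) (2 * Real.pi) :=
          polarPoint_add_two_pi _
        simp only [Function.comp_apply, he']
        exact (hp.nat_mul n φ).symm
  · rw [hrange]
    rintro ⟨θ, hθ⟩
    have h1 := polarPoint_normSq (s θ) θ
    simp only at hθ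
    rw [hθ] at h1
    simp only [Prod.fst_zero, Prod.snd_zero] at h1
    nlinarith [(hsm θ).1, h.pos]
  · rw [hrange]
    exact isBounded_component_polar hsper hsc h.pos (fun θ => (hsm θ).1) (fun θ => (hsm θ).2)
  · rintro _ ⟨t, rfl⟩
    exact polarPoint_mem_annulus h.pos.le (hsm _).1 (hsm _).2 _

end TrappingAnnulus

open Asymptotics

/-! ### The quartic Lyapunov function of a weak focus -/

theorem isBigO_monomial (i j : ℕ) :
    (fun ζ : ℝ × ℝ => ζ.1 ^ i * ζ.2 ^ j) =O[𝓝 0] fun ζ => ‖ζ‖ ^ (i + j) := by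
  simp only [pow_add]
  exact ((IsBigO.of_norm_le fun ζ : ℝ × ℝ => norm_fst_le ζ).pow i).mul
    ((IsBigO.of_norm_le fun ζ : ℝ × ℝ => norm_snd_le ζ).pow j)

theorem isBigO_quadratic (a b c : ℝ) :
    (fun ζ : ℝ × ℝ => a * ζ.1 ^ 2 + b * (ζ.1 * ζ.2) + c * ζ.2 ^ 2) =O[𝓝 0] fun ζ => ‖ζ‖ ^ 2 := by
  have h1 := (isBigO_monomial 2 0).const_mul_left a
  have h2 := (isBigO_monomial 1 1).const_mul_left b
  have h3 := (isBigO_monomial 0 2).const_mul_left c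
  simpa using! (h1.add h2).add h3

theorem isBigO_cubic (a b c d : ℝ) :
    (fun ζ : ℝ × ℝ => a * ζ.1 ^ 3 + b * (ζ.1 ^ 2 * ζ.2) + c * (ζ.1 * ζ.2 ^ 2) + d * ζ.2 ^ 3)
      =O[𝓝 0] fun ζ => ‖ζ‖ ^ 3 := by
  have h1 := (isBigO_monomial 3 0).const_mul_left a
  have h2 := (isBigO_monomial 2 1).const_mul_left b
  have h3 := (isBigO_monomial 1 2).const_mul_left c
  have h4 := (isBigO_monomial 0 3).const_mul_left d
  simpa using! ((h1.add h2).add h3).add h4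

theorem isBigO_norm_pow_of_le {m n : ℕ} (h : m ≤ n) :
    (fun ζ : ℝ × ℝ => ‖ζ‖ ^ n) =O[𝓝 0] fun ζ => ‖ζ‖ ^ m := by
  refine IsBigO.of_bound 1 ?_
  filter_upwards [Metric.closedBall_mem_nhds (0 : ℝ × ℝ) one_pos] with ζ hζ
  have hζ' : ‖ζ‖ ≤ 1 := mem_closedBall_zero_iff.1 hζ
  rw [one_mul, Real.norm_of_nonneg (by positivity), Real.norm_of_nonneg (by positivity)]
  exact pow_le_pow_of_le_one (norm_nonneg _) hζ' h

theorem isLittleO_norm_pow {m n : ℕ} (h : m < n) :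
    (fun ζ : ℝ × ℝ => ‖ζ‖ ^ n) =o[𝓝 0] fun ζ => ‖ζ‖ ^ m := by
  have := (isLittleO_pow_pow (𝕜 := ℝ) h).comp_tendsto (tendsto_norm_zero (E := ℝ × ℝ))
  exact this

theorem norm_sq_le_sum_sq (ζ : ℝ × ℝ) : ‖ζ‖ ^ 2 ≤ ζ.1 ^ 2 + ζ.2 ^ 2 := by
  rw [Prod.norm_def]
  rcases max_cases ‖ζ.1‖ ‖ζ.2‖ with ⟨h, -⟩ | ⟨h, -⟩ <;> rw [h, Real.norm_eq_abs, sq_abs] <;>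
    nlinarith [sq_nonneg ζ.1, sq_nonneg ζ.2]

theorem sum_sq_le_norm_sq (ζ : ℝ × ℝ) : ζ.1 ^ 2 + ζ.2 ^ 2 ≤ 2 * ‖ζ‖ ^ 2 := by
  have h1 := pow_le_pow_left₀ (norm_nonneg _) (norm_fst_le ζ) 2
  have h2 := pow_le_pow_left₀ (norm_nonneg _) (norm_snd_le ζ) 2
  rw [Real.norm_eq_abs, sq_abs] at h1 h2
  linarith

theorem isBigO_norm_pow_sum_sq (k : ℕ) :
    (fun ζ : ℝ × ℝ => ‖ζ‖ ^ (2 * k)) =O[𝓝 0] fun ζ => (ζ.1 ^ 2 + ζ.2 ^ 2) ^ k := by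
  refine IsBigO.of_bound 1 (Eventually.of_forall fun ζ => ?_)
  rw [one_mul, Real.norm_of_nonneg (by positivity), Real.norm_of_nonneg (by positivity), pow_mul]
  exact pow_le_pow_left₀ (by positivity) (norm_sq_le_sum_sq ζ) k

/-- Near a weak focus `u' = - ω v`, `v' = ω u + h`, where `h` has a Taylor expansion of order three
without linear part, there is a function `V ∼ u ^ 2 + v ^ 2` whose derivative along the flow is
`c (u ^ 2 + v ^ 2) ^ 2` up to higher order. -/
theorem exists_quartic_lyapunov {ω : ℝ} (hω : ω ≠ 0) (b20 b11 b02 b30 b21 b12 b03 : ℝ)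
    {h : ℝ × ℝ → ℝ}
    (hh : (fun ζ : ℝ × ℝ => h ζ - ((b20 * ζ.1 ^ 2 + b11 * (ζ.1 * ζ.2) + b02 * ζ.2 ^ 2) +
      (b30 * ζ.1 ^ 3 + b21 * (ζ.1 ^ 2 * ζ.2) + b12 * (ζ.1 * ζ.2 ^ 2) + b03 * ζ.2 ^ 3)))
      =O[𝓝 0] fun ζ => ‖ζ‖ ^ 4) :
    ∃ V : ℝ × ℝ → ℝ, ContDiff ℝ 1 V ∧
      (fun ζ => V ζ - (ζ.1 ^ 2 + ζ.2 ^ 2)) =o[𝓝 0] (fun ζ => ζ.1 ^ 2 + ζ.2 ^ 2) ∧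
      (fun ζ => fderiv ℝ V ζ (-ω * ζ.2, ω * ζ.1 + h ζ) -
        (b21 + 3 * b03 - b11 * (b20 + b02) / ω) / 4 * (ζ.1 ^ 2 + ζ.2 ^ 2) ^ 2)
        =o[𝓝 0] fun ζ => (ζ.1 ^ 2 + ζ.2 ^ 2) ^ 2 := by
  set c := (b21 + 3 * b03 - b11 * (b20 + b02) / ω) / 4 with hc
  -- The cubic part of V is chosen to cancel the cubic part 2v(b20 u² + b11 uv + b02 v²) of the
  -- derivative; the rotation operator -ωv∂_u + ωu∂_v is invertible on cubic forms.
  obtain ⟨c12, hc12⟩ : ∃ x, x = 2 * b02 / ω := ⟨_, rfl⟩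
  obtain ⟨c30, hc30⟩ : ∃ x, x = (2 * b20 + 4 * b02) / (3 * ω) := ⟨_, rfl⟩
  obtain ⟨c03, hc03⟩ : ∃ x, x = -2 * b11 / (3 * ω) := ⟨_, rfl⟩
  -- On quartic forms that operator kills (u²+v²)², so a multiple of (u²+v²)² must remain, which
  -- fixes c. Its kernel also leaves one free coefficient in V, and the u²v² term is set to zero.
  obtain ⟨d31, hd31⟩ : ∃ x, x = c / ω := ⟨_, rfl⟩
  obtain ⟨d13, hd13⟩ : ∃ x, x = -(c - 2 * b03 - 3 * c03 * b02) / ω := ⟨_, rfl⟩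
  obtain ⟨d40, hd40⟩ : ∃ x, x = (2 * b30 + 2 * c12 * b20) / (4 * ω) := ⟨_, rfl⟩
  obtain ⟨d04, hd04⟩ : ∃ x, x = -(2 * b12 + 2 * c12 * b02 + 3 * c03 * b11) / (4 * ω) := ⟨_, rfl⟩
  set V : ℝ × ℝ → ℝ := fun ζ => ζ.1 ^ 2 + ζ.2 ^ 2 +
    (c30 * ζ.1 ^ 3 + c12 * (ζ.1 * ζ.2 ^ 2) + c03 * ζ.2 ^ 3) +
    (d40 * ζ.1 ^ 4 + d31 * (ζ.1 ^ 3 * ζ.2) + d13 * (ζ.1 * ζ.2 ^ 3) + d04 * ζ.2 ^ 4) with hV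
  have hVd : ∀ ζ w : ℝ × ℝ, fderiv ℝ V ζ w =
      (2 * ζ.1 + (3 * c30 * ζ.1 ^ 2 + c12 * ζ.2 ^ 2) +
        (4 * d40 * ζ.1 ^ 3 + 3 * d31 * (ζ.1 ^ 2 * ζ.2) + d13 * ζ.2 ^ 3)) * w.1 +
      (2 * ζ.2 + (2 * c12 * (ζ.1 * ζ.2) + 3 * c03 * ζ.2 ^ 2) +
        (d31 * ζ.1 ^ 3 + 3 * d13 * (ζ.1 * ζ.2 ^ 2) + 4 * d04 * ζ.2 ^ 3)) * w.2 := by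
    intro ζ w
    have hu : HasFDerivAt (fun ζ : ℝ × ℝ => ζ.1) (ContinuousLinearMap.fst ℝ ℝ ℝ) ζ :=
      hasFDerivAt_fst
    have hv : HasFDerivAt (fun ζ : ℝ × ℝ => ζ.2) (ContinuousLinearMap.snd ℝ ℝ ℝ) ζ :=
      hasFDerivAt_snd
    have := (((hu.pow 2).add (hv.pow 2)).add ((((hu.pow 3).const_mul c30).add
      ((hu.mul (hv.pow 2)).const_mul c12)).add ((hv.pow 3).const_mul c03))).add
      (((((hu.pow 4).const_mul d40).add (((hu.pow 3).mul hv).const_mul d31)).add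
      ((hu.mul (hv.pow 3)).const_mul d13)).add ((hv.pow 4).const_mul d04))
    have h2 : HasFDerivAt V _ ζ := this
    rw [h2.fderiv]
    simp
    ring
  refine ⟨V, by simp only [hV]; fun_prop, ?_, ?_⟩
  · have h3 : (fun ζ : ℝ × ℝ => c30 * ζ.1 ^ 3 + 0 * (ζ.1 ^ 2 * ζ.2) + c12 * (ζ.1 * ζ.2 ^ 2) +
        c03 * ζ.2 ^ 3) =o[𝓝 0] fun ζ => ‖ζ‖ ^ (2 * 1) :=
      (isBigO_cubic _ _ _ _).trans_isLittleO (isLittleO_norm_pow (by norm_num))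
    have h4 : (fun ζ : ℝ × ℝ => d40 * ζ.1 ^ 4 + d31 * (ζ.1 ^ 3 * ζ.2) + d13 * (ζ.1 * ζ.2 ^ 3) +
        d04 * ζ.2 ^ 4) =o[𝓝 0] fun ζ => ‖ζ‖ ^ (2 * 1) := by
      have h1 := (isBigO_monomial 4 0).const_mul_left d40
      have h2 := (isBigO_monomial 3 1).const_mul_left d31
      have h3 := (isBigO_monomial 1 3).const_mul_left d13
      have h4 := (isBigO_monomial 0 4).const_mul_left d04
      refine IsBigO.trans_isLittleO (g := fun ζ => ‖ζ‖ ^ 4) ?_ (isLittleO_norm_pow (by norm_num))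
      simpa using! ((h1.add h2).add h3).add h4
    have := (h3.add h4).trans_isBigO (isBigO_norm_pow_sum_sq 1)
    simp only [pow_one] at this
    refine this.congr_left fun ζ => ?_
    simp only [hV]; ring
  · set ρ : ℝ × ℝ → ℝ := fun ζ => h ζ - ((b20 * ζ.1 ^ 2 + b11 * (ζ.1 * ζ.2) + b02 * ζ.2 ^ 2) +
      (b30 * ζ.1 ^ 3 + b21 * (ζ.1 ^ 2 * ζ.2) + b12 * (ζ.1 * ζ.2 ^ 2) + b03 * ζ.2 ^ 3)) with hρ
    have e2 := isBigO_quadratic b20 b11 b02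
    have e3 := isBigO_cubic b30 b21 b12 b03
    have f2 := isBigO_quadratic 0 (2 * c12) (3 * c03)
    have f3 := isBigO_cubic d31 0 (3 * d13) (4 * d04)
    have f1 : (fun ζ : ℝ × ℝ => 2 * ζ.2) =O[𝓝 0] fun ζ => ‖ζ‖ ^ 1 := by
      simpa using! (isBigO_monomial 0 1).const_mul_left 2
    have g1 := (f1.add (f2.trans (isBigO_norm_pow_of_le (by norm_num : 1 ≤ 2)))).add
      (f3.trans (isBigO_norm_pow_of_le (by norm_num : 1 ≤ 3)))
    -- What the cancellations leave over: products of a part of ∂V/∂v with a part of h of total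
    -- order at least five.
    have t1 := f2.mul e3
    have t2 := f3.mul e2
    have t3 := f3.mul (e3.trans (isBigO_norm_pow_of_le (by norm_num : 2 ≤ 3)))
    have t4 := g1.mul hh
    simp only [← pow_add] at t1 t2 t3 t4
    norm_num only at t1 t2 t3 t4
    have t5 := ((((t1.add t2).add t3).add t4).trans_isLittleO
      (isLittleO_norm_pow (by norm_num : 4 < 5))).trans_isBigO (isBigO_norm_pow_sum_sq 2)
    refine t5.congr_left fun ζ => ?_
    rw [hVd]
    have hh' : h ζ = ρ ζ + ((b20 * ζ.1 ^ 2 + b11 * (ζ.1 * ζ.2) + b02 * ζ.2 ^ 2) +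
      (b30 * ζ.1 ^ 3 + b21 * (ζ.1 ^ 2 * ζ.2) + b12 * (ζ.1 * ζ.2 ^ 2) + b03 * ζ.2 ^ 3)) := by
      simp only [hρ]; ring
    rw [hh']
    generalize ρ ζ = R
    rw [hd31, hd13, hd40, hd04, hc12, hc30, hc03, hc]
    field_simp
    ring

/-! ### From the Lyapunov function to weak sinks and limit cycles -/

theorem exists_disc_subset {s : Set (ℝ × ℝ)} (hs : s ∈ 𝓝 (0 : ℝ × ℝ)) :
    ∃ δ > 0, ∀ ζ : ℝ × ℝ, ζ.1 ^ 2 + ζ.2 ^ 2 ≤ δ ^ 2 → ζ ∈ s := by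
  obtain ⟨η, hη, hball⟩ := Metric.mem_nhds_iff.1 hs
  refine ⟨η / 2, half_pos hη, fun ζ hζ => hball ?_⟩
  rw [mem_ball_zero_iff]
  have := abs_le_of_sq_le_sq ((norm_sq_le_sum_sq ζ).trans hζ) (half_pos hη).le
  rw [abs_of_nonneg (norm_nonneg ζ)] at this
  linarith

theorem eventually_quartic_bounds {V : ℝ × ℝ → ℝ} {G : ℝ × ℝ → ℝ × ℝ} {k : ℝ} (hk : 0 < k)
    (hV : (fun ζ => V ζ - (ζ.1 ^ 2 + ζ.2 ^ 2)) =o[𝓝 0] fun ζ : ℝ × ℝ => ζ.1 ^ 2 + ζ.2 ^ 2)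
    (hV' : (fun ζ => fderiv ℝ V ζ (G ζ) + k * (ζ.1 ^ 2 + ζ.2 ^ 2) ^ 2)
      =o[𝓝 0] fun ζ : ℝ × ℝ => (ζ.1 ^ 2 + ζ.2 ^ 2) ^ 2) :
    ∀ᶠ ζ : ℝ × ℝ in 𝓝 0,
      ((ζ.1 ^ 2 + ζ.2 ^ 2) / 2 ≤ V ζ ∧ V ζ ≤ 3 / 2 * (ζ.1 ^ 2 + ζ.2 ^ 2)) ∧
      (-(3 / 2 * k) * (ζ.1 ^ 2 + ζ.2 ^ 2) ^ 2 ≤ fderiv ℝ V ζ (G ζ) ∧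
        fderiv ℝ V ζ (G ζ) ≤ -(k / 2) * (ζ.1 ^ 2 + ζ.2 ^ 2) ^ 2) := by
  filter_upwards [hV.def one_half_pos, hV'.def (half_pos hk)] with ζ h1 h2
  rw [Real.norm_eq_abs, Real.norm_of_nonneg (by positivity), abs_le] at h1 h2
  obtain ⟨h1, h1'⟩ := h1
  obtain ⟨h2, h2'⟩ := h2
  refine ⟨⟨?_, ?_⟩, ?_, ?_⟩ <;> linarith

theorem isWeakSink_of_chart {F G : ℝ × ℝ → ℝ × ℝ} {P : ℝ × ℝ} {A : (ℝ × ℝ) ≃L[ℝ] (ℝ × ℝ)}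
    {V : ℝ × ℝ → ℝ} {k : ℝ} (hk : 0 < k) (hF0 : F P = 0) (hF : ContDiffAt ℝ 1 F P)
    (hG : ∀ᶠ z in 𝓝 P, A (F z) = G (A (z - P))) (hVd : ContDiff ℝ 1 V)
    (hV : (fun ζ => V ζ - (ζ.1 ^ 2 + ζ.2 ^ 2)) =o[𝓝 0] fun ζ : ℝ × ℝ => ζ.1 ^ 2 + ζ.2 ^ 2)
    (hV' : (fun ζ => fderiv ℝ V ζ (G ζ) + k * (ζ.1 ^ 2 + ζ.2 ^ 2) ^ 2)
      =o[𝓝 0] fun ζ : ℝ × ℝ => (ζ.1 ^ 2 + ζ.2 ^ 2) ^ 2) : IsWeakSink F P := by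
  obtain ⟨K, s, hs, hK⟩ := hF.exists_lipschitzOnWith
  have hφ : Tendsto (fun z => A (z - P)) (𝓝 P) (𝓝 0) := by
    have : Continuous fun z => A (z - P) := A.continuous.comp (by fun_prop)
    simpa using this.tendsto P
  obtain ⟨R, hR, hball⟩ := Metric.nhds_basis_closedBall.mem_iff.1
    (inter_mem hs (inter_mem hG (hφ.eventually (eventually_quartic_bounds hk hV hV'))))
  have hb : ∀ z, dist z P ≤ R → _ := fun z hz => (hball (Metric.mem_closedBall.2 hz)).2
  have hWd : ∀ z, HasFDerivAt (fun z => V (A (z - P)))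
      ((fderiv ℝ V (A (z - P))).comp (A : (ℝ × ℝ) →L[ℝ] (ℝ × ℝ))) z := fun z => by
    have h1 : HasFDerivAt (fun z => A (z - P)) (A : (ℝ × ℝ) →L[ℝ] (ℝ × ℝ)) z :=
      A.hasFDerivAt.comp z ((hasFDerivAt_id z).sub_const P)
    exact ((hVd.differentiable one_ne_zero).differentiableAt.hasFDerivAt).comp z h1
  have hW' : ∀ z, dist z P ≤ R → fderiv ℝ (fun z => V (A (z - P))) z (F z) =
      fderiv ℝ V (A (z - P)) (G (A (z - P))) := fun z hz => by
    rw [(hWd z).fderiv, ← (hb z hz).1]; rfl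
  have hA : ∀ w, ‖A w‖ ≤ ‖(A : (ℝ × ℝ) →L[ℝ] (ℝ × ℝ))‖ * ‖w‖ := fun w =>
    (A : (ℝ × ℝ) →L[ℝ] (ℝ × ℝ)).le_opNorm w
  have hA' : ∀ w, ‖w‖ ≤ ‖(A.symm : (ℝ × ℝ) →L[ℝ] (ℝ × ℝ))‖ * ‖A w‖ := fun w => by
    simpa using (A.symm : (ℝ × ℝ) →L[ℝ] (ℝ × ℝ)).le_opNorm (A w)
  set a := ‖(A : (ℝ × ℝ) →L[ℝ] (ℝ × ℝ))‖
  set b := ‖(A.symm : (ℝ × ℝ) →L[ℝ] (ℝ × ℝ))‖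
  have hbpos : 0 < b := A.norm_symm_pos
  -- With s = u²+v² one has ‖ζ‖² ≤ s ≤ 2‖ζ‖² for the maximum norm and s/2 ≤ W ≤ 3s/2. These give
  -- 1/(2b²) and 3a², and the bounds -(3k/2)s² and -(k/2)s² become -6k W² and -(2k/9) W².
  have hQ : QuarticDecay F P (fun z => V (A (z - P))) R (1 / (2 * b ^ 2)) (3 * a ^ 2)
      (2 / 9 * k) (6 * k) :=
    { R_pos := hR
      c₁_pos := by positivity
      c_pos := by positivity
      C_pos := by positivity
      diff := fun z _ => (hWd z).differentiableAt
      lower := fun z hz => by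
        have h1 := (hb z hz).2.1.1
        have h2 := norm_sq_le_sum_sq (A (z - P))
        have h3 := pow_le_pow_left₀ (norm_nonneg _) (hA' (z - P)) 2
        rw [dist_eq_norm, one_div, inv_mul_le_iff₀ (by positivity)]
        rw [mul_pow] at h3
        have h4 := mul_le_mul_of_nonneg_left h2 (sq_nonneg b)
        have h5 := mul_le_mul_of_nonneg_left h1 (sq_nonneg b)
        linarith
      upper := fun z hz => by
        have h1 := (hb z hz).2.1.2
        have h2 := sum_sq_le_norm_sq (A (z - P))
        have h3 := pow_le_pow_left₀ (norm_nonneg _) (hA (z - P)) 2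
        rw [mul_pow] at h3
        rw [dist_eq_norm]
        linarith
      deriv_lower := fun z hz => by
        obtain ⟨-, ⟨h1, -⟩, h2, -⟩ := hb z hz
        rw [hW' z hz]
        have h3 := pow_le_pow_left₀ (by positivity) h1 2
        have h4 := mul_le_mul_of_nonneg_left h3 hk.le
        linarith
      deriv_upper := fun z hz => by
        obtain ⟨-, ⟨h1, h1'⟩, -, h2⟩ := hb z hz
        rw [hW' z hz]
        have h3 := pow_le_pow_left₀ (le_trans (by positivity) h1) h1' 2
        have h4 := mul_le_mul_of_nonneg_left h3 hk.le
        linarith }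
  exact hQ.isWeakSink hF0 (hK.mono fun z hz => (hball hz).1)

/-- The change of chart is an affine homeomorphism with Lipschitz linear part, so it carries
solutions, cluster points, connected components and bounded sets along. -/
theorem IsLimitCycleAround.of_chart {F : ℝ × ℝ → ℝ × ℝ} {P : ℝ × ℝ}
    {A : (ℝ × ℝ) ≃L[ℝ] (ℝ × ℝ)} {γ : ℝ → ℝ × ℝ}
    (h : IsLimitCycleAround (chartField F P A) 0 γ) :
    IsLimitCycleAround F P fun t => P + A.symm (γ t) := by
  set e : (ℝ × ℝ) ≃ₜ (ℝ × ℝ) := A.symm.toHomeomorph.trans (Homeomorph.addLeft P) with he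
  have hee : ∀ ζ, e ζ = P + A.symm ζ := fun ζ => rfl
  have he0 : e 0 = P := by simp [hee]
  have hsol : ∀ {w : ℝ → ℝ × ℝ} {s : Set ℝ}, IsSolutionOn (chartField F P A) w s →
      IsSolutionOn F (fun t => e (w t)) s := fun {w s} hw t ht => by
    have h1 := ((A.symm : (ℝ × ℝ) →L[ℝ] (ℝ × ℝ)).hasFDerivAt.comp_hasDerivWithinAt t
      (hw t ht)).const_add P
    simp only [chartField] at h1
    rw [ContinuousLinearEquiv.coe_coe, A.symm_apply_apply] at h1
    exact h1
  have hrange : Set.range (fun t => e (γ t)) = e '' Set.range γ := Set.range_comp e γ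
  obtain ⟨h1, ⟨T, hT, h2⟩, ⟨t, ht⟩, ⟨w, hw1, hw2, hw3⟩, h5, h6⟩ := h
  change IsLimitCycleAround F P fun t => e (γ t)
  refine ⟨hsol h1, ⟨T, hT, fun t => by simp only [h2 t]⟩, ⟨t, fun h => ht (e.injective h)⟩,
    ⟨fun t => e (w t), hsol hw1, ?_, ?_⟩, ?_, ?_⟩
  · rw [hrange]
    rintro ⟨ζ, hζ, heq⟩
    exact hw2 (e.injective heq ▸ hζ)
  · rw [hrange, ← hw3]
    ext Q
    constructor
    · intro hQ
      refine ⟨e.symm Q, ?_, e.apply_symm_apply Q⟩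
      have := MapClusterPt.continuousAt_comp (f := e.symm) e.symm.continuous.continuousAt hQ
      simpa [Function.comp_def] using! this
    · rintro ⟨ζ, hζ, rfl⟩
      exact MapClusterPt.continuousAt_comp (f := e) e.continuous.continuousAt hζ
  · rw [hrange]
    rintro ⟨ζ, hζ, heq⟩
    rw [← he0] at heq
    exact h5 (e.injective heq ▸ hζ)
  · rw [hrange, ← Set.image_compl_eq e.bijective, ← he0, ← e.image_connectedComponentIn h5]
    have h7 : Bornology.IsBounded (A.symm '' connectedComponentIn (Set.range γ)ᶜ 0) :=
      (A.symm : (ℝ × ℝ) →L[ℝ] (ℝ × ℝ)).lipschitz.isBounded_image h6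
    have h8 : e '' connectedComponentIn (Set.range γ)ᶜ 0 =
        (fun z => P + z) '' (A.symm '' connectedComponentIn (Set.range γ)ᶜ 0) := by
      rw [Set.image_image]; rfl
    rw [h8]
    exact (isometry_add_left P).lipschitz.isBounded_image h7

theorem isCompact_annulus (ε δ : ℝ) : IsCompact (annulus ε δ) := by
  refine (isCompact_closedBall (0 : ℝ × ℝ) |δ|).of_isClosed_subset ?_ fun ζ hζ => ?_
  · have hc : Continuous fun ζ : ℝ × ℝ => ζ.1 ^ 2 + ζ.2 ^ 2 := by fun_prop
    exact (isClosed_le continuous_const hc).inter (isClosed_le hc continuous_const)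
  · rw [mem_closedBall_zero_iff]
    have := sq_le_sq.1 ((norm_sq_le_sum_sq ζ).trans hζ.2)
    rwa [abs_of_nonneg (norm_nonneg ζ)] at this

/-- If the origin is a weak sink of `G l₀`, with a quartic Lyapunov function, and repelling for
`G l` when `l > l₀`, then limit cycles appear for `l > l₀`. -/
theorem eventually_exists_limitCycle {G : ℝ → ℝ × ℝ → ℝ × ℝ} {l₀ ω k : ℝ} {V : ℝ × ℝ → ℝ}
    (hω : 0 < ω) (hk : 0 < k)
    (hGc : ∀ᶠ ζ in 𝓝 (0 : ℝ × ℝ), ContinuousAt (fun x : ℝ × (ℝ × ℝ) => G x.1 x.2) (l₀, ζ))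
    (hlin : (fun x : ℝ × (ℝ × ℝ) => G x.1 x.2 - (-ω * x.2.2, ω * x.2.1))
      =o[𝓝 (l₀, 0)] fun x => x.2)
    (hsm : ∀ᶠ x : ℝ × (ℝ × ℝ) in 𝓝 (l₀, 0), ContDiffAt ℝ 1 (G x.1) x.2)
    (hin : ∀ᶠ l in 𝓝[>] l₀, ∀ᶠ ζ : ℝ × ℝ in 𝓝 0, ζ ≠ 0 → 0 < ζ.1 * (G l ζ).1 + ζ.2 * (G l ζ).2)
    (hVd : ContDiff ℝ 1 V)
    (hV : (fun ζ => V ζ - (ζ.1 ^ 2 + ζ.2 ^ 2)) =o[𝓝 0] fun ζ : ℝ × ℝ => ζ.1 ^ 2 + ζ.2 ^ 2)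
    (hV' : (fun ζ => fderiv ℝ V ζ (G l₀ ζ) + k * (ζ.1 ^ 2 + ζ.2 ^ 2) ^ 2)
      =o[𝓝 0] fun ζ : ℝ × ℝ => (ζ.1 ^ 2 + ζ.2 ^ 2) ^ 2) {U : Set (ℝ × ℝ)} (hU : U ∈ 𝓝 0) :
    ∀ᶠ l in 𝓝[>] l₀, ∃ γ, IsLimitCycleAround (G l) 0 γ ∧ Set.range γ ⊆ U := by
  -- The rotation contributes at least ω‖ζ‖², and the two error terms at most ω‖ζ‖²/4 each,
  -- uniformly for l near l₀.
  have hrot : ∀ᶠ x : ℝ × (ℝ × ℝ) in 𝓝 (l₀, 0), x.2 ≠ 0 →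
      0 < x.2.1 * (G x.1 x.2).2 - x.2.2 * (G x.1 x.2).1 := by
    filter_upwards [hlin.def (by positivity : 0 < ω / 4)] with x hx hne
    have hpos : 0 < ‖x.2‖ := norm_pos_iff.2 hne
    have h1 := (norm_fst_le _).trans hx
    have h2 := (norm_snd_le _).trans hx
    set m := ‖x.2‖
    have hu : |x.2.1| ≤ m := norm_fst_le x.2
    have hv : |x.2.2| ≤ m := norm_snd_le x.2
    have hsq := norm_sq_le_sum_sq x.2
    simp only [Prod.fst_sub, Prod.snd_sub, Real.norm_eq_abs] at h1 h2
    have h3 : |x.2.1 * ((G x.1 x.2).2 - ω * x.2.1)| ≤ m * (ω / 4 * m) := by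
      rw [abs_mul]; gcongr
    have h4 : |x.2.2 * ((G x.1 x.2).1 - -ω * x.2.2)| ≤ m * (ω / 4 * m) := by
      rw [abs_mul]; gcongr
    have h5 := (abs_le.1 h3).1
    have h6 := (abs_le.1 h4).2
    have h7 : 0 < ω * m ^ 2 := by positivity
    have h8 := mul_le_mul_of_nonneg_left hsq hω.le
    nlinarith
  obtain ⟨pa, hpa, pb, hpb, hprod⟩ := eventually_prod_iff.1 ((nhds_prod_eq (x := l₀)
    (y := (0 : ℝ × ℝ))) ▸ (hrot.and hsm))
  obtain ⟨δ, hδ, hdisc⟩ := exists_disc_subset (inter_mem hU (inter_mem hpb (inter_mem hGc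
    (eventually_quartic_bounds hk hV hV'))))
  have hdU : ∀ ζ : ℝ × ℝ, ζ.1 ^ 2 + ζ.2 ^ 2 ≤ δ ^ 2 → ζ ∈ U := fun ζ hζ => (hdisc ζ hζ).1
  have hdb : ∀ ζ : ℝ × ℝ, ζ.1 ^ 2 + ζ.2 ^ 2 ≤ δ ^ 2 → pb ζ := fun ζ hζ => (hdisc ζ hζ).2.1
  have hdc : ∀ ζ : ℝ × ℝ, ζ.1 ^ 2 + ζ.2 ^ 2 ≤ δ ^ 2 → _ := fun ζ hζ => (hdisc ζ hζ).2.2.1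
  have hdV : ∀ ζ : ℝ × ℝ, ζ.1 ^ 2 + ζ.2 ^ 2 ≤ δ ^ 2 → _ := fun ζ hζ => (hdisc ζ hζ).2.2.2
  -- At l₀ the derivative of V is negative away from the origin; on a compact annulus this persists
  -- for nearby l.
  have hcomp : ∀ᶠ l in 𝓝 l₀, ∀ ζ ∈ annulus (δ / 3) δ, fderiv ℝ V ζ (G l ζ) < 0 := by
    refine (isCompact_annulus _ _).eventually_forall_of_forall_eventually fun ζ hζ => ?_
    have h1 : ContinuousAt (fun x : ℝ × (ℝ × ℝ) => fderiv ℝ V x.2 (G x.1 x.2)) (l₀, ζ) :=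
      (((hVd.continuous_fderiv one_ne_zero).comp continuous_snd).continuousAt).clm_apply
        (hdc ζ hζ.2)
    refine h1.eventually_lt_const (lt_of_le_of_lt (hdV ζ hζ.2).2.2 ?_)
    have h2 : 0 < ζ.1 ^ 2 + ζ.2 ^ 2 := lt_of_lt_of_le (by positivity) hζ.1
    have : 0 < k / 2 * (ζ.1 ^ 2 + ζ.2 ^ 2) ^ 2 := by positivity
    linarith
  filter_upwards [hin, nhdsWithin_le_nhds hpa, nhdsWithin_le_nhds hcomp] with l hl hla hlc
  obtain ⟨ε, hε, hεin⟩ := exists_disc_subset hl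
  set ε' := min ε (δ / 4) with hε'
  have hε'pos : 0 < ε' := lt_min hε (by positivity)
  have hε'δ : ε' ≤ δ / 4 := min_le_right _ _
  have hne : ∀ {ζ : ℝ × ℝ} {r : ℝ}, 0 < r → r ^ 2 ≤ ζ.1 ^ 2 + ζ.2 ^ 2 → ζ ≠ 0 := by
    rintro ζ r hr hζ rfl
    simp only [Prod.fst_zero, Prod.snd_zero] at hζ
    nlinarith
  -- Since s/2 ≤ V ≤ 3s/2 with s = u²+v², the level δ²/4 lies above V(ε', 0) ≤ 3δ²/32, below V ≥
  -- δ²/2 on the outer circle, and in the region s ≥ δ²/6 > (δ/3)², where V is known to decrease.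
  have htrap : TrappingAnnulus (G l) V ε' δ (δ ^ 2 / 4) :=
    { pos := hε'pos
      lt := by linarith
      smooth := fun ζ hζ => (hprod hla (hdb ζ hζ.2)).2
      rot := fun ζ hζ => (hprod hla (hdb ζ hζ.2)).1 (hne hε'pos hζ.1)
      inner := fun ζ hζ => hεin ζ (hζ.trans_le
        (pow_le_pow_left₀ hε'pos.le (min_le_left _ _) 2)) (hne hε'pos hζ.ge)
      diff := fun ζ _ => (hVd.differentiable one_ne_zero).differentiableAt
      inner_lt := by
        have h1 : ε' ^ 2 ≤ (δ / 4) ^ 2 := pow_le_pow_left₀ hε'pos.le hε'δ 2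
        have h2 := (hdV (ε', 0) (by simp only; nlinarith)).1.2
        simp only at h2
        nlinarith
      lt_outer := fun ζ hζ => by
        have := (hdV ζ hζ.le).1.1
        rw [hζ] at this
        nlinarith
      outer := fun ζ hζ hVζ => by
        refine hlc ζ ⟨?_, hζ.2⟩
        have := (hdV ζ hζ.2).1.2
        rw [hVζ] at this
        nlinarith }
  obtain ⟨γ, h1, h2⟩ := htrap.exists_limitCycle
  exact ⟨γ, h1, fun ζ hζ => hdU ζ (h2 hζ).2⟩

/-! ### Equilibria of the system -/

section Equilibrium

variable {N : ℕ} {p M X : ℝ}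

theorem coefK_eq (hp : 1 < p) : coefK N p = coefL N p + 2 / (p - 1) := by
  have : p - 1 ≠ 0 := by linarith
  unfold coefK coefL
  field_simp
  ring

theorem coefL_add (hp : 1 < p) : coefL N p + 2 * (2 / (p - 1)) = (N : ℝ) - 2 := by
  have : p - 1 ≠ 0 := by linarith
  unfold coefL
  field_simp
  ring

theorem slope_pos (hp : 1 < p) : 0 < 2 / (p - 1) := div_pos two_pos (by linarith)

theorem exponent_sub_one (hp : 1 < p) : 2 * p / (p + 1) - 1 = (p - 1) / (p + 1) := by
  have : p + 1 ≠ 0 := by linarith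
  field_simp
  ring

theorem exponent_pos (hp : 1 < p) : 0 < 2 * p / (p + 1) := by positivity

theorem rpow_exponent {y : ℝ} (hy : 0 < y) :
    y ^ (2 * p / (p + 1)) = y ^ (2 * p / (p + 1) - 1) * y := by
  rw [← Real.rpow_add_one hy.ne', sub_add_cancel]

theorem phaseField_of_pos {x y : ℝ} (hx : 0 < x) (hy : 0 < y) :
    phaseField N p M (x, y) = (2 / (p - 1) * x - y,
      -coefK N p * y + x ^ p + M * y ^ (2 * p / (p + 1))) := by
  simp only [phaseField, abs_of_pos hx, abs_of_pos hy]
  rw [← Real.rpow_add_one hx.ne', sub_add_cancel]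

theorem mem_equilibriumAbscissae_iff (hp : 1 < p) (hX : 0 < X) :
    X ∈ equilibriumAbscissae N p M ↔
      X ^ (p - 1) + M * (2 / (p - 1)) * (2 / (p - 1) * X) ^ (2 * p / (p + 1) - 1) =
        coefK N p * (2 / (p - 1)) := by
  have hY : 0 < 2 / (p - 1) * X := mul_pos (slope_pos hp) hX
  have h2 : X ^ p = X ^ (p - 1) * X := by rw [← Real.rpow_add_one hX.ne', sub_add_cancel]
  simp only [equilibriumAbscissae, Set.mem_ofPred_eq, hX, true_and, phaseField_of_pos hX hY,
    Prod.mk_eq_zero, sub_self, rpow_exponent hY, h2]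
  constructor
  · intro h
    refine mul_right_cancel₀ hX.ne' ?_
    linarith
  · intro h
    linear_combination X * h

/-- The abscissa of the equilibrium at the critical value of the parameter. -/
noncomputable def critX (N : ℕ) (p : ℝ) : ℝ := ((2 / (p - 1)) ^ 2 + coefL N p / p) ^ (1 / (p - 1))

theorem critX_base (hp : 1 < p) : (2 / (p - 1)) ^ 2 + coefL N p / p =
    (((N : ℝ) - 2) * (p - 1) ^ 2 + 4) / (p * (p - 1) ^ 2) := by
  have : p - 1 ≠ 0 := by linarith
  have : p ≠ 0 := by linarith
  unfold coefL
  field_simp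
  ring

theorem critX_base_pos (hN : 3 ≤ N) (hp : 1 < p) : 0 < (2 / (p - 1)) ^ 2 + coefL N p / p := by
  have hN' : (3 : ℝ) ≤ N := by exact_mod_cast hN
  rw [critX_base hp]
  have h1 : 0 < p - 1 := by linarith
  have h2 : 0 < (N : ℝ) - 2 := by linarith
  positivity

theorem critX_pos (hN : 3 ≤ N) (hp : 1 < p) : 0 < critX N p :=
  Real.rpow_pos_of_pos (critX_base_pos hN hp) _

theorem critX_rpow (hN : 3 ≤ N) (hp : 1 < p) :
    critX N p ^ (p - 1) = (2 / (p - 1)) ^ 2 + coefL N p / p := by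
  have h1 : p - 1 ≠ 0 := by linarith
  rw [critX, ← Real.rpow_mul (critX_base_pos hN hp).le, one_div_mul_cancel h1, Real.rpow_one]

/-- This says that the trace, -L + M q Y^(q-1), vanishes at the critical equilibrium. Taking
logarithms reduces the comparison of powers with the closed form of `Mbar` to a linear identity
between log 2, log p, log(p-1) and log X. -/
theorem Mbar_mul (hN : 3 ≤ N) (hp : 1 < p) :
    Mbar N p * (2 * p / (p + 1)) * (2 / (p - 1) * critX N p) ^ (2 * p / (p + 1) - 1) =
      coefL N p := by
  have hN' : (3 : ℝ) ≤ N := by exact_mod_cast hN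
  have h1 : 0 < p - 1 := by linarith
  have h2 : 0 < (N : ℝ) - 2 := by linarith
  have h3 : 0 < p := by linarith
  have hX := critX_pos hN hp
  have hlogX : (p - 1) * Real.log (critX N p) =
      Real.log (((N : ℝ) - 2) * (p - 1) ^ 2 + 4) - (Real.log p + 2 * Real.log (p - 1)) := by
    rw [← Real.log_rpow hX, critX_rpow hN hp, critX_base hp,
      Real.log_div (by positivity) (by positivity), Real.log_mul h3.ne' (by positivity),
      Real.log_pow]
    norm_num
  have key : (2 * p / (p + 1)) * (2 / (p - 1) * critX N p) ^ (2 * p / (p + 1) - 1) *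
      ((p + 1) * (p - 1)) =
      (4 * p) ^ (p / (p + 1)) * (((N : ℝ) - 2) * (p - 1) ^ 2 + 4) ^ (1 / (p + 1)) := by
    refine Real.log_injOn_pos (Set.mem_Ioi.2 (by positivity)) (Set.mem_Ioi.2 (by positivity)) ?_
    have h4 : Real.log 4 = 2 * Real.log 2 := by
      rw [show (4 : ℝ) = 2 ^ 2 by norm_num, Real.log_pow]; norm_num
    rw [Real.log_mul (by positivity) (by positivity), Real.log_mul (by positivity) (by positivity),
      Real.log_div (by positivity) (by positivity), Real.log_mul (by positivity) (by positivity),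
      Real.log_rpow (by positivity), Real.log_mul (by positivity) hX.ne',
      Real.log_div (by positivity) h1.ne', Real.log_mul (by positivity) h1.ne',
      Real.log_mul (by positivity) (by positivity), Real.log_rpow (by positivity),
      Real.log_rpow (by positivity), Real.log_mul (by positivity) h3.ne', h4,
      exponent_sub_one hp]
    have h5 : Real.log (((N : ℝ) - 2) * (p - 1) ^ 2 + 4) =
        (p - 1) * Real.log (critX N p) + (Real.log p + 2 * Real.log (p - 1)) := by linarith
    rw [h5]
    have : p + 1 ≠ 0 := by linarith
    field_simp
    ring
  unfold Mbar
  rw [← key]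
  unfold coefL
  have : p + 1 ≠ 0 := by linarith
  have : ((2 / (p - 1) * critX N p) ^ (2 * p / (p + 1) - 1)) ≠ 0 :=
    (Real.rpow_pos_of_pos (mul_pos (slope_pos hp) hX) _).ne'
  field_simp
  ring

theorem Mbar_mul' (hN : 3 ≤ N) (hp : 1 < p) :
    Mbar N p * (2 / (p - 1) * critX N p) ^ (2 * p / (p + 1) - 1) =
      coefL N p * (p + 1) / (2 * p) := by
  have h := Mbar_mul hN hp
  have : p + 1 ≠ 0 := by linarith
  have : p ≠ 0 := by linarith
  rw [← h]
  field_simp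

theorem critX_mem (hN : 3 ≤ N) (hp : 1 < p) :
    critX N p ∈ equilibriumAbscissae N p (Mbar N p) := by
  rw [mem_equilibriumAbscissae_iff hp (critX_pos hN hp), critX_rpow hN hp, mul_right_comm,
    Mbar_mul' hN hp, coefK_eq hp]
  have : p - 1 ≠ 0 := by linarith
  have : p ≠ 0 := by linarith
  field_simp
  ring

/-- In the variable σ = (X/`critX`)^(q-1) the left side of the equilibrium equation is A σ^(p+1) + B
σ with A > 0, hence convex. Its derivative at σ = 1 is positive, so it exceeds its critical value
for all σ > 1. This covers M < 0, where a smaller equilibrium may exist. -/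
theorem isGreatest_critX (hN : 3 ≤ N) (hp : 1 < p) :
    IsGreatest (equilibriumAbscissae N p (Mbar N p)) (critX N p) := by
  refine ⟨critX_mem hN hp, fun X hX => ?_⟩
  by_contra hcon
  push Not at hcon
  have hX0 : 0 < X := hX.1
  have hc := critX_pos hN hp
  have ha := slope_pos hp
  have h1 := (mem_equilibriumAbscissae_iff hp hX0).1 hX
  have h2 := (mem_equilibriumAbscissae_iff hp hc).1 (critX_mem hN hp)
  obtain ⟨r, hr⟩ : ∃ r, r = X / critX N p := ⟨_, rfl⟩
  have hr1 : 1 < r := by rw [hr, one_lt_div hc]; exact hcon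
  have hXr : X = critX N p * r := by rw [hr]; field_simp
  have hr0 : 0 < r := one_pos.trans hr1
  have hq : 0 < 2 * p / (p + 1) - 1 := by
    rw [exponent_sub_one hp]; exact div_pos (by linarith) (by linarith)
  have hσ : 1 < r ^ (2 * p / (p + 1) - 1) := Real.one_lt_rpow hr1 hq
  have hσp : r ^ (p - 1) = (r ^ (2 * p / (p + 1) - 1)) ^ (p + 1) := by
    rw [← Real.rpow_mul hr0.le, exponent_sub_one hp, div_mul_cancel₀]
    linarith
  have hB := one_add_mul_self_le_rpow_one_add (s := r ^ (2 * p / (p + 1) - 1) - 1)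
    (by linarith) (p := p + 1) (by linarith)
  rw [add_sub_cancel, ← hσp] at hB
  rw [hXr, Real.mul_rpow hc.le hr0.le, ← mul_assoc, Real.mul_rpow (mul_pos ha hc).le hr0.le] at h1
  set σ := r ^ (2 * p / (p + 1) - 1)
  set Q := (2 / (p - 1) * critX N p) ^ (2 * p / (p + 1) - 1) with hQ
  have hMQ : Mbar N p * Q = coefL N p * (p + 1) / (2 * p) := Mbar_mul' hN hp
  have hbase := critX_rpow hN hp
  have hbpos := critX_base_pos hN hp
  -- The derivative at σ = 1; it is a positive multiple of N-2, the determinant of the linear part.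
  have hdet : 0 < (p + 1) * critX N p ^ (p - 1) + Mbar N p * (2 / (p - 1)) * Q := by
    have hN' : (3 : ℝ) ≤ N := by exact_mod_cast hN
    have : (p + 1) * critX N p ^ (p - 1) + Mbar N p * (2 / (p - 1)) * Q =
        (p + 1) / 2 * (2 / (p - 1)) * ((N : ℝ) - 2) := by
      rw [mul_right_comm, hMQ, hbase, ← coefL_add hp]
      have : p - 1 ≠ 0 := by linarith
      have : p ≠ 0 := by linarith
      field_simp
      ring
    rw [this]
    have : 0 < (N : ℝ) - 2 := by linarith
    positivity
  have h3 : critX N p ^ (p - 1) * (1 + (p + 1) * (σ - 1)) ≤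
      critX N p ^ (p - 1) * r ^ (p - 1) :=
    mul_le_mul_of_nonneg_left hB (Real.rpow_nonneg hc.le _)
  have h4 := mul_pos hdet (sub_pos.2 hσ)
  nlinarith

theorem pointP_eq_of_isGreatest (h : IsGreatest (equilibriumAbscissae N p M) X) :
    pointP N p M = (X, 2 / (p - 1) * X) := by
  simp only [pointP, h.csSup_eq]

theorem pointP_Mbar (hN : 3 ≤ N) (hp : 1 < p) :
    pointP N p (Mbar N p) = (critX N p, 2 / (p - 1) * critX N p) :=
  pointP_eq_of_isGreatest (isGreatest_critX hN hp)

/-! ### Smoothness and linearization in the open first quadrant -/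

theorem contDiffAt_phaseField {n : ℕ} {x y : ℝ} (hx : 0 < x) (hy : 0 < y) :
    ContDiffAt ℝ n (fun l : ℝ × (ℝ × ℝ) => phaseField N p l.1 l.2) (M, (x, y)) := by
  have e1 : ContDiffAt ℝ n (fun l : ℝ × (ℝ × ℝ) => l.2.1) (M, (x, y)) := by fun_prop
  have e2 : ContDiffAt ℝ n (fun l : ℝ × (ℝ × ℝ) => l.2.2) (M, (x, y)) := by fun_prop
  have e3 : ContDiffAt ℝ n (fun l : ℝ × (ℝ × ℝ) => l.1) (M, (x, y)) := by fun_prop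
  exact ((contDiffAt_const.mul e1).sub e2).prodMk (((contDiffAt_const.mul e2).add
    (((e1.abs hx.ne').rpow_const_of_ne (abs_pos.2 hx.ne').ne').mul e1)).add
    (e3.mul ((e2.abs hy.ne').rpow_const_of_ne (abs_pos.2 hy.ne').ne')))

theorem hasFDerivAt_phaseField {x y : ℝ} (hx : 0 < x) (hy : 0 < y) :
    ∃ J : (ℝ × ℝ) →L[ℝ] (ℝ × ℝ), HasFDerivAt (phaseField N p M) J (x, y) ∧
      ∀ w, J w = (2 / (p - 1) * w.1 - w.2, p * x ^ (p - 1) * w.1 +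
        (-coefK N p + M * (2 * p / (p + 1)) * y ^ (2 * p / (p + 1) - 1)) * w.2) := by
  have hu : HasFDerivAt (fun ζ : ℝ × ℝ => ζ.1) (ContinuousLinearMap.fst ℝ ℝ ℝ) (x, y) :=
    hasFDerivAt_fst
  have hv : HasFDerivAt (fun ζ : ℝ × ℝ => ζ.2) (ContinuousLinearMap.snd ℝ ℝ ℝ) (x, y) :=
    hasFDerivAt_snd
  have h1 := (hu.const_mul (2 / (p - 1))).sub hv
  have h2 := ((hv.const_mul (-coefK N p)).add (hu.rpow_const (p := p) (Or.inl hx.ne'))).add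
    ((hv.rpow_const (p := 2 * p / (p + 1)) (Or.inl hy.ne')).const_mul M)
  have h3 := (h1.prodMk h2).congr_of_eventuallyEq (f₁ := phaseField N p M) (by
    filter_upwards [(continuous_fst.tendsto (x, y)).eventually (lt_mem_nhds hx),
      (continuous_snd.tendsto (x, y)).eventually (lt_mem_nhds hy)] with z hz1 hz2
    exact phaseField_of_pos hz1 hz2)
  refine ⟨_, h3, fun w => ?_⟩
  ext
  · simp
  · simp
    ring

end Equilibrium

/-! ### Taylor expansion of powers -/

theorem isBigO_pow_succ_of_deriv {g g' : ℝ → ℝ} {n : ℕ} (hg0 : g 0 = 0)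
    (hd : ∀ᶠ u in 𝓝 (0 : ℝ), HasDerivAt g (g' u) u) (hg' : g' =O[𝓝 0] fun u => u ^ n) :
    g =O[𝓝 0] fun u => u ^ (n + 1) := by
  obtain ⟨C, hCpos, hC'⟩ := hg'.exists_pos
  have hC := hC'.bound
  obtain ⟨δ, hδ, hball⟩ := Metric.eventually_nhds_iff_ball.1 (hd.and hC)
  refine IsBigO.of_bound C ?_
  filter_upwards [Metric.ball_mem_nhds (0 : ℝ) hδ] with u hu
  have hsub : Metric.closedBall (0 : ℝ) |u| ⊆ Metric.ball 0 δ := by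
    refine Metric.closedBall_subset_ball ?_
    simpa using hu
  have hC0 : ∀ s, |s| ≤ |u| → ‖g' s‖ ≤ C * |u| ^ n := fun s hs => by
    have h1 := (hball s (hsub (by simpa using hs))).2
    rw [norm_pow, Real.norm_eq_abs] at h1
    refine h1.trans ?_
    rw [Real.norm_eq_abs]
    gcongr
  have h := (convex_closedBall (0 : ℝ) |u|).norm_image_sub_le_of_norm_hasDerivWithin_le
    (f := g) (f' := g') (C := C * |u| ^ n) (x := 0) (y := u)
    (fun s hs => (hball s (hsub hs)).1.hasDerivWithinAt)
    (fun s hs => hC0 s (by simpa using hs)) (by simp) (by simp)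
  rw [hg0, sub_zero, sub_zero] at h
  rw [norm_pow, pow_succ, ← mul_assoc]
  exact h

/-- The Taylor remainder of (X+u)^r has as its derivative r times the remainder of one order less
for the exponent r-1, so the order is raised step by step by the mean value inequality. -/
theorem rpow_taylor_three {X : ℝ} (hX : 0 < X) (r : ℝ) :
    (fun u => (X + u) ^ r - (X ^ r + r * X ^ (r - 1) * u + r * (r - 1) * X ^ (r - 2) / 2 * u ^ 2 +
      r * (r - 1) * (r - 2) * X ^ (r - 3) / 6 * u ^ 3)) =O[𝓝 0] fun u : ℝ => u ^ 4 := by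
  have hpos : ∀ᶠ u in 𝓝 (0 : ℝ), 0 < X + u :=
    (continuous_const.add continuous_id).continuousAt.eventually
      (lt_mem_nhds (by simpa using hX))
  have hd : ∀ s : ℝ, ∀ᶠ u in 𝓝 (0 : ℝ),
      HasDerivAt (fun u => (X + u) ^ s) (s * (X + u) ^ (s - 1)) u := fun s => by
    filter_upwards [hpos] with u hu
    simpa using ((hasDerivAt_id u).const_add X).rpow_const (p := s) (Or.inl hu.ne')
  have h0 : ∀ s : ℝ, (fun u => (X + u) ^ s - X ^ s) =O[𝓝 0] fun u : ℝ => u ^ 1 := fun s => by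
    have := (hd s).self_of_nhds.isBigO_sub
    simpa using this
  have h1 : ∀ s : ℝ, (fun u => (X + u) ^ s - (X ^ s + s * X ^ (s - 1) * u))
      =O[𝓝 0] fun u : ℝ => u ^ 2 := fun s => by
    refine isBigO_pow_succ_of_deriv (g' := fun u => s * ((X + u) ^ (s - 1) - X ^ (s - 1)))
      (by simp) ?_ ((h0 (s - 1)).const_mul_left s)
    filter_upwards [hd s] with u hu
    convert! hu.sub (((hasDerivAt_id u).const_mul (s * X ^ (s - 1))).const_add (X ^ s)) using 1
    ring
  have h2 : ∀ s : ℝ, (fun u => (X + u) ^ s - (X ^ s + s * X ^ (s - 1) * u +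
      s * (s - 1) * X ^ (s - 2) / 2 * u ^ 2)) =O[𝓝 0] fun u : ℝ => u ^ 3 := fun s => by
    refine isBigO_pow_succ_of_deriv (g' := fun u => s * ((X + u) ^ (s - 1) -
      (X ^ (s - 1) + (s - 1) * X ^ (s - 1 - 1) * u))) (by simp) ?_ ((h1 (s - 1)).const_mul_left s)
    filter_upwards [hd s] with u hu
    convert! hu.sub ((((hasDerivAt_id u).const_mul (s * X ^ (s - 1))).const_add (X ^ s)).add
      (((hasDerivAt_id u).pow 2).const_mul (s * (s - 1) * X ^ (s - 2) / 2))) using 1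
    simp only [id]
    norm_num [sub_sub]
    ring
  refine isBigO_pow_succ_of_deriv (g' := fun u => r * ((X + u) ^ (r - 1) -
      (X ^ (r - 1) + (r - 1) * X ^ (r - 1 - 1) * u +
      (r - 1) * (r - 1 - 1) * X ^ (r - 1 - 2) / 2 * u ^ 2))) (by simp) ?_
      ((h2 (r - 1)).const_mul_left r)
  filter_upwards [hd r] with u hu
  convert! hu.sub (((((hasDerivAt_id u).const_mul (r * X ^ (r - 1))).const_add (X ^ r)).add
    (((hasDerivAt_id u).pow 2).const_mul (r * (r - 1) * X ^ (r - 2) / 2))).add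
    (((hasDerivAt_id u).pow 3).const_mul (r * (r - 1) * (r - 2) * X ^ (r - 3) / 6))) using 1
  simp only [id]
  norm_num [sub_sub]
  ring

/-! ### Partial derivatives of ridge functions -/

theorem iteratedDeriv_comp_affine (Φ : ℝ → ℝ) (c b : ℝ) (n : ℕ) :
    iteratedDeriv n (fun v => Φ (c + b * v)) = fun v => b ^ n * iteratedDeriv n Φ (c + b * v) := by
  induction n with
  | zero => simp
  | succ n ih =>
    rw [iteratedDeriv_succ, ih]
    funext v
    rw [deriv_const_mul_field, iteratedDeriv_succ,
      deriv_comp_mul_left b (fun x => iteratedDeriv n Φ (c + x)) v, deriv_comp_const_add,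
      smul_eq_mul]
    ring

/-- All the derivatives of `Φ` are smooth at `c`. -/
def SmoothDerivsAt (Φ : ℝ → ℝ) (c : ℝ) : Prop :=
  ∀ j n : ℕ, ContDiffAt ℝ n (iteratedDeriv j Φ) c

theorem smoothDerivsAt_id (c : ℝ) : SmoothDerivsAt (fun x => x) c := by
  intro j n
  have : iteratedDeriv j (fun x : ℝ => x) = fun x => if j = 0 then x else if j = 1 then 1 else 0 :=
    funext fun x => iteratedDeriv_fun_id
  rw [this]
  split_ifs
  · exact contDiffAt_id
  · exact contDiffAt_const
  · exact contDiffAt_const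

theorem iteratedDeriv_const_mul_rpow (d r : ℝ) (n : ℕ) :
    iteratedDeriv n (fun x : ℝ => d * x ^ r) =
      fun x => d * ((descPochhammer ℝ n).eval r * x ^ (r - n)) := by
  funext x
  rw [iteratedDeriv_const_mul_field, iteratedDeriv_eq_iterate, Real.iter_deriv_rpow_const]

theorem smoothDerivsAt_const_mul_rpow (d r : ℝ) {c : ℝ} (hc : 0 < c) :
    SmoothDerivsAt (fun x => d * x ^ r) c := by
  intro j n
  rw [iteratedDeriv_const_mul_rpow]
  exact contDiffAt_const.mul (contDiffAt_const.mul (Real.contDiffAt_rpow_const_of_ne hc.ne'))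

theorem partialAtZero_congr {φ ψ : ℝ × ℝ → ℝ} (h : φ =ᶠ[𝓝 0] ψ) (i j : ℕ) :
    partialAtZero i j φ = partialAtZero i j ψ := by
  refine EventuallyEq.iteratedDeriv_eq i ?_
  have h' : ∀ᶠ x : ℝ × ℝ in 𝓝 0 ×ˢ 𝓝 0, φ x = ψ x := by rwa [← nhds_prod_eq]
  filter_upwards [h'.curry] with u hu
  exact EventuallyEq.iteratedDeriv_eq j hu

theorem iteratedDeriv_ridge_sum {Φ₁ Φ₂ Φ₃ : ℝ → ℝ} {c₁ c₂ c₃ : ℝ} (b₁ b₂ b₃ d₁ d₂ d₃ : ℝ) (n : ℕ)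
    (h₁ : ContDiffAt ℝ n Φ₁ c₁) (h₂ : ContDiffAt ℝ n Φ₂ c₂) (h₃ : ContDiffAt ℝ n Φ₃ c₃) :
    iteratedDeriv n (fun v => d₁ * Φ₁ (c₁ + b₁ * v) + d₂ * Φ₂ (c₂ + b₂ * v) +
      d₃ * Φ₃ (c₃ + b₃ * v)) 0 = d₁ * (b₁ ^ n * iteratedDeriv n Φ₁ c₁) +
      d₂ * (b₂ ^ n * iteratedDeriv n Φ₂ c₂) + d₃ * (b₃ ^ n * iteratedDeriv n Φ₃ c₃) := by
  have hs : ∀ {Φ : ℝ → ℝ} {c : ℝ} (b d : ℝ), ContDiffAt ℝ n Φ c →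
      ContDiffAt ℝ n (fun v => d * Φ (c + b * v)) 0 := fun {Φ c} b d h => by
    refine contDiffAt_const.mul (ContDiffAt.comp (g := Φ) 0 (by simpa using h) ?_)
    fun_prop
  rw [iteratedDeriv_fun_add ((hs b₁ d₁ h₁).add (hs b₂ d₂ h₂)) (hs b₃ d₃ h₃),
    iteratedDeriv_fun_add (hs b₁ d₁ h₁) (hs b₂ d₂ h₂)]
  simp only [iteratedDeriv_const_mul_field, iteratedDeriv_comp_affine, mul_zero, add_zero]

/-- Each term depends on one affine form, so a mixed derivative is an ordinary derivative times
powers of the coefficients. The inner identity is needed near u = 0, not only at it, because the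
outer derivative acts on it. -/
theorem partialAtZero_ridge_sum {Φ₁ Φ₂ Φ₃ : ℝ → ℝ} {c₁ c₂ c₃ : ℝ} (a₁ a₂ a₃ b₁ b₂ b₃ : ℝ)
    (i j : ℕ) (h₁ : SmoothDerivsAt Φ₁ c₁) (h₂ : SmoothDerivsAt Φ₂ c₂)
    (h₃ : SmoothDerivsAt Φ₃ c₃) :
    partialAtZero i j (fun ζ => Φ₁ (c₁ + a₁ * ζ.1 + b₁ * ζ.2) + Φ₂ (c₂ + a₂ * ζ.1 + b₂ * ζ.2) +
      Φ₃ (c₃ + a₃ * ζ.1 + b₃ * ζ.2)) = a₁ ^ i * b₁ ^ j * iteratedDeriv (i + j) Φ₁ c₁ +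
      a₂ ^ i * b₂ ^ j * iteratedDeriv (i + j) Φ₂ c₂ +
      a₃ ^ i * b₃ ^ j * iteratedDeriv (i + j) Φ₃ c₃ := by
  have hev : ∀ {Φ : ℝ → ℝ} {c : ℝ} (a : ℝ), SmoothDerivsAt Φ c →
      ∀ᶠ u in 𝓝 (0 : ℝ), ContDiffAt ℝ j Φ (c + a * u) := fun {Φ c} a h => by
    have hc : ContinuousAt (fun u : ℝ => c + a * u) 0 := by fun_prop
    refine hc.eventually ?_
    have := h 0 j
    rw [iteratedDeriv_zero] at this
    simpa using this.eventually (by simp)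
  have hin : (fun u => iteratedDeriv j (fun v => Φ₁ (c₁ + a₁ * u + b₁ * v) +
      Φ₂ (c₂ + a₂ * u + b₂ * v) + Φ₃ (c₃ + a₃ * u + b₃ * v)) 0) =ᶠ[𝓝 0]
      fun u => b₁ ^ j * iteratedDeriv j Φ₁ (c₁ + a₁ * u) +
        b₂ ^ j * iteratedDeriv j Φ₂ (c₂ + a₂ * u) + b₃ ^ j * iteratedDeriv j Φ₃ (c₃ + a₃ * u) := by
    filter_upwards [hev a₁ h₁, hev a₂ h₂, hev a₃ h₃] with u e₁ e₂ e₃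
    simpa using iteratedDeriv_ridge_sum b₁ b₂ b₃ 1 1 1 j e₁ e₂ e₃
  have hit : ∀ Φ : ℝ → ℝ, iteratedDeriv i (iteratedDeriv j Φ) = iteratedDeriv (i + j) Φ :=
    fun Φ => by
      rw [iteratedDeriv_eq_iterate, iteratedDeriv_eq_iterate, iteratedDeriv_eq_iterate,
        Function.iterate_add_apply]
  rw [partialAtZero, EventuallyEq.iteratedDeriv_eq i hin,
    iteratedDeriv_ridge_sum a₁ a₂ a₃ _ _ _ i (h₁ j i) (h₂ j i) (h₃ j i)]
  simp only [hit]
  ring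

/-! ### The first Lyapunov coefficient at the critical value -/

section Focus

variable {N : ℕ} {p : ℝ}

/-- The ordinate of the equilibrium at the critical value of the parameter. -/
noncomputable def critY (N : ℕ) (p : ℝ) : ℝ := 2 / (p - 1) * critX N p

/-- The second derivative of `x ^ p` at the critical equilibrium. -/
noncomputable def critPhi₂ (N : ℕ) (p : ℝ) : ℝ := p * (p - 1) * critX N p ^ (p - 2)

/-- The second derivative of `M y ^ (2 p / (p + 1))` at the critical equilibrium. -/
noncomputable def critPsi₂ (N : ℕ) (p : ℝ) : ℝ :=
  Mbar N p * (2 * p / (p + 1) * (2 * p / (p + 1) - 1)) * critY N p ^ (2 * p / (p + 1) - 2)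

/-- The third derivative of `M y ^ (2 p / (p + 1))` at the critical equilibrium. -/
noncomputable def critPsi₃ (N : ℕ) (p : ℝ) : ℝ :=
  Mbar N p * (2 * p / (p + 1) * (2 * p / (p + 1) - 1) * (2 * p / (p + 1) - 2)) *
    critY N p ^ (2 * p / (p + 1) - 3)

/-- A positive multiple of the first Lyapunov coefficient. -/
noncomputable def focalValue (N : ℕ) (p : ℝ) : ℝ :=
  critPsi₃ N p * ((2 / (p - 1)) ^ 2 + ((N : ℝ) - 2)) -
    critPsi₂ N p * (2 / (p - 1)) / ((N : ℝ) - 2) *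
      (critPhi₂ N p + critPsi₂ N p * ((2 / (p - 1)) ^ 2 + ((N : ℝ) - 2)))

theorem critY_pos (hN : 3 ≤ N) (hp : 1 < p) : 0 < critY N p :=
  mul_pos (slope_pos hp) (critX_pos hN hp)

theorem rpow_sub_nat_mul {y : ℝ} (hy : 0 < y) (r : ℝ) (n : ℕ) : y ^ (r - n) = y ^ r / y ^ n := by
  rw [Real.rpow_sub hy, Real.rpow_natCast]

theorem critPhi₂_eq (hN : 3 ≤ N) (hp : 1 < p) : critPhi₂ N p =
    p * (p - 1) * ((2 / (p - 1)) ^ 2 + coefL N p / p) * (2 / (p - 1)) / critY N p := by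
  have hX := critX_pos hN hp
  have ha := slope_pos hp
  have h := rpow_sub_nat_mul hX (p - 1) 1
  rw [critX_rpow hN hp, Nat.cast_one, sub_sub, one_add_one_eq_two, pow_one] at h
  rw [critPhi₂, h, critY]
  field_simp

theorem critPsi₂_eq (hN : 3 ≤ N) (hp : 1 < p) : critPsi₂ N p =
    coefL N p * ((p - 1) / (p + 1)) / critY N p := by
  have hY := critY_pos hN hp
  have h := rpow_sub_nat_mul hY (2 * p / (p + 1) - 1) 1
  rw [Nat.cast_one, sub_sub, one_add_one_eq_two, pow_one] at h
  rw [critPsi₂, h, ← Mbar_mul hN hp, ← critY, ← exponent_sub_one hp]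
  ring

theorem critPsi₃_eq (hN : 3 ≤ N) (hp : 1 < p) : critPsi₃ N p =
    coefL N p * ((p - 1) / (p + 1)) * (-2 / (p + 1)) / critY N p ^ 2 := by
  have hY := critY_pos hN hp
  have h := rpow_sub_nat_mul hY (2 * p / (p + 1) - 1) 2
  rw [Nat.cast_two, sub_sub, show (1 : ℝ) + 2 = 3 by norm_num] at h
  have h2 : 2 * p / (p + 1) - 2 = -2 / (p + 1) := by
    have : p + 1 ≠ 0 := by linarith
    field_simp
    ring
  rw [critPsi₃, h, ← Mbar_mul hN hp, ← critY, ← exponent_sub_one hp, h2]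
  ring

/-- With a(p-1) = 2 and L = (N-2) - 2a, all derivatives at the critical point are explicit over
powers of Y; the factor L splits off ψ₂ and ψ₃, and the remaining bracket simplifies to
-4(N-1)/((p+1)(N-2)). -/
theorem focalValue_eq (hN : 3 ≤ N) (hp : 1 < p) :
    ∃ κ > 0, focalValue N p = -coefL N p * κ := by
  have hN' : (3 : ℝ) ≤ N := by exact_mod_cast hN
  have hY := critY_pos hN hp
  have h1 : 0 < p - 1 := by linarith
  have h2 : 0 < (N : ℝ) - 2 := by linarith
  have hL : coefL N p = ((N : ℝ) - 2) - 2 * (2 / (p - 1)) := by linarith [coefL_add (N := N) hp]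
  refine ⟨(p - 1) / (p + 1) / critY N p ^ 2 * ((2 / (p - 1)) ^ 2 + ((N : ℝ) - 2)) *
    (4 * (1 + ((N : ℝ) - 2)) / ((p + 1) * ((N : ℝ) - 2))), by positivity, ?_⟩
  rw [focalValue, critPhi₂_eq hN hp, critPsi₂_eq hN hp, critPsi₃_eq hN hp, hL]
  generalize (N : ℝ) - 2 = W at *
  have : p + 1 ≠ 0 := by linarith
  have : p ≠ 0 := by linarith
  have := h1.ne'
  have := h2.ne'
  have := hY.ne'
  field_simp
  ring

/-- The linear part at the critical equilibrium. -/
theorem hasFDerivAt_critical (hN : 3 ≤ N) (hp : 1 < p) :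
    ∃ J : (ℝ × ℝ) →L[ℝ] (ℝ × ℝ),
      HasFDerivAt (phaseField N p (Mbar N p)) J (critX N p, critY N p) ∧
      ∀ w, J w = (2 / (p - 1) * w.1 - w.2,
        ((2 / (p - 1)) ^ 2 + ((N : ℝ) - 2)) * w.1 - 2 / (p - 1) * w.2) := by
  obtain ⟨J, hJ, hJw⟩ := hasFDerivAt_phaseField (N := N) (p := p) (M := Mbar N p)
    (critX_pos hN hp) (critY_pos hN hp)
  refine ⟨J, hJ, fun w => ?_⟩
  rw [hJw, critX_rpow hN hp, critY, Mbar_mul hN hp, coefK_eq hp, ← coefL_add hp]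
  have : p - 1 ≠ 0 := by linarith
  have : p ≠ 0 := by linarith
  ext
  · rfl
  · simp only
    field_simp
    ring

theorem phaseField_critical (hN : 3 ≤ N) (hp : 1 < p) :
    phaseField N p (Mbar N p) (critX N p, critY N p) = 0 :=
  (critX_mem hN hp).2

/-- The components of `A F (P + A⁻¹ ζ)` are sums of ridge functions; their partial derivatives. -/
theorem partialAtZero_phaseField (hN : 3 ≤ N) (hp : 1 < p) {B : ℝ × ℝ → ℝ × ℝ}
    {b₁₁ b₁₂ b₂₁ b₂₂ : ℝ} (hB : ∀ ζ, B ζ = (b₁₁ * ζ.1 + b₁₂ * ζ.2, b₂₁ * ζ.1 + b₂₂ * ζ.2))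
    (k m : ℝ) {i j : ℕ} (hij : 2 ≤ i + j) :
    partialAtZero i j (fun ζ =>
      k * (phaseField N p (Mbar N p) ((critX N p, critY N p) + B ζ)).1 +
      m * (phaseField N p (Mbar N p) ((critX N p, critY N p) + B ζ)).2) =
    m * (b₁₁ ^ i * b₁₂ ^ j *
        ((descPochhammer ℝ (i + j)).eval p * critX N p ^ (p - (i + j : ℕ))) +
      b₂₁ ^ i * b₂₂ ^ j * (Mbar N p * ((descPochhammer ℝ (i + j)).eval (2 * p / (p + 1)) *
        critY N p ^ (2 * p / (p + 1) - (i + j : ℕ))))) := by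
  have hX := critX_pos hN hp
  have hY := critY_pos hN hp
  set a := 2 / (p - 1) with ha
  set K := coefK N p
  have hev : (fun ζ =>
      k * (phaseField N p (Mbar N p) ((critX N p, critY N p) + B ζ)).1 +
      m * (phaseField N p (Mbar N p) ((critX N p, critY N p) + B ζ)).2) =ᶠ[𝓝 0]
      fun ζ : ℝ × ℝ => (fun x => x) ((k * (a * critX N p - critY N p) - m * K * critY N p) +
          (k * (a * b₁₁ - b₂₁) - m * K * b₂₁) * ζ.1 + (k * (a * b₁₂ - b₂₂) - m * K * b₂₂) * ζ.2) +
        (fun x => m * x ^ p) (critX N p + b₁₁ * ζ.1 + b₁₂ * ζ.2) +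
        (fun x => m * Mbar N p * x ^ (2 * p / (p + 1)))
          (critY N p + b₂₁ * ζ.1 + b₂₂ * ζ.2) := by
    have h1 : ContinuousAt (fun ζ : ℝ × ℝ => critX N p + b₁₁ * ζ.1 + b₁₂ * ζ.2) 0 := by fun_prop
    have h2 : ContinuousAt (fun ζ : ℝ × ℝ => critY N p + b₂₁ * ζ.1 + b₂₂ * ζ.2) 0 := by fun_prop
    filter_upwards [h1.eventually (lt_mem_nhds (by simpa using hX)),
      h2.eventually (lt_mem_nhds (by simpa using hY))] with ζ e1 e2
    rw [hB, Prod.mk_add_mk, ← add_assoc, ← add_assoc, phaseField_of_pos e1 e2]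
    ring
  have hid : iteratedDeriv (i + j) (fun x : ℝ => x) = fun _ => 0 := funext fun x => by
    rw [iteratedDeriv_fun_id, if_neg (by omega), if_neg (by omega)]
  rw [partialAtZero_congr hev, partialAtZero_ridge_sum _ _ _ _ _ _ i j (smoothDerivsAt_id _)
    (smoothDerivsAt_const_mul_rpow m p hX) (smoothDerivsAt_const_mul_rpow (m * Mbar N p) _ hY),
    hid, iteratedDeriv_const_mul_rpow, iteratedDeriv_const_mul_rpow]
  ring

/-- Admissible charts differ only by maps commuting with the linear part, so each is determined by ω
and the image (m, n) of (0, 1). The coefficient then depends on the chart only through the positive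
factor 1/(16 ω² (m²+n²)). -/
theorem lyapunovCoeff_eq (hN : 3 ≤ N) (hp : 1 < p) {A : (ℝ × ℝ) ≃L[ℝ] (ℝ × ℝ)} {ω : ℝ}
    (h : IsHopfChart (phaseField N p (Mbar N p)) (critX N p, critY N p) A ω) :
    ∃ κ > 0, lyapunovCoeff (chartField (phaseField N p (Mbar N p)) (critX N p, critY N p) A) ω =
      focalValue N p * κ := by
  have hN' : (3 : ℝ) ≤ N := by exact_mod_cast hN
  obtain ⟨hω, -, -, hA⟩ := h
  obtain ⟨J, hJ, hJw⟩ := hasFDerivAt_critical hN hp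
  rw [hJ.fderiv] at hA
  set a := 2 / (p - 1) with ha
  obtain ⟨k, k', hk⟩ : ∃ k k', A (1, 0) = (k, k') := ⟨_, _, rfl⟩
  obtain ⟨m, n, hmn⟩ : ∃ m n, A (0, 1) = (m, n) := ⟨_, _, rfl⟩
  have hAw : ∀ w : ℝ × ℝ, A w = (k * w.1 + m * w.2, k' * w.1 + n * w.2) := fun w => by
    have : w = w.1 • ((1, 0) : ℝ × ℝ) + w.2 • ((0, 1) : ℝ × ℝ) := by ext <;> simp
    conv_lhs => rw [this, map_add, map_smul, map_smul, hk, hmn]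
    ext <;> simp <;> ring
  have e1 := hA (1, 0)
  have e2 := hA (0, 1)
  simp only [hJw, hAw, Prod.mk.injEq] at e1 e2
  norm_num at e1 e2
  obtain ⟨e11, e12⟩ := e1
  obtain ⟨e21, e22⟩ := e2
  have hk1 : k = ω * n - a * m := by linarith
  have hk2 : k' = -ω * m - a * n := by linarith
  subst hk1 hk2
  have hs : 0 < m ^ 2 + n ^ 2 := by
    by_contra hcon
    have hm : m = 0 := by nlinarith [sq_nonneg m, sq_nonneg n]
    have hn : n = 0 := by nlinarith [sq_nonneg m, sq_nonneg n]
    have : ((0, 1) : ℝ × ℝ) = 0 := A.injective (by rw [hmn, hm, hn, map_zero]; rfl)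
    simp at this
  -- The frequency is not free: its square is the determinant of the linear part.
  have hω2 : ω ^ 2 = (N : ℝ) - 2 := by
    refine mul_right_cancel₀ hs.ne' ?_
    linear_combination -m * e11 - n * e12
  have hsymm : ∀ ζ, A.symm ζ = (n / (ω * (m ^ 2 + n ^ 2)) * ζ.1 + -m / (ω * (m ^ 2 + n ^ 2)) * ζ.2,
      (ω * m + a * n) / (ω * (m ^ 2 + n ^ 2)) * ζ.1 +
      (ω * n - a * m) / (ω * (m ^ 2 + n ^ 2)) * ζ.2) := fun ζ => by
    rw [ContinuousLinearEquiv.symm_apply_eq, hAw]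
    have := hω.ne'
    have := hs.ne'
    ext <;> simp only <;> field_simp <;> ring
  have hf : ∀ i j : ℕ, 2 ≤ i + j → partialAtZero i j (fun ζ =>
      (chartField (phaseField N p (Mbar N p)) (critX N p, critY N p) A ζ).1) = _ :=
    fun i j hij => by
      simp only [chartField, hAw]
      exact partialAtZero_phaseField hN hp hsymm (ω * n - a * m) m hij
  have hg : ∀ i j : ℕ, 2 ≤ i + j → partialAtZero i j (fun ζ =>
      (chartField (phaseField N p (Mbar N p)) (critX N p, critY N p) A ζ).2) = _ :=
    fun i j hij => by
      simp only [chartField, hAw]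
      exact partialAtZero_phaseField hN hp hsymm (-ω * m - a * n) n hij
  refine ⟨1 / (16 * ω ^ 2 * (m ^ 2 + n ^ 2)), by positivity, ?_⟩
  unfold lyapunovCoeff
  simp only
  rw [hf 3 0 (by norm_num), hf 1 2 (by norm_num), hf 1 1 (by norm_num), hf 2 0 (by norm_num),
    hf 0 2 (by norm_num), hg 2 1 (by norm_num), hg 0 3 (by norm_num), hg 1 1 (by norm_num),
    hg 2 0 (by norm_num), hg 0 2 (by norm_num)]
  rw [focalValue, ← hω2, ← ha]
  have hP2 : ∀ r : ℝ, (descPochhammer ℝ 2).eval r = r * (r - 1) := fun r => by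
    simp [descPochhammer_succ_right]
  have hP3 : ∀ r : ℝ, (descPochhammer ℝ 3).eval r = r * (r - 1) * (r - 2) := fun r => by
    simp [descPochhammer_succ_right]
  norm_num only [hP2, hP3, Nat.cast_ofNat]
  have hφ : p * (p - 1) * critX N p ^ (p - 2) = critPhi₂ N p := rfl
  have hψ : Mbar N p * (2 * p / (p + 1) * (2 * p / (p + 1) - 1) *
      critY N p ^ (2 * p / (p + 1) - 2)) = critPsi₂ N p := by rw [critPsi₂]; ring
  have hψ' : Mbar N p * (2 * p / (p + 1) * (2 * p / (p + 1) - 1) * (2 * p / (p + 1) - 2) *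
      critY N p ^ (2 * p / (p + 1) - 3)) = critPsi₃ N p := by rw [critPsi₃]; ring
  rw [hφ, hψ, hψ']
  generalize critPhi₂ N p = φ₂
  generalize critPsi₂ N p = ψ₂
  generalize critPsi₃ N p = ψ₃
  -- The third derivative of x^p drops out of the coefficient.
  generalize p * (p - 1) * (p - 2) * critX N p ^ (p - 3) = φ₃
  have := hω.ne'
  have := hs.ne'
  field_simp
  ring

theorem sign_focalValue (hN : 3 ≤ N) (hp : 1 < p) {κ : ℝ} (hκ : 0 < κ) :
    SignType.sign (focalValue N p * κ) = -SignType.sign (coefL N p) := by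
  obtain ⟨κ', hκ', h⟩ := focalValue_eq hN hp
  rw [h, sign_mul, sign_mul, sign_pos hκ, sign_pos hκ', mul_one, mul_one, Left.sign_neg]

/-! ### Shear charts -/

/-- The coordinates `(u, v)` with `x = u` and `y = m u + β v`. -/
noncomputable def shear (m β : ℝ) (hβ : β ≠ 0) : (ℝ × ℝ) ≃L[ℝ] (ℝ × ℝ) :=
  LinearEquiv.toContinuousLinearEquiv
    { toFun := fun w => (w.1, (w.2 - m * w.1) / β)
      invFun := fun ζ => (ζ.1, m * ζ.1 + β * ζ.2)
      map_add' := fun w z => by ext <;> simp; ring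
      map_smul' := fun c w => by ext <;> simp; ring
      left_inv := fun w => by ext <;> simp; field_simp; ring
      right_inv := fun w => by ext <;> simp; field_simp }

theorem shear_apply (m β : ℝ) (hβ : β ≠ 0) (w : ℝ × ℝ) :
    shear m β hβ w = (w.1, (w.2 - m * w.1) / β) := rfl

theorem shear_symm_apply (m β : ℝ) (hβ : β ≠ 0) (ζ : ℝ × ℝ) :
    (shear m β hβ).symm ζ = (ζ.1, m * ζ.1 + β * ζ.2) := rfl

theorem sqrt_frequency_pos (hN : 3 ≤ N) : 0 < √((N : ℝ) - 2) := by
  have hN' : (3 : ℝ) ≤ N := by exact_mod_cast hN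
  exact Real.sqrt_pos.2 (by linarith)

theorem isHopfChart_shear (hN : 3 ≤ N) (hp : 1 < p) :
    IsHopfChart (phaseField N p (Mbar N p)) (critX N p, critY N p)
      (shear (2 / (p - 1)) √((N : ℝ) - 2) (sqrt_frequency_pos hN).ne') √((N : ℝ) - 2) := by
  obtain ⟨J, hJ, hJw⟩ := hasFDerivAt_critical hN hp
  have hω := sqrt_frequency_pos hN
  have hω2 : √((N : ℝ) - 2) ^ 2 = (N : ℝ) - 2 := Real.sq_sqrt (Real.sqrt_pos.1 hω).le
  refine ⟨hω, phaseField_critical hN hp, hJ.differentiableAt, fun w => ?_⟩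
  rw [hJ.fderiv, shear_apply, shear_apply, hJw]
  generalize √((N : ℝ) - 2) = ω at *
  have : p - 1 ≠ 0 := by linarith
  rw [← hω2]
  ext <;> simp only <;> field_simp <;> ring

theorem lyapunovSignEq_critical (hN : 3 ≤ N) (hp : 1 < p) :
    LyapunovSignEq (phaseField N p (Mbar N p)) (pointP N p (Mbar N p))
      (-SignType.sign (coefL N p)) := by
  rw [pointP_Mbar hN hp]
  refine ⟨⟨_, _, isHopfChart_shear hN hp⟩, fun A ω hA => ?_⟩
  obtain ⟨κ, hκ, h⟩ := lyapunovCoeff_eq hN hp hA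
  exact (congrArg SignType.sign h).trans (sign_focalValue hN hp hκ)

/-! ### The critical equilibrium is a weak focus -/

/-- The equation for v = (y - Y - a u)/ω, with S and T the Taylor remainders of the two powers. The
equilibrium relation removes the constants, the zero trace removes the v term, and the determinant
makes the u term ω u. -/
theorem cubic_normal_form_snd {a ω X Y K M c₀ c₁ c₂ c₃ e₀ e₁ e₂ e₃ u v S T : ℝ} (hω : ω ≠ 0)
    (heq : -K * Y + c₀ + M * e₀ = 0) (hK : K = M * e₁ + a) (hD : c₁ = a ^ 2 + ω ^ 2)
    (hY : Y = a * X) :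
    (-K * (Y + (a * u + ω * v)) + (S + (c₀ + c₁ * u + c₂ / 2 * u ^ 2 + c₃ / 6 * u ^ 3)) +
      M * (T + (e₀ + e₁ * (a * u + ω * v) + e₂ / 2 * (a * u + ω * v) ^ 2 +
        e₃ / 6 * (a * u + ω * v) ^ 3)) -
      a * (a * (X + u) - (Y + (a * u + ω * v)))) / ω =
    ω * u +
      ((((c₂ + M * e₂ * a ^ 2) / (2 * ω)) * u ^ 2 +
        M * e₂ * a * (u * v) + M * e₂ * ω / 2 * v ^ 2) +
      ((c₃ + M * e₃ * a ^ 3) / (6 * ω) * u ^ 3 +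
        M * e₃ * a ^ 2 / 2 * (u ^ 2 * v) + M * e₃ * a * ω / 2 * (u * v ^ 2) +
        M * e₃ * ω ^ 2 / 6 * v ^ 3) + (S + M * T) / ω) := by
  subst hK hD hY
  field_simp
  linear_combination 12 * heq

/-- In the shear chart u' = -ωv holds exactly, so only v' carries nonlinear terms and
`exists_quartic_lyapunov` applies; its constant then evaluates to `focalValue` / 8. -/
theorem exists_critical_lyapunov (hN : 3 ≤ N) (hp : 1 < p) :
    ∃ V : ℝ × ℝ → ℝ, ContDiff ℝ 1 V ∧
      (fun ζ => V ζ - (ζ.1 ^ 2 + ζ.2 ^ 2)) =o[𝓝 0] (fun ζ => ζ.1 ^ 2 + ζ.2 ^ 2) ∧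
      (fun ζ => fderiv ℝ V ζ (chartField (phaseField N p (Mbar N p)) (critX N p, critY N p)
          (shear (2 / (p - 1)) √((N : ℝ) - 2) (sqrt_frequency_pos hN).ne') ζ) -
        focalValue N p / 8 * (ζ.1 ^ 2 + ζ.2 ^ 2) ^ 2)
        =o[𝓝 0] fun ζ => (ζ.1 ^ 2 + ζ.2 ^ 2) ^ 2 := by
  have hX := critX_pos hN hp
  have hY := critY_pos hN hp
  have hω := sqrt_frequency_pos hN
  have hω2 : √((N : ℝ) - 2) ^ 2 = (N : ℝ) - 2 := Real.sq_sqrt (Real.sqrt_pos.1 hω).le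
  have hYdef : critY N p = 2 / (p - 1) * critX N p := rfl
  have hp0 : p ≠ 0 := by linarith
  have hp1 : p - 1 ≠ 0 := by linarith
  have heq := congrArg Prod.snd (phaseField_critical hN hp)
  rw [phaseField_of_pos hX hY] at heq
  have hMb := Mbar_mul hN hp
  rw [← hYdef] at hMb
  have hXp := critX_rpow hN hp
  have hK := coefK_eq (N := N) hp
  have hLN := coefL_add (N := N) hp
  set G := chartField (phaseField N p (Mbar N p)) (critX N p, critY N p)
          (shear (2 / (p - 1)) √((N : ℝ) - 2) (sqrt_frequency_pos hN).ne') with hG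
  set ω := √((N : ℝ) - 2)
  set a := 2 / (p - 1) with ha
  set φ₃ := p * (p - 1) * (p - 2) * critX N p ^ (p - 3) with hφ₃
  have hT1 := rpow_taylor_three hX p
  have hT2 := rpow_taylor_three hY (2 * p / (p + 1))
  set R₁ : ℝ → ℝ := fun u => (critX N p + u) ^ p - (critX N p ^ p + p * critX N p ^ (p - 1) * u +
    p * (p - 1) * critX N p ^ (p - 2) / 2 * u ^ 2 +
    p * (p - 1) * (p - 2) * critX N p ^ (p - 3) / 6 * u ^ 3) with hR₁
  set q := 2 * p / (p + 1) with hq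
  set R₂ : ℝ → ℝ := fun u => (critY N p + u) ^ q - (critY N p ^ q + q * critY N p ^ (q - 1) * u +
    q * (q - 1) * critY N p ^ (q - 2) / 2 * u ^ 2 +
    q * (q - 1) * (q - 2) * critY N p ^ (q - 3) / 6 * u ^ 3) with hR₂
  have hGform : ∀ᶠ ζ : ℝ × ℝ in 𝓝 0, G ζ = (-ω * ζ.2, ω * ζ.1 +
      ((((critPhi₂ N p + critPsi₂ N p * a ^ 2) / (2 * ω)) * ζ.1 ^ 2 +
        critPsi₂ N p * a * (ζ.1 * ζ.2) + critPsi₂ N p * ω / 2 * ζ.2 ^ 2) +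
      ((φ₃ + critPsi₃ N p * a ^ 3) / (6 * ω) * ζ.1 ^ 3 +
        critPsi₃ N p * a ^ 2 / 2 * (ζ.1 ^ 2 * ζ.2) + critPsi₃ N p * a * ω / 2 * (ζ.1 * ζ.2 ^ 2) +
        critPsi₃ N p * ω ^ 2 / 6 * ζ.2 ^ 3) +
      (R₁ ζ.1 + Mbar N p * R₂ (a * ζ.1 + ω * ζ.2)) / ω)) := by
    have h1 : ContinuousAt (fun ζ : ℝ × ℝ => critX N p + ζ.1) 0 := by fun_prop
    have h2 : ContinuousAt (fun ζ : ℝ × ℝ => critY N p + (a * ζ.1 + ω * ζ.2)) 0 := by fun_prop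
    filter_upwards [h1.eventually (lt_mem_nhds (by simpa using hX)),
      h2.eventually (lt_mem_nhds (by simpa using hY))] with ζ e1 e2
    rw [hG]
    simp only [chartField, shear_symm_apply, shear_apply, Prod.mk_add_mk]
    rw [phaseField_of_pos e1 e2]
    have r1 : (critX N p + ζ.1) ^ p = R₁ ζ.1 + (critX N p ^ p + p * critX N p ^ (p - 1) * ζ.1 +
      p * (p - 1) * critX N p ^ (p - 2) / 2 * ζ.1 ^ 2 +
      p * (p - 1) * (p - 2) * critX N p ^ (p - 3) / 6 * ζ.1 ^ 3) := by simp only [hR₁]; ring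
    have r2 : (critY N p + (a * ζ.1 + ω * ζ.2)) ^ q = R₂ (a * ζ.1 + ω * ζ.2) +
      (critY N p ^ q + q * critY N p ^ (q - 1) * (a * ζ.1 + ω * ζ.2) +
      q * (q - 1) * critY N p ^ (q - 2) / 2 * (a * ζ.1 + ω * ζ.2) ^ 2 +
      q * (q - 1) * (q - 2) * critY N p ^ (q - 3) / 6 * (a * ζ.1 + ω * ζ.2) ^ 3) := by
      simp only [hR₂]; ring
    have hK' : coefK N p = Mbar N p * q * critY N p ^ (q - 1) + a := by rw [hMb, hK]
    have hD : p * critX N p ^ (p - 1) = a ^ 2 + ω ^ 2 := by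
      rw [hXp, hω2, ← hLN, ha]
      field_simp
      ring
    rw [r1, r2]
    simp only [Prod.snd_zero] at heq
    have hYX : critY N p = a * critX N p := hYdef
    have hψ₂ : critPsi₂ N p = Mbar N p * (q * (q - 1) * critY N p ^ (q - 2)) := mul_assoc _ _ _
    have hψ₃ : critPsi₃ N p = Mbar N p * (q * (q - 1) * (q - 2) * critY N p ^ (q - 3)) :=
      mul_assoc _ _ _
    have hφ₂ : critPhi₂ N p = p * (p - 1) * critX N p ^ (p - 2) := rfl
    have hK'' : coefK N p = Mbar N p * (q * critY N p ^ (q - 1)) + a := by rw [hK', mul_assoc]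
    rw [hψ₂, hψ₃, hφ₂]
    exact Prod.ext (by simp only; rw [hYX]; ring)
      (cubic_normal_form_snd hω.ne' heq hK'' hD hYX)
  obtain ⟨V, hV1, hV2, hV3⟩ := exists_quartic_lyapunov hω.ne'
    ((critPhi₂ N p + critPsi₂ N p * a ^ 2) / (2 * ω)) (critPsi₂ N p * a) (critPsi₂ N p * ω / 2)
    ((φ₃ + critPsi₃ N p * a ^ 3) / (6 * ω)) (critPsi₃ N p * a ^ 2 / 2)
    (critPsi₃ N p * a * ω / 2) (critPsi₃ N p * ω ^ 2 / 6) (h := fun ζ => (G ζ).2 - ω * ζ.1) (by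
      have hlin : (fun ζ : ℝ × ℝ => a * ζ.1 + ω * ζ.2) =O[𝓝 0] fun ζ => ‖ζ‖ := by
        have h1 := (isBigO_monomial 1 0).const_mul_left a
        have h2 := (isBigO_monomial 0 1).const_mul_left ω
        simpa using! h1.add h2
      have hfst : (fun ζ : ℝ × ℝ => ζ.1) =O[𝓝 0] fun ζ => ‖ζ‖ := by
        simpa using! isBigO_monomial 1 0
      have t1 : (fun ζ : ℝ × ℝ => R₁ ζ.1) =O[𝓝 0] fun ζ => ‖ζ‖ ^ 4 :=
        (hT1.comp_tendsto (continuous_fst.tendsto' (0 : ℝ × ℝ) 0 rfl)).trans (hfst.pow 4)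
      have t2 : (fun ζ : ℝ × ℝ => R₂ (a * ζ.1 + ω * ζ.2)) =O[𝓝 0] fun ζ => ‖ζ‖ ^ 4 := by
        have hc : Continuous fun ζ : ℝ × ℝ => a * ζ.1 + ω * ζ.2 := by fun_prop
        exact (hT2.comp_tendsto (hc.tendsto' (0 : ℝ × ℝ) 0 (by simp))).trans (hlin.pow 4)
      refine IsBigO.congr' ((t1.add (t2.const_mul_left (Mbar N p))).const_mul_left ω⁻¹) ?_
        (EventuallyEq.refl _ _)
      filter_upwards [hGform] with ζ hζ
      rw [hζ]
      simp only
      ring)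
  refine ⟨V, hV1, hV2, hV3.congr' ?_ (EventuallyEq.refl _ _)⟩
  filter_upwards [hGform] with ζ hζ
  have hζ' : ((-ω * ζ.2, ω * ζ.1 + ((G ζ).2 - ω * ζ.1)) : ℝ × ℝ) = G ζ := by
    ext
    · rw [hζ]
    · simp
  rw [hζ', focalValue, ← hω2, ← ha]
  congr 2
  clear_value a ω
  field_simp
  ring

theorem contDiffAt_phaseField_critical (hN : 3 ≤ N) (hp : 1 < p) :
    ContDiffAt ℝ 1 (phaseField N p (Mbar N p)) (critX N p, critY N p) :=
  ContDiffAt.comp (critX N p, critY N p)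
    (contDiffAt_phaseField (n := 1) (critX_pos hN hp) (critY_pos hN hp))
    (contDiffAt_const.prodMk contDiffAt_id)

theorem isWeakSink_critical (hN : 3 ≤ N) (hp : 1 < p) (hL : 0 < coefL N p) :
    IsWeakSink (phaseField N p (Mbar N p)) (pointP N p (Mbar N p)) := by
  rw [pointP_Mbar hN hp]
  obtain ⟨κ, hκ, hf⟩ := focalValue_eq hN hp
  obtain ⟨V, h1, h2, h3⟩ := exists_critical_lyapunov hN hp
  refine isWeakSink_of_chart (F := phaseField N p (Mbar N p)) (V := V)
    (A := shear (2 / (p - 1)) √((N : ℝ) - 2) (sqrt_frequency_pos hN).ne')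
    (G := chartField (phaseField N p (Mbar N p)) (critX N p, critY N p)
      (shear (2 / (p - 1)) √((N : ℝ) - 2) (sqrt_frequency_pos hN).ne'))
    (k := -(focalValue N p / 8)) ?_ (phaseField_critical hN hp)
    (contDiffAt_phaseField_critical hN hp) (Eventually.of_forall fun z => ?_) h1 h2
    (h3.congr_left fun ζ => by ring)
  · rw [hf]
    have := mul_pos hL hκ
    linarith
  · simp [chartField, critY]

theorem isWeakSource_critical (hN : 3 ≤ N) (hp : 1 < p) (hL : coefL N p < 0) :
    IsWeakSource (phaseField N p (Mbar N p)) (pointP N p (Mbar N p)) := by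
  rw [pointP_Mbar hN hp]
  obtain ⟨κ, hκ, hf⟩ := focalValue_eq hN hp
  obtain ⟨V, h1, h2, h3⟩ := exists_critical_lyapunov hN hp
  refine isWeakSink_of_chart (F := fun z => -phaseField N p (Mbar N p) z) (V := V)
    (A := shear (2 / (p - 1)) √((N : ℝ) - 2) (sqrt_frequency_pos hN).ne')
    (G := fun ζ => -chartField (phaseField N p (Mbar N p)) (critX N p, critY N p)
      (shear (2 / (p - 1)) √((N : ℝ) - 2) (sqrt_frequency_pos hN).ne') ζ)
    (k := focalValue N p / 8) ?_ (by simpa [critY] using phaseField_critical hN hp)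
    (contDiffAt_phaseField_critical hN hp).neg (Eventually.of_forall fun z => ?_) h1 h2
    (h3.neg_left.congr_left fun ζ => by rw [map_neg]; ring)
  · rw [hf]
    have := mul_pos (neg_pos.2 hL) hκ
    linarith
  · simp [chartField, critY]

end Focus

/-! ### Hopf bifurcation of a family in normal form -/

section NormalForm

variable {G : ℝ → ℝ × ℝ → ℝ × ℝ} {l₀ ω k : ℝ} {α β : ℝ → ℝ} {V : ℝ × ℝ → ℝ}
  {U : Set (ℝ × ℝ)}

theorem eventually_inner_pos_of_hasFDerivAt {F : ℝ × ℝ → ℝ × ℝ} {J : (ℝ × ℝ) →L[ℝ] (ℝ × ℝ)}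
    {c d : ℝ} (hc : 0 < c) (hF0 : F 0 = 0) (hF : HasFDerivAt F J 0)
    (hJ : ∀ ζ, J ζ = (c * ζ.1 - d * ζ.2, d * ζ.1 + c * ζ.2)) :
    ∀ᶠ ζ in 𝓝 0, ζ ≠ 0 → 0 < ζ.1 * (F ζ).1 + ζ.2 * (F ζ).2 := by
  have h := hF.isLittleO
  simp only [hF0, sub_zero] at h
  filter_upwards [h.def (show 0 < c / 4 by linarith)] with ζ hζ h0
  have hn : 0 < ‖ζ‖ := norm_pos_iff.2 h0
  have e1 := (norm_fst_le (F ζ - J ζ)).trans hζ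
  have e2 := (norm_snd_le (F ζ - J ζ)).trans hζ
  have e3 := norm_fst_le ζ
  have e4 := norm_snd_le ζ
  have hsq : ‖ζ‖ ^ 2 ≤ ζ.1 ^ 2 + ζ.2 ^ 2 := by
    rw [Prod.norm_def]
    rcases max_cases ‖ζ.1‖ ‖ζ.2‖ with ⟨h, -⟩ | ⟨h, -⟩ <;> rw [h, Real.norm_eq_abs, sq_abs] <;>
      nlinarith [sq_nonneg ζ.1, sq_nonneg ζ.2]
  rw [hJ] at e1 e2
  simp only [Prod.fst_sub, Prod.snd_sub] at e1 e2
  have m1 := mul_le_mul e3 e1 (norm_nonneg _) hn.le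
  have m2 := mul_le_mul e4 e2 (norm_nonneg _) hn.le
  rw [← norm_mul, Real.norm_eq_abs] at m1 m2
  have := (abs_le.1 m1).1
  have := (abs_le.1 m2).1
  have := mul_le_mul_of_nonneg_left hsq hc.le
  have := mul_pos hc (pow_pos hn 2)
  linarith

theorem eventually_exists_limitCycle_of_contDiffAt (hω : 0 < ω) (hk : 0 < k)
    (hG : ContDiffAt ℝ 1 (fun x : ℝ × (ℝ × ℝ) => G x.1 x.2) (l₀, 0))
    (hG0 : ∀ᶠ l in 𝓝 l₀, G l 0 = 0)
    (hJ : ∀ᶠ l in 𝓝 l₀, ∃ J : (ℝ × ℝ) →L[ℝ] (ℝ × ℝ), HasFDerivAt (G l) J 0 ∧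
      ∀ ζ, J ζ = (α l * ζ.1 - β l * ζ.2, β l * ζ.1 + α l * ζ.2))
    (hα : α l₀ = 0) (hβ : β l₀ = ω) (hα' : ∀ᶠ l in 𝓝[>] l₀, 0 < α l)
    (hVd : ContDiff ℝ 1 V)
    (hV : (fun ζ => V ζ - (ζ.1 ^ 2 + ζ.2 ^ 2)) =o[𝓝 0] fun ζ => ζ.1 ^ 2 + ζ.2 ^ 2)
    (hV' : (fun ζ => fderiv ℝ V ζ (G l₀ ζ) + k * (ζ.1 ^ 2 + ζ.2 ^ 2) ^ 2)
      =o[𝓝 0] fun ζ => (ζ.1 ^ 2 + ζ.2 ^ 2) ^ 2) (hU : U ∈ 𝓝 0) :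
    ∀ᶠ l in 𝓝[>] l₀, ∃ γ, IsLimitCycleAround (G l) 0 γ ∧ Set.range γ ⊆ U := by
  have hev := hG.eventually (by simp)
  have hι : ∀ l : ℝ, ∀ ζ : ℝ × ℝ, ContDiffAt ℝ 1 (fun ζ : ℝ × ℝ => (l, ζ)) ζ := fun l ζ =>
    contDiffAt_const.prodMk contDiffAt_id
  refine eventually_exists_limitCycle (ω := ω) hω hk ?_ ?_ ?_ ?_ hVd hV hV' hU
  · exact ((hι l₀ 0).continuousAt.eventually hev).mono fun ζ hζ => hζ.continuousAt
  · have hs := hG.hasStrictFDerivAt (by simp)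
    obtain ⟨J, hJ, hJζ⟩ := hJ.self_of_nhds
    have hcomp := hs.hasFDerivAt.comp (f := fun ζ : ℝ × ℝ => (l₀, ζ)) (0 : ℝ × ℝ)
      ((hasFDerivAt_const l₀ 0).prodMk (hasFDerivAt_id 0))
    have hJe := hJ.unique hcomp
    have ht : Tendsto (fun x : ℝ × (ℝ × ℝ) => (x, (x.1, (0 : ℝ × ℝ)))) (𝓝 (l₀, 0))
        (𝓝 ((l₀, 0), (l₀, 0))) := by
      have : Continuous (fun x : ℝ × (ℝ × ℝ) => (x, (x.1, (0 : ℝ × ℝ)))) := by fun_prop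
      exact this.tendsto' _ _ rfl
    have h := hs.isLittleO.comp_tendsto ht
    refine (h.trans_isBigO (IsBigO.of_bound 1 (Eventually.of_forall fun x => ?_))).congr' ?_
      (EventuallyEq.refl _ _)
    · simp [Prod.norm_def]
    · filter_upwards [(continuous_fst.tendsto' (l₀, (0 : ℝ × ℝ)) l₀ rfl).eventually hG0] with x hx
      have e : (-ω * x.2.2, ω * x.2.1) = J x.2 := by rw [hJζ, hα, hβ]; ext <;> simp
      have e' : x - (x.1, (0 : ℝ × ℝ)) = (0, x.2) := by ext <;> simp
      rw [e, hJe]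
      simp only [Function.comp_apply, hx, sub_zero, e']
      rfl
  · filter_upwards [hev] with x hx
    exact ContDiffAt.comp (g := fun x : ℝ × (ℝ × ℝ) => G x.1 x.2) x.2 hx (hι x.1 x.2)
  · filter_upwards [nhdsWithin_le_nhds hG0, nhdsWithin_le_nhds hJ, hα'] with l h0 h1 h2
    obtain ⟨J, h1, h1'⟩ := h1
    exact eventually_inner_pos_of_hasFDerivAt h2 h0 h1 h1'

end NormalForm

/-! ### Linear algebra of the linear part -/

section LinearPart

/-- With y = (a-α)u + βv, the first equation reads u' = αu - βv at once; trace 2α and determinant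
α²+β² force the second one. -/
theorem shear_conj {J : (ℝ × ℝ) →L[ℝ] (ℝ × ℝ)} {a D E α β : ℝ}
    (hJ : ∀ w, J w = (a * w.1 - w.2, D * w.1 + E * w.2)) (hα : 2 * α = a + E)
    (hβ : β ≠ 0) (hβ2 : β ^ 2 = D - (a - α) ^ 2) (ζ : ℝ × ℝ) :
    shear (a - α) β hβ (J ((shear (a - α) β hβ).symm ζ)) =
      (α * ζ.1 - β * ζ.2, β * ζ.1 + α * ζ.2) := by
  rw [shear_symm_apply, hJ, shear_apply]
  have hE : E = 2 * α - a := by linarith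
  have hD : D = β ^ 2 + (a - α) ^ 2 := by linarith
  subst hE hD
  ext
  · simp only; ring
  · simp only; field_simp; ring

theorem roots_charpoly_eq {J : (ℝ × ℝ) →L[ℝ] (ℝ × ℝ)} {a D E α β : ℝ}
    (hJ : ∀ w, J w = (a * w.1 - w.2, D * w.1 + E * w.2)) (hα : 2 * α = a + E)
    (hβ2 : β ^ 2 = D - (a - α) ^ 2) :
    (J.toLinearMap.charpoly.map (algebraMap ℝ ℂ)).roots =
      {(α : ℂ) + β * Complex.I, (α : ℂ) - β * Complex.I} := by
  have hM : LinearMap.toMatrix (Module.Basis.finTwoProd ℝ) (Module.Basis.finTwoProd ℝ)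
      J.toLinearMap = !![a, -1; D, E] := by
    ext i j
    fin_cases i <;> fin_cases j <;> simp [LinearMap.toMatrix_apply, hJ]
  rw [← LinearMap.charpoly_toMatrix _ (Module.Basis.finTwoProd ℝ), hM, Matrix.charpoly_fin_two]
  have hE : E = 2 * α - a := by linarith
  have hD : D = β ^ 2 + (a - α) ^ 2 := by linarith
  subst hE hD
  have : (Polynomial.X ^ 2 - Polynomial.C (!![a, -1; β ^ 2 + (a - α) ^ 2, 2 * α - a]).trace *
      Polynomial.X + Polynomial.C (!![a, -1; β ^ 2 + (a - α) ^ 2, 2 * α - a]).det).map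
        (algebraMap ℝ ℂ) =
      (({(α : ℂ) + β * Complex.I, (α : ℂ) - β * Complex.I} : Multiset ℂ).map
        fun z => Polynomial.X - Polynomial.C z).prod := by
    rw [Matrix.trace_fin_two_of, Matrix.det_fin_two_of]
    simp only [Multiset.insert_eq_cons, Multiset.map_cons, Multiset.map_singleton,
      Multiset.prod_cons, Multiset.prod_singleton]
    have hI : (Polynomial.C Complex.I : Polynomial ℂ) ^ 2 = -1 := by
      rw [← map_pow, Complex.I_sq]; simp
    simp only [Polynomial.map_add, Polynomial.map_sub, Polynomial.map_mul, Polynomial.map_pow,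
      Polynomial.map_X, Polynomial.map_C, Polynomial.map_neg, Polynomial.map_one,
      Polynomial.map_ofNat, map_add, map_sub, map_mul, map_pow, map_neg, map_one,
      Complex.coe_algebraMap, map_ofNat]
    linear_combination (Polynomial.C (β : ℂ)) ^ 2 * hI
  rw [this, Polynomial.roots_multiset_prod_X_sub_C]

end LinearPart

/-! ### The branch of equilibria -/

theorem exists_local_inverse {f : ℝ → ℝ} {a f' : ℝ} (hf : ContDiffAt ℝ 1 f a)
    (hd : HasDerivAt f f' a) (h : f' ≠ 0) :
    ∃ g : ℝ → ℝ, ContDiffAt ℝ 1 g (f a) ∧ g (f a) = a ∧ HasDerivAt g f'⁻¹ (f a) ∧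
      ∀ᶠ y in 𝓝 (f a), f (g y) = y := by
  have hs : HasStrictDerivAt f f' a := hf.hasStrictDerivAt' hd (by simp)
  have hd' := hs.hasStrictFDerivAt_equiv h
  have hd'' := hd'.hasFDerivAt
  refine ⟨hf.localInverse hd'' (by simp), hf.to_localInverse hd'' (by simp),
    hf.localInverse_apply_image hd'' (by simp), ?_, ?_⟩
  · exact (hs.to_localInverse h).hasDerivAt
  · exact hd'.eventually_right_inverse

section Bifurcation

variable {N : ℕ} {p : ℝ}

theorem Mbar_pos (hN : 3 ≤ N) (hp : 1 < p) (hL : 0 < coefL N p) : 0 < Mbar N p := by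
  have h := Mbar_mul hN hp
  have h1 := exponent_pos hp
  have h2 := Real.rpow_pos_of_pos (critY_pos hN hp) (2 * p / (p + 1) - 1)
  rw [critY] at h2
  rw [mul_assoc] at h
  exact pos_of_mul_pos_left (h ▸ hL) (mul_pos h1 h2).le

theorem Mbar_neg (hN : 3 ≤ N) (hp : 1 < p) (hL : coefL N p < 0) : Mbar N p < 0 := by
  have h := Mbar_mul hN hp
  have h1 := exponent_pos hp
  have h2 := Real.rpow_pos_of_pos (critY_pos hN hp) (2 * p / (p + 1) - 1)
  rw [critY] at h2
  rw [mul_assoc] at h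
  exact neg_of_mul_neg_left (h ▸ hL) (mul_pos h1 h2).le

theorem eq_of_mem_equilibriumAbscissae (hp : 1 < p) {M X X' : ℝ} (hM : 0 ≤ M)
    (h : X ∈ equilibriumAbscissae N p M) (h' : X' ∈ equilibriumAbscissae N p M) : X = X' := by
  have key : ∀ x y : ℝ, 0 < x → x < y → x ∈ equilibriumAbscissae N p M →
      y ∈ equilibriumAbscissae N p M → False := fun x y hx hxy e1 e2 => by
    have ha := slope_pos hp
    rw [mem_equilibriumAbscissae_iff hp hx] at e1
    rw [mem_equilibriumAbscissae_iff hp (hx.trans hxy)] at e2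
    have h1 : x ^ (p - 1) < y ^ (p - 1) := Real.rpow_lt_rpow hx.le hxy (by linarith)
    have h2 : (2 / (p - 1) * x) ^ (2 * p / (p + 1) - 1) ≤
        (2 / (p - 1) * y) ^ (2 * p / (p + 1) - 1) := by
      refine Real.rpow_le_rpow (by positivity) (by gcongr) ?_
      rw [exponent_sub_one hp]
      exact div_nonneg (by linarith) (by linarith)
    have := mul_le_mul_of_nonneg_left h2 (mul_nonneg hM ha.le)
    linarith
  rcases lt_trichotomy X X' with h1 | h1 | h1
  · exact (key X X' h.1 h1 h h').elim
  · exact h1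
  · exact (key X' X h'.1 h1 h' h).elim

/-- For `M > 0` the equilibrium is unique, and near the critical value it depends smoothly on `M`,
with a decreasing abscissa. -/
theorem exists_equilibrium_branch (hN : 3 ≤ N) (hp : 1 < p) (hL : 0 < coefL N p) :
    ∃ (g : ℝ → ℝ) (g' : ℝ), g' < 0 ∧ ContDiffAt ℝ 1 g (Mbar N p) ∧
      HasDerivAt g g' (Mbar N p) ∧ g (Mbar N p) = critX N p ∧
      ∀ᶠ M in 𝓝 (Mbar N p), g M ∈ equilibriumAbscissae N p M ∧
        pointP N p M = (g M, 2 / (p - 1) * g M) := by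
  have hX := critX_pos hN hp
  have hY := critY_pos hN hp
  have hM := Mbar_pos hN hp hL
  have ha := slope_pos hp
  have hp1 : 0 < p - 1 := by linarith
  have hr : 0 < 2 * p / (p + 1) - 1 := by
    rw [exponent_sub_one hp]; exact div_pos hp1 (by linarith)
  set r := 2 * p / (p + 1) - 1 with hrdef
  have hmem := (mem_equilibriumAbscissae_iff hp hX).1 (critX_mem hN hp)
  rw [← hrdef] at hmem
  set a := 2 / (p - 1) with hadef
  -- The equilibrium equation solved for M. At `critX` the derivative of m is negative because the
  -- critical M is positive, and the branch is the local inverse.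
  set m : ℝ → ℝ := fun X => (coefK N p * a - X ^ (p - 1)) / (a * (a * X) ^ r) with hm
  have hYr : 0 < (a * critX N p) ^ r := Real.rpow_pos_of_pos (mul_pos ha hX) _
  have hm0 : m (critX N p) = Mbar N p := by
    rw [hm, div_eq_iff (mul_pos ha hYr).ne']
    linarith
  have hnum : HasDerivAt (fun X : ℝ => coefK N p * a - X ^ (p - 1))
      (-((p - 1) * critX N p ^ (p - 1 - 1))) (critX N p) :=
    (Real.hasDerivAt_rpow_const (Or.inl hX.ne')).const_sub _
  have hden : HasDerivAt (fun X : ℝ => a * (a * X) ^ r)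
      (a * (a * r * (a * critX N p) ^ (r - 1))) (critX N p) := by
    have h1 : HasDerivAt (fun X : ℝ => a * X) a (critX N p) := by
      simpa using (hasDerivAt_id (critX N p)).const_mul a
    exact (h1.rpow_const (Or.inl (mul_pos ha hX).ne')).const_mul a
  have hmd := hnum.div hden (mul_pos ha hYr).ne'
  have hnumeq : coefK N p * a - critX N p ^ (p - 1) = Mbar N p * (a * (a * critX N p) ^ r) := by
    linarith
  rw [hnumeq] at hmd
  set m' := (-((p - 1) * critX N p ^ (p - 1 - 1)) * (a * (a * critX N p) ^ r) -
    Mbar N p * (a * (a * critX N p) ^ r) * (a * (a * r * (a * critX N p) ^ (r - 1)))) /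
      (a * (a * critX N p) ^ r) ^ 2 with hm'
  have hm'neg : m' < 0 := by
    have e1 : 0 < critX N p ^ (p - 1 - 1) := Real.rpow_pos_of_pos hX _
    have e2 : 0 < (a * critX N p) ^ (r - 1) := Real.rpow_pos_of_pos (mul_pos ha hX) _
    refine div_neg_of_neg_of_pos ?_ (by positivity)
    have : 0 < (p - 1) * critX N p ^ (p - 1 - 1) * (a * (a * critX N p) ^ r) := by positivity
    have : 0 < Mbar N p * (a * (a * critX N p) ^ r) * (a * (a * r * (a * critX N p) ^ (r - 1))) := by
      positivity
    linarith
  have hmc : ContDiffAt ℝ 1 m (critX N p) := by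
    refine ContDiffAt.div (contDiffAt_const.sub (contDiffAt_id.rpow_const_of_ne hX.ne'))
      (contDiffAt_const.mul ?_) (mul_pos ha hYr).ne'
    exact (contDiffAt_const.mul contDiffAt_id).rpow_const_of_ne (mul_pos ha hX).ne'
  obtain ⟨g, hg, hg0, hgd, hinv⟩ := exists_local_inverse hmc hmd hm'neg.ne
  rw [hm0] at hg hg0 hgd hinv
  refine ⟨g, m'⁻¹, inv_lt_zero.2 hm'neg, hg, hgd, hg0, ?_⟩
  have hgpos := hg.continuousAt.eventually (lt_mem_nhds (hg0 ▸ hX))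
  filter_upwards [hinv, hgpos, lt_mem_nhds hM] with M h1 h2 h3
  have hmemM : g M ∈ equilibriumAbscissae N p M := by
    rw [mem_equilibriumAbscissae_iff hp h2]
    have : 0 < (a * g M) ^ r := Real.rpow_pos_of_pos (mul_pos ha h2) _
    rw [hm, div_eq_iff (mul_pos ha this).ne'] at h1
    linarith
  exact ⟨hmemM, pointP_eq_of_isGreatest ⟨hmemM, fun X hX =>
    (eq_of_mem_equilibriumAbscissae hp h3.le hX hmemM).le⟩⟩

/-- The linear part at an equilibrium of the first quadrant, as a function of its abscissa. -/
theorem hasFDerivAt_equilibrium (hp : 1 < p) {M X : ℝ} (hX : X ∈ equilibriumAbscissae N p M) :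
    ∃ J : (ℝ × ℝ) →L[ℝ] (ℝ × ℝ), HasFDerivAt (phaseField N p M) J (X, 2 / (p - 1) * X) ∧
      ∀ w, J w = (2 / (p - 1) * w.1 - w.2, p * X ^ (p - 1) * w.1 +
        (-coefK N p + 2 * p / (p + 1) / (2 / (p - 1)) *
          (coefK N p * (2 / (p - 1)) - X ^ (p - 1))) * w.2) := by
  have ha := slope_pos hp
  obtain ⟨J, hJ, hJw⟩ := hasFDerivAt_phaseField (N := N) (p := p) (M := M) hX.1 (mul_pos ha hX.1)
  refine ⟨J, hJ, fun w => ?_⟩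
  have h := (mem_equilibriumAbscissae_iff hp hX.1).1 hX
  -- The equilibrium equation eliminates M, so that the trace depends on the abscissa alone.
  rw [hJw, ← h]
  generalize 2 / (p - 1) = a at *
  have := ha.ne'
  ext
  · rfl
  · simp only
    congr 2
    field_simp
    ring

theorem isAndronovHopfPoint_Mbar (hN : 3 ≤ N) (hp : 1 < p) (hL : 0 < coefL N p) :
    IsAndronovHopfPoint (phaseField N p) (pointP N p) (Mbar N p) := by
  obtain ⟨g, g', hg', hg, hgd, hg0, hbr⟩ := exists_equilibrium_branch hN hp hL
  have hX := critX_pos hN hp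
  have hY := critY_pos hN hp
  have ha := slope_pos hp
  have hω := sqrt_frequency_pos hN
  have hω2 : √((N : ℝ) - 2) ^ 2 = (N : ℝ) - 2 := Real.sq_sqrt (Real.sqrt_pos.1 hω).le
  have hXp := critX_rpow hN hp
  have hK := coefK_eq (N := N) hp
  have hLN := coefL_add (N := N) hp
  have hp0 : p ≠ 0 := by linarith
  have hp1 : p - 1 ≠ 0 := by linarith
  have hp2 : p + 1 ≠ 0 := by linarith
  obtain ⟨V, hV1, hV2, hV3⟩ := exists_critical_lyapunov hN hp
  obtain ⟨κ, hκ, hf⟩ := focalValue_eq hN hp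
  set a := 2 / (p - 1) with hadef
  set q := 2 * p / (p + 1) with hqdef
  have hq : 0 < q := exponent_pos hp
  have hYa : critY N p = a * critX N p := rfl
  set D : ℝ → ℝ := fun M => p * g M ^ (p - 1) with hD
  set E : ℝ → ℝ := fun M => -coefK N p + q / a * (coefK N p * a - g M ^ (p - 1)) with hE
  set α : ℝ → ℝ := fun M => (a + E M) / 2 with hα
  -- With trace 2α this radicand is the determinant minus α², so the eigenvalues are α ± iβ.
  set β : ℝ → ℝ := fun M => √(D M - (a - α M) ^ 2) with hβ
  have hE0 : E (Mbar N p) = -a := by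
    simp only [hE, hg0, hXp, hK, hqdef, hadef]
    field_simp
    ring
  have hα0 : α (Mbar N p) = 0 := by simp only [hα, hE0]; ring
  have hD0 : D (Mbar N p) = a ^ 2 + ((N : ℝ) - 2) := by
    simp only [hD, hg0, hXp, ← hLN, hadef]
    field_simp
    ring
  have hβ0 : β (Mbar N p) = √((N : ℝ) - 2) := by
    simp only [hβ, hα0, hD0]
    congr 1
    ring
  have hgp : ContDiffAt ℝ 1 (fun M => g M ^ (p - 1)) (Mbar N p) :=
    hg.rpow_const_of_ne (hg0 ▸ hX.ne')
  have hDc : ContDiffAt ℝ 1 D (Mbar N p) := contDiffAt_const.mul hgp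
  have hEc : ContDiffAt ℝ 1 E (Mbar N p) :=
    contDiffAt_const.add (contDiffAt_const.mul (contDiffAt_const.sub hgp))
  have hαc : ContDiffAt ℝ 1 α (Mbar N p) := (contDiffAt_const.add hEc).div_const 2
  have hrad : 0 < D (Mbar N p) - (a - α (Mbar N p)) ^ 2 := Real.sqrt_pos.1 (hω.trans_eq hβ0.symm)
  have hradc : ContDiffAt ℝ 1 (fun M => D M - (a - α M) ^ 2) (Mbar N p) :=
    hDc.sub ((contDiffAt_const.sub hαc).pow 2)
  have hβc : ContDiffAt ℝ 1 β (Mbar N p) := hradc.sqrt hrad.ne'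
  -- The trace decreases with the abscissa, and the abscissa decreases with M.
  obtain ⟨α', hα'0, hα'⟩ : ∃ α' > 0, HasDerivAt α α' (Mbar N p) := by
    have h1 := hgd.rpow_const (p := p - 1) (Or.inl (hg0 ▸ hX.ne'))
    have h2 := ((((h1.const_sub (coefK N p * a)).const_mul (q / a)).const_add
      (-coefK N p)).const_add a).div_const 2
    refine ⟨_, ?_, h2⟩
    have e1 : 0 < g (Mbar N p) ^ (p - 1 - 1) := Real.rpow_pos_of_pos (hg0 ▸ hX) _
    have e2 : 0 < -g' * (p - 1) * g (Mbar N p) ^ (p - 1 - 1) :=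
      mul_pos (mul_pos (neg_pos.2 hg') (by linarith)) e1
    have e3 := mul_pos (div_pos hq ha) e2
    linarith
  have hαpos : ∀ᶠ M in 𝓝[>] (Mbar N p), 0 < α M := by
    have h := (hα'.tendsto_slope.mono_left (nhdsGT_le_nhdsNE _)).eventually (lt_mem_nhds hα'0)
    filter_upwards [h, self_mem_nhdsWithin] with M h1 h2
    rw [slope_def_field, hα0, sub_zero] at h1
    exact (div_pos_iff_of_pos_right (sub_pos.2 h2)).1 h1
  have hbr' : ∀ᶠ M in 𝓝 (Mbar N p), g M ∈ equilibriumAbscissae N p M ∧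
      pointP N p M = (g M, a * g M) ∧ 0 < β M ∧ β M ^ 2 = D M - (a - α M) ^ 2 := by
    filter_upwards [hbr, hradc.continuousAt.eventually (lt_mem_nhds hrad)] with M h1 h2
    exact ⟨h1.1, h1.2, Real.sqrt_pos.2 h2, Real.sq_sqrt h2.le⟩
  have hPc : ContinuousAt (fun M => ((g M, a * g M) : ℝ × ℝ)) (Mbar N p) :=
    hg.continuousAt.prodMk (continuousAt_const.mul hg.continuousAt)
  have hPe : (fun M => ((g M, a * g M) : ℝ × ℝ)) =ᶠ[𝓝 (Mbar N p)] pointP N p :=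
    hbr.mono fun M h => h.2.symm
  have h2α : ∀ M, 2 * α M = a + E M := fun M => by simp only [hα]; ring
  refine ⟨hPc.congr hPe, ⟨α, β, ?_, hα0, α', hα'0, hα'⟩, fun U hU => ?_⟩
  · filter_upwards [hbr'] with M hM
    obtain ⟨h1, h2, h3, h4⟩ := hM
    obtain ⟨J, hJ, hJw⟩ := hasFDerivAt_equilibrium hp h1
    rw [h2]
    exact ⟨h1.2, hJ.differentiableAt, h3, by
      rw [hJ.fderiv]; exact roots_charpoly_eq hJw (h2α M) h4⟩
  · set B : ℝ → ℝ × ℝ → ℝ × ℝ := fun M ζ =>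
      (g M + ζ.1, a * g M + ((a - α M) * ζ.1 + β M * ζ.2)) with hB
    -- The chart field written out explicitly, because `shear` needs a proof of β ≠ 0, available
    -- only for M near the critical value.
    set G : ℝ → ℝ × ℝ → ℝ × ℝ := fun M ζ => ((phaseField N p M (B M ζ)).1,
      ((phaseField N p M (B M ζ)).2 - (a - α M) * (phaseField N p M (B M ζ)).1) / β M) with hG
    have hlift : ∀ f : ℝ → ℝ, ContDiffAt ℝ 1 f (Mbar N p) →
        ContDiffAt ℝ 1 (fun x : ℝ × (ℝ × ℝ) => f x.1) (Mbar N p, 0) := fun f hf =>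
      ContDiffAt.comp (g := f) (Mbar N p, (0 : ℝ × ℝ)) hf contDiffAt_fst
    have hBc : ContDiffAt ℝ 1 (fun x : ℝ × (ℝ × ℝ) => B x.1 x.2) (Mbar N p, 0) := by
      have e1 : ContDiffAt ℝ 1 (fun x : ℝ × (ℝ × ℝ) => g x.1) (Mbar N p, 0) :=
        hlift _ hg
      have e2 : ContDiffAt ℝ 1 (fun x : ℝ × (ℝ × ℝ) => α x.1) (Mbar N p, 0) :=
        hlift _ hαc
      have e3 : ContDiffAt ℝ 1 (fun x : ℝ × (ℝ × ℝ) => β x.1) (Mbar N p, 0) :=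
        hlift _ hβc
      have e4 : ContDiffAt ℝ 1 (fun x : ℝ × (ℝ × ℝ) => x.2.1) (Mbar N p, 0) := by fun_prop
      have e5 : ContDiffAt ℝ 1 (fun x : ℝ × (ℝ × ℝ) => x.2.2) (Mbar N p, 0) := by fun_prop
      exact (e1.add e4).prodMk ((contDiffAt_const.mul e1).add
        (((contDiffAt_const.sub e2).mul e4).add (e3.mul e5)))
    have hB0 : B (Mbar N p) 0 = (critX N p, critY N p) := by simp [hB, hg0, hYa]
    have hGc : ContDiffAt ℝ 1 (fun x : ℝ × (ℝ × ℝ) => G x.1 x.2) (Mbar N p, 0) := by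
      have hfst : ContDiffAt ℝ 1 (fun x : ℝ × (ℝ × ℝ) => x.1) (Mbar N p, 0) := contDiffAt_fst
      have e2 : ContDiffAt ℝ 1 (fun x : ℝ × (ℝ × ℝ) => α x.1) (Mbar N p, 0) :=
        hlift _ hαc
      have e3 : ContDiffAt ℝ 1 (fun x : ℝ × (ℝ × ℝ) => β x.1) (Mbar N p, 0) :=
        hlift _ hβc
      have e4 : ContDiffAt ℝ 1 (fun x : ℝ × (ℝ × ℝ) => phaseField N p x.1 (B x.1 x.2))
          (Mbar N p, 0) := by
        have h := contDiffAt_phaseField (N := N) (p := p) (M := Mbar N p) (n := 1) hX hY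
        rw [← hB0] at h
        exact h.comp (f := fun x : ℝ × (ℝ × ℝ) => (x.1, B x.1 x.2)) (Mbar N p, 0)
          (hfst.prodMk hBc)
      exact e4.fst.prodMk (((e4.snd).sub ((contDiffAt_const.sub e2).mul e4.fst)).div e3
        (hβ0 ▸ hω.ne'))
    have hchart : ∀ M, ∀ h : β M ≠ 0,
        G M = chartField (phaseField N p M) (g M, a * g M) (shear (a - α M) (β M) h) :=
      fun M h => rfl
    have hG0 : ∀ᶠ M in 𝓝 (Mbar N p), G M 0 = 0 := by
      filter_upwards [hbr'] with M hM
      rw [hchart M hM.2.2.1.ne', chartField, map_zero, add_zero, hM.1.2, map_zero]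
    have hJ : ∀ᶠ M in 𝓝 (Mbar N p), ∃ J : (ℝ × ℝ) →L[ℝ] (ℝ × ℝ), HasFDerivAt (G M) J 0 ∧
        ∀ ζ, J ζ = (α M * ζ.1 - β M * ζ.2, β M * ζ.1 + α M * ζ.2) := by
      filter_upwards [hbr'] with M hM
      obtain ⟨h1, h2, h3, h4⟩ := hM
      obtain ⟨J, hJ, hJw⟩ := hasFDerivAt_equilibrium hp h1
      set A := shear (a - α M) (β M) h3.ne'
      refine ⟨A.toContinuousLinearMap.comp (J.comp A.symm.toContinuousLinearMap), ?_,
        shear_conj hJw (h2α M) h3.ne' h4⟩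
      rw [hchart M h3.ne']
      have hin : HasFDerivAt (fun ζ => (g M, a * g M) + A.symm ζ) A.symm.toContinuousLinearMap 0 :=
        A.symm.hasFDerivAt.const_add _
      have hJ0 : HasFDerivAt (phaseField N p M) J ((g M, a * g M) + A.symm 0) := by simpa using hJ
      have hJA := hJ0.comp 0 hin
      exact A.toContinuousLinearMap.hasFDerivAt.comp (0 : ℝ × ℝ) hJA
    have hlim : ∀ᶠ x : ℝ × (ℝ × ℝ) in 𝓝 (Mbar N p, 0), B x.1 x.2 ∈ U := by
      refine hBc.continuousAt.eventually_mem ?_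
      rw [pointP_Mbar hN hp] at hU
      exact hB0 ▸ hU
    obtain ⟨S, hS, W, hW, hSW⟩ := mem_nhds_prod_iff.1 hlim
    have hV3' := hV3.congr_left (f₂ := fun ζ => fderiv ℝ V ζ (G (Mbar N p) ζ) +
        -(focalValue N p / 8) * (ζ.1 ^ 2 + ζ.2 ^ 2) ^ 2) fun ζ => by
      have : chartField (phaseField N p (Mbar N p)) (critX N p, critY N p)
          (shear a √((N : ℝ) - 2) hω.ne') ζ = G (Mbar N p) ζ := by
        simp only [hG, hB, chartField, shear_apply, shear_symm_apply, hα0, hβ0, hg0, sub_zero]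
        rfl
      rw [this]
      ring
    have hk : 0 < -(focalValue N p / 8) := by
      rw [hf]
      have := mul_pos hL hκ
      linarith
    have hcyc := eventually_exists_limitCycle_of_contDiffAt hω hk hGc hG0 hJ hα0 hβ0 hαpos hV1
      hV2 hV3' hW
    have hall : ∀ᶠ M in 𝓝[>] (Mbar N p),
        ∃ γ, IsLimitCycleAround (phaseField N p M) (pointP N p M) γ ∧ Set.range γ ⊆ U := by
      filter_upwards [hcyc, nhdsWithin_le_nhds hbr', nhdsWithin_le_nhds hS] with M h1 h2 h3
      obtain ⟨γ, hγ, hγW⟩ := h1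
      obtain ⟨-, h5, h6, -⟩ := h2
      rw [hchart M h6.ne'] at hγ
      rw [h5]
      refine ⟨_, hγ.of_chart, ?_⟩
      rintro _ ⟨t, rfl⟩
      exact hSW (Set.mk_mem_prod h3 (hγW ⟨t, rfl⟩))
    obtain ⟨b, hb, hb'⟩ := (mem_nhdsGT_iff_exists_Ioo_subset).1 hall
    exact ⟨b - Mbar N p, sub_pos.2 hb, fun l hl => hb' ⟨hl.1, by linarith [hl.2]⟩⟩

end Bifurcation

theorem mainTheorem9 (N : ℕ) (hN : 3 ≤ N) (p : ℝ) (hp : 1 < p) :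
    (((N : ℝ) + 2) / ((N : ℝ) - 2) < p →
      0 < Mbar N p ∧
      IsGreatest (equilibriumAbscissae N p (Mbar N p)) (pointP N p (Mbar N p)).1 ∧
      IsWeakSink (phaseField N p (Mbar N p)) (pointP N p (Mbar N p)) ∧
      IsAndronovHopfPoint (phaseField N p) (pointP N p) (Mbar N p) ∧
      LyapunovSignEq (phaseField N p (Mbar N p)) (pointP N p (Mbar N p))
        (-SignType.sign (coefL N p))) ∧
    (p < ((N : ℝ) + 2) / ((N : ℝ) - 2) →
      Mbar N p < 0 ∧
      IsGreatest (equilibriumAbscissae N p (Mbar N p)) (pointP N p (Mbar N p)).1 ∧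
      IsWeakSource (phaseField N p (Mbar N p)) (pointP N p (Mbar N p)) ∧
      LyapunovSignEq (phaseField N p (Mbar N p)) (pointP N p (Mbar N p))
        (-SignType.sign (coefL N p))) := by
  have hN' : (3 : ℝ) ≤ N := by exact_mod_cast hN
  have hN2 : 0 < (N : ℝ) - 2 := by linarith
  have hp1 : 0 < p - 1 := by linarith
  have hgr : IsGreatest (equilibriumAbscissae N p (Mbar N p)) (pointP N p (Mbar N p)).1 := by
    rw [pointP_Mbar hN hp]
    exact isGreatest_critX hN hp
  refine ⟨fun h => ?_, fun h => ?_⟩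
  · rw [div_lt_iff₀ hN2] at h
    have hL : 0 < coefL N p := div_pos (by linarith) hp1
    exact ⟨Mbar_pos hN hp hL, hgr, isWeakSink_critical hN hp hL,
      isAndronovHopfPoint_Mbar hN hp hL, lyapunovSignEq_critical hN hp⟩
  · rw [lt_div_iff₀ hN2] at h
    have hL : coefL N p < 0 := div_neg_of_neg_of_pos (by linarith) hp1
    exact ⟨Mbar_neg hN hp hL, hgr, isWeakSource_critical hN hp hL,
      lyapunovSignEq_critical hN hp⟩
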